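/- Let $T$ be a finite directed rooted tree with vertex set $V$, $|V| = n$, arcs directed from parents to children, and set of leaves $L$ (vertices without children). Let $\rho$ be an integer with $0 < \rho < |L|$. A *placement* is a set $P \subseteq L$ with $|P| = \rho$. For $e \in V$ the *failure number* $f(e,P)$ is the number of $p \in P$ reachable from $e$ (every vertex reaches itself), and the *failure aggregate* of $P$ with respect to a set $E$ of events is $\vec f(P) = \langle p_\rho, \dots, p_1, p_0\rangle$ with $p_i = |\{e \in E : f(e,P) = i\}|$. A placement is *optimal* if $\vec f(P)$ is lexicographically minimum among all placements. Consider the following divide/conquer dynamic program. *Preprocessing.* Compute for every vertex $u$ the number $\ell(u)$ of leaves, the number of vertices, and a nearest leaf in its subtree. *Divide.* A vertex $u$ is asked for $r(u)$ or $r(u)-1$ replicas, starting with $r(\mathrm{root}) = \rho$. By repeated splitting at the median capacity, its children $c$ are labelled *filled* if $\sum_{c'} \min(\ell(c'),\ell(c)) < r(u)$ (sum over all children $c'$ of $u$), and *unfilled* otherwise. Filled children receive a replica on each of their leaves. With $s$ the difference of $r(u)$ and the number of leaves below filled children, and $k$ the number of unfilled children, every unfilled child $c$ is recursively asked for $r(c)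 = \lceil s/k\rceil$ or $r(c)-1$ replicas. *Conquer.* Every unfilled child $c$ returns optimal vectors $\vec a_c, \vec b_c$ (entry $i$ counts the vertices with failure number $i$) for $r(c)-1$ and $r(c)$ replicas, with placements attaining them. With $h = s - k(\lceil s/k\rceil - 1)$, linear-time selection (median of medians) finds the $h$ children with the lexicographically smallest $\vec b_c - \vec a_c$, ordered so that the $h$-th has the largest value among them. The vector of $u$ for $r(u)$ replicas is the sum of $\vec b_c$ over these $h$ children, of $\vec a_c$ over the other unfilled children, of the aggregates of the filled children, and of the unit vector for $u$; for $r(u)-1$ replicas only the first $h-1$ of them contribute $\vec b_c$. The decisions are recorded, and at the end the placement found for $\rho$ replicas at the root is written out. There are three versions. 1. *Basic version*: all vectors have length $\rho+1$ and the recursion ends at the leaves. 2. *Compact version*: the vectors returned by $u$ have length $r(u)+1$; the recursion ends already when $r(u)=1$, where a nearest leaf is chosen; in the preprocessing every path of vertices with exactly one child is contracted together with the vertex below it into one pseudonode that stores the number of contracted vertices. 3. *Chain version*: compact vectors and the end of the recursion at $r(u)=1$ as in version 2, without its path contraction; instead, between the divide and the conquer phase, every degenerate chain, that is, every maximal path of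 vertices $u$ with $r(u) \ge 2$ that have exactly one unfilled child, is contracted into one pseudonode that stores the contributions of the path and of its filled subtrees to the two vectors returned. Time is counted in elementary steps at unit cost: arithmetic and comparison of numbers, reading or writing one array entry, inspecting or constructing one list, record or tree cell; allocating an array of length $m$ costs $m+1$ steps. Then each of the three versions outputs the elements of an optimal placement $P$, without repetition, and its failure aggregate with respect to $E = V$. This placement is optimal both for $E = V$ and for $E = V \setminus L$. Moreover there is an absolute constant $K$ such that for all $T$ and $\rho$ as above the numbers of steps are at most 1. $K\, n\rho$ for the basic version, 2. $K\,(n + \rho^2)$ for the compact version, 3. $K\,(n + \rho \log \rho)$ for the chain version. -/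

import Mathlib

namespace ReplicaPlacement

/-! ## The placement problem -/

section Model

variable {V : Type}

open Classical in
/-- The number of elements of `P` reachable from the event `e` along arcs of `A`
(every vertex reaches itself). -/
noncomputable def failureNumber (A : V → V → Prop) (e : V) (P : Finset V) : ℕ :=
  (P.filter fun p => Relation.ReflTransGen A e p).card

open Classical in
/-- The number of events in `E` whose failure number is `i`. -/
noncomputable def failureCount (A : V → V → Prop) (E P : Finset V) (i : ℕ) : ℕ :=
  (E.filter fun e => failureNumber A e P = i).card

/-- The failure aggregate `⟨p_ρ, …, p_1, p_0⟩`, as an element of `ℕ ^ (ρ + 1)` with the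
lexicographic order. -/
noncomputable def failureAggregate (A : V → V → Prop) (E : Finset V) (ρ : ℕ) (P : Finset V) :
    Lex (Fin (ρ + 1) → ℕ) :=
  toLex fun i => failureCount A E P (ρ - i)

/-- A placement of size `ρ` on the candidate set `C`. -/
def IsPlacement (C : Finset V) (ρ : ℕ) (P : Finset V) : Prop :=
  P ⊆ C ∧ P.card = ρ

/-- `P` solves the placement problem with arcs `A`, events `E`, candidates `C` and size `ρ`. -/
def IsLexicominimum (A : V → V → Prop) (E C : Finset V) (ρ : ℕ) (P : Finset V) : Prop :=
  IsPlacement C ρ P ∧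
    ∀ P', IsPlacement C ρ P' → failureAggregate A E ρ P ≤ failureAggregate A E ρ P'

open Classical in
/-- The vertices without outgoing arcs. -/
noncomputable def leafSet [Fintype V] (A : V → V → Prop) : Finset V :=
  Finset.univ.filter fun v => ∀ w, ¬ A v w

end Model

/-! ## Rooted trees as data -/

/-- A rooted tree: a vertex together with the list of the subtrees at its children. -/
inductive RoseTree (V : Type) where
  | node (v : V) (children : List (RoseTree V))

namespace RoseTree

variable {V : Type}

/-- The vertex at the root. -/
def root : RoseTree V → V
  | node v _ => v

mutual
/-- All vertices of a tree. -/
def vertices : RoseTree V → List V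
  | node v cs => v :: verticesList cs
/-- All vertices of a list of trees. -/
def verticesList : List (RoseTree V) → List V
  | [] => []
  | c :: cs => vertices c ++ verticesList cs
end

mutual
/-- All pairs (parent, child) of a tree. -/
def arcs : RoseTree V → List (V × V)
  | node v cs => cs.map (fun c => (v, c.root)) ++ arcsList cs
/-- All pairs (parent, child) of a list of trees. -/
def arcsList : List (RoseTree V) → List (V × V)
  | [] => []
  | c :: cs => arcs c ++ arcsList cs
end

/-- `t` is a description of the directed graph on `V` with arc relation `A`; this graph is then a
directed rooted tree. -/
def Represents (t : RoseTree V) (A : V → V → Prop) : Prop :=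
  t.vertices.Nodup ∧ (∀ v, v ∈ t.vertices) ∧ ∀ u v, A u v ↔ (u, v) ∈ t.arcs

end RoseTree

/-! ## Step counting

A computation carries its value and the number of steps it has used. The only sources of steps are
`op`, which stands for one step of a random access machine with unit cost, and `zeros`, which
allocates an array. Every argument of `op` below is a bounded combination of arithmetic operations
and comparisons of numbers, accesses to one entry of an array, writes of one entry of an array,
constructions of one cell of a list, record or tree, and inspections of the head of a list. Arrays
that are written to are never used again in their old state, so that writing is done in place. -/

/-- A value together with the number of steps used to compute it. -/
structure Timed (α : Type) where
  val : α
  time : ℕ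

instance : Monad Timed where
  pure a := ⟨a, 0⟩
  bind x f := ⟨(f x.val).val, x.time + (f x.val).time⟩

/-- One elementary step with result `a`. -/
def op {α : Type} (a : α) : Timed α := ⟨a, 1⟩

/-- Allocation of an array of length `n` filled with zeros. -/
def zeros (n : ℕ) : Timed (Array ℕ) := ⟨Array.replicate n 0, n + 1⟩

/-! ### Lists -/

section Lists

variable {α β : Type}

/-- The length of a list. -/
def count : List α → Timed ℕ
  | [] => op 0
  | _ :: xs => do
    let n ← count xs
    op (n + 1)

/-- Concatenation, in time linear in the first list. -/
def append : List α → List α → Timed (List α)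
  | [], ys => op ys
  | x :: xs, ys => do
    let zs ← append xs ys
    op (x :: zs)

/-- The list of the results of `f`. -/
def mapList (f : α → Timed β) : List α → Timed (List β)
  | [] => op []
  | x :: xs => do
    let y ← f x
    let ys ← mapList f xs
    op (y :: ys)

/-- The entry at position `i` (counted from `0`). -/
def nth : List α → ℕ → Timed (Option α)
  | [], _ => op none
  | x :: _, 0 => op (some x)
  | _ :: xs, i + 1 => do
    let j ← op i
    nth xs j

end Lists

/-! ### Linear-time selection -/

section Selection

variable {α : Type} (cmp : α → α → Timed Ordering)

/-- The three parts of a list relative to a pivot. -/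
structure Parts (α : Type) where
  lt : List α
  eq : List α
  gt : List α

/-- Partition of a list by comparison with the pivot `p`. -/
def partition (p : α) : List α → Timed (Parts α)
  | [] => op ⟨[], [], []⟩
  | x :: xs => do
    let s ← partition p xs
    let o ← cmp x p
    op (match o with
      | .lt => { s with lt := x :: s.lt }
      | .eq => { s with eq := x :: s.eq }
      | .gt => { s with gt := x :: s.gt })

/-- Insertion into a sorted list. -/
def insertSorted (x : α) : List α → Timed (List α)
  | [] => op [x]
  | y :: ys => do
    let o ← cmp x y
    match o with
    | .gt => do
      let zs ← insertSorted x ys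
      op (y :: zs)
    | _ => op (x :: y :: ys)

/-- Insertion sort, used for lists of bounded length only. -/
def insertionSort : List α → Timed (List α)
  | [] => op []
  | x :: xs => do
    let ys ← insertionSort xs
    insertSorted cmp x ys

/-- The medians of the consecutive blocks of five. -/
def medians : List α → Timed (List α)
  | a :: b :: c :: d :: e :: xs => do
    let s ← insertionSort cmp [a, b, c, d, e]
    let m ← nth s 2
    let ms ← medians xs
    op (match m with
      | some y => y :: ms
      | none => ms)
  | _ => op []

/-- Selection of an element of rank `i` (counted from `0`) by the median of medians. The first
argument bounds the depth of the recursion; the length of the list is enough. -/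
def select : ℕ → List α → ℕ → Timed (Option α)
  | 0, _, _ => op none
  | fuel + 1, xs, i => do
    let n ← count xs
    let small ← op (decide (n < 30))
    if small then
      let ys ← insertionSort cmp xs
      nth ys i
    else
      let ms ← medians cmp xs
      let j ← op (n / 10)
      let pivot ← select fuel ms j
      match pivot with
      | none => op none
      | some p =>
        let s ← partition cmp p xs
        let a ← count s.lt
        let b ← count s.eq
        let inLt ← op (decide (i < a))
        let inEq ← op (decide (i < a + b))
        if inLt then
          select fuel s.lt i
        else if inEq then
          op (some p)
        else
          let k ← op (i - (a + b))
          select fuel s.gt k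

end Selection

/-! ## Preprocessing -/

/-- A tree with the numbers that the algorithm needs at its vertices. A node may stand for a
contracted path of `weight` vertices; without contraction `weight = 1`. -/
structure InfoTree (V : Type) where
  /-- number of vertices that the root stands for -/
  weight : ℕ
  /-- number of leaves -/
  leaves : ℕ
  /-- number of vertices -/
  size : ℕ
  /-- number of vertices on a shortest path from the root to a leaf -/
  depth : ℕ
  /-- a leaf at the end of such a path -/
  nearest : V
  children : List (InfoTree V)

section Preprocessing

variable {V : Type}

/-- Node of weight one with first child `c` and the further children `cs`. -/
def joinInfo (c : InfoTree V) : List (InfoTree V) → Timed (InfoTree V)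
  | [] => op ⟨1, c.leaves, c.size + 1, c.depth + 1, c.nearest, [c]⟩
  | d :: ds => do
    let t ← joinInfo d ds
    let closer ← op (decide (c.depth + 1 < t.depth))
    if closer then
      op ⟨1, c.leaves + t.leaves, c.size + t.size, c.depth + 1, c.nearest, c :: t.children⟩
    else
      op ⟨1, c.leaves + t.leaves, c.size + t.size, t.depth, t.nearest, c :: t.children⟩

mutual
/-- Computes the numbers of leaves and of vertices and the nearest leaves. If `contract` is set,
every path of vertices with one child is merged with the vertex below it. -/
def annotate (contract : Bool) : RoseTree V → Timed (InfoTree V)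
  | .node v cs => do
    let ds ← annotateList contract cs
    match ds with
    | [] => op ⟨1, 1, 1, 1, v, []⟩
    | [d] =>
      if contract then
        op { d with weight := d.weight + 1, size := d.size + 1, depth := d.depth + 1 }
      else
        joinInfo d []
    | d :: e :: es => joinInfo d (e :: es)
/-- The same for a list of trees. -/
def annotateList (contract : Bool) : List (RoseTree V) → Timed (List (InfoTree V))
  | [] => op []
  | c :: cs => do
    let d ← annotate contract c
    let ds ← annotateList contract cs
    op (d :: ds)
end

end Preprocessing

/-! ## Divide phase -/

section Divide

variable {V : Type}

/-- Comparison of the capacities of two children. -/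
def compareLeaves (c d : InfoTree V) : Timed Ordering :=
  op (compare c.leaves d.leaves)

/-- Sum of the capacities. -/
def sumLeaves : List (InfoTree V) → Timed ℕ
  | [] => op 0
  | c :: cs => do
    let n ← sumLeaves cs
    op (c.leaves + n)

/-- The children labelled so far, the total capacity of the filled ones and the number of the
unfilled ones. -/
structure Labelling (V : Type) where
  filled : List (InfoTree V)
  unfilled : List (InfoTree V)
  filledLeaves : ℕ
  unfilledCount : ℕ

/-- Labels the children in `M` as filled or unfilled, where `r` replicas are to be placed below
their parent. Each round finds the median capacity in `M` and labels at least half of `M`. The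
first argument bounds the number of rounds; the length of `M` is enough. -/
def getFilled (r : ℕ) : ℕ → List (InfoTree V) → Labelling V → Timed (Labelling V)
  | 0, _, D => op D
  | _ + 1, [], D => op D
  | fuel + 1, c :: cs, D => do
    let n ← count (c :: cs)
    let i ← op (n / 2)
    let median ← select compareLeaves n (c :: cs) i
    match median with
    | none => op D
    | some m =>
      let s ← partition compareLeaves m (c :: cs)
      let sumLt ← sumLeaves s.lt
      let sumEq ← sumLeaves s.eq
      let numEq ← count s.eq
      let numGt ← count s.gt
      let total ← op (D.filledLeaves + sumLt + sumEq)
      let rest ← op (m.leaves * (D.unfilledCount + numGt))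
      let fills ← op (decide (total + rest < r))
      if fills then
        let F ← append s.eq D.filled
        let F ← append s.lt F
        let D ← op { D with filled := F, filledLeaves := total }
        getFilled r fuel s.gt D
      else
        let U ← append s.eq D.unfilled
        let U ← append s.gt U
        let D ← op { D with unfilled := U, unfilledCount := D.unfilledCount + numEq + numGt }
        getFilled r fuel s.lt D

end Divide

/-- The leaves chosen for a subtree, as a record of the decisions made. -/
inductive Plan (V : Type) where
  /-- no leaf -/
  | empty
  /-- one leaf -/
  | leaf (v : V)
  /-- all leaves of a tree -/
  | all (t : InfoTree V)
  /-- both parts -/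
  | join (p q : Plan V)

/-- The tree of subproblems. A node `u` that is asked for `r` or `r - 1` replicas carries this `r`,
its weight, its filled children, the subproblems at its unfilled children, and the number `high` of
unfilled children that receive the larger number of replicas when `u` receives `r`. -/
inductive DividedTree (V : Type) where
  /-- a tree that is asked for one or no replica, not to be divided further -/
  | single (t : InfoTree V)
  | node (r weight : ℕ) (filled : List (InfoTree V)) (unfilled : List (DividedTree V)) (high : ℕ)
  /-- the pseudonode of a contracted chain above `child`, with the contributions of the chain and
  of the filled subtrees attached to it to the two vectors, and the leaves of these subtrees -/
  | pseudo (lo hi : Array ℕ) (plan : Plan V) (child : DividedTree V)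

section Divide

variable {V : Type}

/-- Divide phase for a node that is asked for `r` or `r - 1` replicas. The recursion ends at the
leaves, and already at `r = 1` if `early` is set. The numerical argument bounds its depth; the
number of vertices is enough. -/
def divide (early : Bool) : ℕ → InfoTree V → ℕ → Timed (DividedTree V)
  | 0, t, _ => op (.single t)
  | fuel + 1, t, r => do
    let done ← op (t.children.isEmpty || (early && decide (r = 1)))
    if done then
      op (.single t)
    else
      let n ← count t.children
      let D ← getFilled r n t.children ⟨[], [], 0, 0⟩
      -- `s` replicas for the `k` unfilled children: `⌈s / k⌉` or one less for each of them
      let s ← op (r - D.filledLeaves)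
      let k ← op D.unfilledCount
      let q ← op ((s + k - 1) / k)
      let high ← op (s - k * (q - 1))
      let us ← mapList (fun c => divide early fuel c q) D.unfilled
      op (.node r t.weight D.filled us high)

end Divide

/-! ## Vectors

The entry at index `i` of a vector is the number of vertices with failure number `i`. -/

section Vectors

variable {V : Type}

/-- Adds `x` to the entry at index `i`. -/
def addAt (w : Array ℕ) (i x : ℕ) : Timed (Array ℕ) :=
  op (w.setIfInBounds i (w.getD i 0 + x))

/-- Adds the first `m` entries of `v` to those of `w`. -/
def addEntries (v : Array ℕ) : ℕ → Array ℕ → Timed (Array ℕ)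
  | 0, w => op w
  | m + 1, w => do
    let w ← addAt w m (v.getD m 0)
    addEntries v m w

/-- Adds `v` to `w`, in time linear in the length of `v`. -/
def addVector (v w : Array ℕ) : Timed (Array ℕ) :=
  addEntries v v.size w

mutual
/-- Adds the failure aggregate of a filled tree to `w`. -/
def addFilled : InfoTree V → Array ℕ → Timed (Array ℕ)
  | ⟨weight, leaves, _, _, _, cs⟩, w => do
    let w ← addAt w leaves weight
    addFilledList cs w
/-- Adds the failure aggregates of filled trees to `w`. -/
def addFilledList : List (InfoTree V) → Array ℕ → Timed (Array ℕ)
  | [], w => op w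
  | c :: cs, w => do
    let w ← addFilled c w
    addFilledList cs w
end

/-- All leaves of the given trees, added to a plan. -/
def planFilled : List (InfoTree V) → Plan V → Timed (Plan V)
  | [], p => op p
  | c :: cs, p => do
    let q ← op (.join (.all c) p)
    planFilled cs q

end Vectors

/-! ## Transform phase -/

/-- The contribution of a chain: `lo` and `hi` for the vertices of the chain when the top of the
chain receives `r - 1` or `r` replicas, `filled` for the filled subtrees attached to it. -/
structure Contribution (V : Type) where
  lo : Array ℕ
  hi : Array ℕ
  filled : Array ℕ
  plan : Plan V

section Transform

variable {V : Type}

/-- The contribution of an empty chain: three vectors of the given length, if there is one. -/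
def emptyContribution : Option ℕ → Timed (Contribution V)
  | none => op ⟨#[], #[], #[], .empty⟩
  | some r => do
    let lo ← zeros (r + 1)
    let hi ← zeros (r + 1)
    let f ← zeros (r + 1)
    op ⟨lo, hi, f, .empty⟩

/-- Pseudonode of a chain above `x`. -/
def makePseudonode (a : Contribution V) (x : DividedTree V) : Timed (DividedTree V) := do
  let lo ← addVector a.filled a.lo
  let hi ← addVector a.filled a.hi
  op (.pseudo lo hi a.plan x)

mutual
/-- Contracts every maximal chain of nodes with exactly one unfilled child. The second argument is
`none` outside a chain, and inside a chain it is `some r`, where the top of the chain is asked for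
`r` or `r - 1` replicas. -/
def transform : DividedTree V → Option ℕ → Timed (Contribution V × DividedTree V)
  | .node r weight filled [v] _, chain => do
    let length ← op (chain.getD r)
    let below ← transform v (some length)
    let f ← addFilledList filled below.1.filled
    let plan ← planFilled filled below.1.plan
    let lo ← addAt below.1.lo (r - 1) weight
    let hi ← addAt below.1.hi r weight
    let a ← op (⟨lo, hi, f, plan⟩ : Contribution V)
    match chain with
    | none => do
      let x ← makePseudonode a below.2
      let e ← emptyContribution none
      op (e, x)
    | some _ => op (a, below.2)
  | .node r weight filled us high, chain => do
    let vs ← transformList us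
    let a ← emptyContribution chain
    op (a, .node r weight filled vs high)
  | d, chain => do
    let a ← emptyContribution chain
    op (a, d)
/-- The same for a list of nodes outside chains. -/
def transformList : List (DividedTree V) → Timed (List (DividedTree V))
  | [] => op []
  | d :: ds => do
    let x ← transform d none
    let xs ← transformList ds
    op (x.2 :: xs)
end

end Transform

/-! ## Conquer phase -/

/-- Optimal solutions for a node that is asked for `r - 1` (`lo`) or `r` (`hi`) replicas: failure
aggregates and leaves. -/
structure Solution (V : Type) where
  lo : Array ℕ
  hi : Array ℕ
  loPlan : Plan V
  hiPlan : Plan V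

section Conquer

variable {V : Type}

/-- Lexicographic comparison of `x.hi - x.lo` with `y.hi - y.lo` on the first `m` entries, where
the entries with large indices count first. -/
def compareEntries (x y : Solution V) : ℕ → Timed Ordering
  | 0 => op .eq
  | m + 1 => do
    let a ← op ((x.hi.getD m 0 : ℤ) - x.lo.getD m 0)
    let b ← op ((y.hi.getD m 0 : ℤ) - y.lo.getD m 0)
    let o ← op (compare a b)
    match o with
    | .eq => compareEntries x y m
    | o => op o

/-- Lexicographic comparison of `x.hi - x.lo` with `y.hi - y.lo`. -/
def compareGain (x y : Solution V) : Timed Ordering :=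
  compareEntries x y x.hi.size

/-- Moves `m` solutions with the smallest values of `hi - lo` to the front, where `m ≥ 1`; the one
at position `m - 1` has the largest value among them. -/
def bringForward (m : ℕ) (xs : List (Solution V)) : Timed (List (Solution V)) := do
  let n ← count xs
  let pivot ← select compareGain n xs (m - 1)
  match pivot with
  | none => op xs
  | some p =>
    let s ← partition compareGain p xs
    let ys ← append s.eq s.gt
    append s.lt ys

/-- Adds the solutions `hi` of the first `m` children and `lo` of the others. -/
def combine : ℕ → List (Solution V) → Array ℕ → Plan V → Timed (Array ℕ × Plan V)
  | _, [], w, p => op (w, p)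
  | 0, x :: xs, w, p => do
    let w ← addVector x.lo w
    let p ← op (.join x.loPlan p)
    combine 0 xs w p
  | m + 1, x :: xs, w, p => do
    let w ← addVector x.hi w
    let p ← op (.join x.hiPlan p)
    combine m xs w p

mutual
/-- Conquer phase. The vectors of a node that is asked for `r` or `r - 1` replicas have length
`dim r`. -/
def conquer (dim : ℕ → ℕ) : DividedTree V → Timed (Solution V)
  | .single t => do
    let lo ← zeros (dim 1)
    let lo ← addAt lo 0 t.size
    let hi ← zeros (dim 1)
    let hi ← addAt hi 0 (t.size - t.depth)
    let hi ← addAt hi 1 t.depth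
    op ⟨lo, hi, .empty, .leaf t.nearest⟩
  | .node r weight filled us high => do
    let sols ← conquerList dim us
    let xs ← bringForward high sols
    let f ← zeros (dim r)
    let f ← addFilledList filled f
    let plan ← planFilled filled .empty
    let lo ← zeros (dim r)
    let lo ← addVector f lo
    let lo ← addAt lo (r - 1) weight
    let hi ← zeros (dim r)
    let hi ← addVector f hi
    let hi ← addAt hi r weight
    let a ← combine (high - 1) xs lo plan
    let b ← combine high xs hi plan
    op ⟨a.1, b.1, a.2, b.2⟩
  | .pseudo lo hi plan child => do
    let x ← conquer dim child
    let lo ← addVector x.lo lo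
    let hi ← addVector x.hi hi
    op ⟨lo, hi, .join plan x.loPlan, .join plan x.hiPlan⟩
/-- The same for a list of nodes. -/
def conquerList (dim : ℕ → ℕ) : List (DividedTree V) → Timed (List (Solution V))
  | [] => op []
  | d :: ds => do
    let x ← conquer dim d
    let xs ← conquerList dim ds
    op (x :: xs)
end

end Conquer

/-! ## Output -/

section Output

variable {V : Type}

mutual
/-- Writes all leaves of a tree in front of a list. -/
def writeLeaves : InfoTree V → List V → Timed (List V)
  | ⟨_, _, _, _, v, []⟩, out => op (v :: out)
  | ⟨_, _, _, _, _, c :: cs⟩, out => writeLeavesList (c :: cs) out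
/-- Writes all leaves of some trees in front of a list. -/
def writeLeavesList : List (InfoTree V) → List V → Timed (List V)
  | [], out => op out
  | c :: cs, out => do
    let out ← writeLeavesList cs out
    writeLeaves c out
end

/-- Writes the leaves of a plan in front of a list. -/
def writePlan : Plan V → List V → Timed (List V)
  | .empty, out => op out
  | .leaf v, out => op (v :: out)
  | .all t, out => writeLeaves t out
  | .join p q, out => do
    let out ← writePlan q out
    let out ← writePlan p out
    op out

/-- The chosen leaves and the failure aggregate. -/
def output (x : Solution V) : Timed (List V × Array ℕ) := do
  let P ← writePlan x.hiPlan []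
  op (P, x.hi)

/-! ## The three versions of the algorithm -/

/-- The basic version: all vectors have length `ρ + 1`, and the recursion ends at the leaves. -/
def basicAlgorithm (t : RoseTree V) (ρ : ℕ) : Timed (List V × Array ℕ) := do
  let a ← annotate false t
  let d ← divide false a.size a ρ
  let x ← conquer (fun _ => ρ + 1) d
  output x

/-- The version with compact vectors, in which paths of vertices with one child are contracted
and the recursion ends at `r = 1`. -/
def compactAlgorithm (t : RoseTree V) (ρ : ℕ) : Timed (List V × Array ℕ) := do
  let a ← annotate true t
  let d ← divide true a.size a ρ
  let x ← conquer (fun r => r + 1) d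
  output x

/-- The version with compact vectors in which degenerate chains, that is, paths of vertices with
one unfilled child, are contracted between the divide and the conquer phase. -/
def chainAlgorithm (t : RoseTree V) (ρ : ℕ) : Timed (List V × Array ℕ) := do
  let a ← annotate false t
  let d ← divide true a.size a ρ
  let d' ← transform d none
  let x ← conquer (fun r => r + 1) d'.2
  output x

end Output

open Classical in
/-- The output lists, without repetition, the vertices of a placement of size `ρ` on the leaves
that is lexicominimum, whether or not the leaves are themselves counted as events, together with
its failure aggregate over all vertices. -/
def IsSolution {V : Type} [Fintype V] (A : V → V → Prop) (ρ : ℕ) (out : List V × Array ℕ) : Prop :=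
  out.1.Nodup ∧
  IsLexicominimum A Finset.univ (leafSet A) ρ out.1.toFinset ∧
  IsLexicominimum A (Finset.univ \ leafSet A) (leafSet A) ρ out.1.toFinset ∧
  out.2.size = ρ + 1 ∧
  ∀ i ≤ ρ, out.2.getD i 0 = failureCount A Finset.univ out.1.toFinset i

end ReplicaPlacement

namespace ReplicaPlacement

/-! ## Values and times of computations -/

-- Encoding. A failure aggregate is read as a polynomial over ℕ whose coefficient at `i` counts the
-- vertices with failure number `i`. Evaluated at a base `B` larger than twice the number of
-- vertices it becomes a single number, the cost, and lexicographic comparison becomes comparison of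
-- numbers (`digitSum_lt_digitSum`, `toLex_le_of_digitSum_le`). Costs of disjoint subtrees add, and
-- the differences `hi - lo`, whose entries may be negative, become integers. The base occurs in the
-- proof only, not in the algorithm.
--
-- Correctness. In a cheapest distribution of leaves to the children of a vertex, a child that is
-- not full has at most one leaf less than any other child. Otherwise moving one leaf to it removes
-- a term `B ^ a` at the root of the richer child and creates only terms of lower degree, too few to
-- compensate (`Share.num_le_num_add_one`). With the labelling criterion this forces filled children
-- to be full and every unfilled child to receive `q - 1` or `q` leaves, where `q = ⌈s/k⌉`
-- (`Split.num_bounds`). It remains to choose which unfilled children receive `q`. Those with the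
-- smallest price `hi - lo` are best, by a Lagrange multiplier at the price of the last one chosen
-- (`Split.optimal_combinedShare`). The same threshold serves `r` and `r - 1`, so one selection
-- yields both vectors. Induction over the tree of subproblems gives least cost at the root, and
-- `isSolution_output` translates this back to the graph. For a placement of given size the leaves
-- have a fixed contribution to the aggregate, so the events `V` and `V \ L` have the same optimal
-- placements.
--
-- Time. Selection is linear (`select_spec`), labelling halves the list of open children in each
-- round (`getFilled_spec`), and so preprocessing, divide phase and output are linear in the number
-- of vertices. In the conquer phase a node with `k` unfilled children costs about `k` times the
-- length of their vectors, plus the length of its own vectors and the size of its filled subtrees.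
-- Each bound is an induction with slack: the bound for a subproblem leaves enough unspent to pay
-- for its share of the work at its parent. The basic version charges `ρ` per vertex. The compact
-- version uses the potential `(r - 1)²`, which decreases at every node because no vertex has
-- exactly one child (`IsDivision.conquers_compact`). The chain version uses `(r - 1) log (r - 1)`,
-- which decreases at nodes with at least two unfilled children; along a chain full-length vectors
-- are handled only a bounded number of times (`IsDivision.chainSpec`).

@[simp] theorem Timed.val_bind {α β : Type} (x : Timed α) (f : α → Timed β) :
    (x >>= f).val = (f x.val).val := rfl

@[simp] theorem Timed.time_bind {α β : Type} (x : Timed α) (f : α → Timed β) :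
    (x >>= f).time = x.time + (f x.val).time := rfl

@[simp] theorem op_val {α : Type} (a : α) : (op a).val = a := (rfl)

@[simp] theorem op_time {α : Type} (a : α) : (op a).time = 1 := rfl

@[simp] theorem zeros_val (n : ℕ) : (zeros n).val = Array.replicate n 0 := rfl

@[simp] theorem zeros_time (n : ℕ) : (zeros n).time = n + 1 := rfl

section Lists

variable {α β : Type}

@[simp] theorem count_val (xs : List α) : (count xs).val = xs.length := by
  induction xs with
  | nil => rfl
  | cons x xs ih => simp [count, ih]

@[simp] theorem count_time (xs : List α) : (count xs).time = xs.length + 1 := by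
  induction xs with
  | nil => rfl
  | cons x xs ih => simp [count, ih]

@[simp] theorem append_val (xs ys : List α) : (append xs ys).val = xs ++ ys := by
  induction xs with
  | nil => rfl
  | cons x xs ih => simp [append, ih]

@[simp] theorem append_time (xs ys : List α) : (append xs ys).time = xs.length + 1 := by
  induction xs with
  | nil => rfl
  | cons x xs ih => simp [append, ih]

@[simp] theorem mapList_val (f : α → Timed β) (xs : List α) :
    (mapList f xs).val = xs.map fun x => (f x).val := by
  induction xs with
  | nil => rfl
  | cons x xs ih => simp [mapList, ih]

@[simp] theorem mapList_time (f : α → Timed β) (xs : List α) :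
    (mapList f xs).time = (xs.map fun x => (f x).time).sum + xs.length + 1 := by
  induction xs with
  | nil => rfl
  | cons x xs ih => simp [mapList, ih]; omega

@[simp] theorem nth_val (xs : List α) (i : ℕ) : (nth xs i).val = xs[i]? := by
  induction xs generalizing i with
  | nil => simp [nth]
  | cons x xs ih => cases i <;> simp [nth, ih]

theorem nth_time_le (xs : List α) (i : ℕ) : (nth xs i).time ≤ 2 * xs.length + 1 := by
  induction xs generalizing i with
  | nil => simp [nth]
  | cons x xs ih =>
    cases i with
    | zero => simp [nth]
    | succ i => have := ih i; simp [nth]; omega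

end Lists

/-! ## Selection -/

section Selection

variable {α κ : Type} [LinearOrder κ]

/-- On the elements of `S`, the comparison `cmp` compares the values of `key` in at most `c`
steps. -/
def ComparesBy (cmp : α → α → Timed Ordering) (key : α → κ) (c : ℕ) (S : α → Prop) : Prop :=
  ∀ x y, S x → S y → (cmp x y).val = compare (key x) (key y) ∧ (cmp x y).time ≤ c

variable {cmp : α → α → Timed Ordering} {key : α → κ} {c : ℕ} {S : α → Prop}

theorem partition_val (h : ComparesBy cmp key c S) {p : α} (hp : S p) (xs : List α)
    (hxs : ∀ x ∈ xs, S x) :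
    (partition cmp p xs).val =
      ⟨xs.filter fun x => key x < key p, xs.filter fun x => key x = key p,
        xs.filter fun x => key p < key x⟩ := by
  induction xs with
  | nil => rfl
  | cons x xs ih =>
    have hx := (h x p (hxs x (by simp)) hp).1
    simp only [partition, Timed.val_bind, op_val, ih fun y hy => hxs y (by simp [hy]), hx]
    rcases lt_trichotomy (key x) (key p) with hlt | heq | hgt
    · simp [compare_lt_iff_lt.2 hlt, hlt, hlt.ne, hlt.not_gt]
    · simp [heq]
    · simp [compare_gt_iff_gt.2 hgt, hgt, hgt.ne', hgt.not_gt]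

theorem partition_time_le (h : ComparesBy cmp key c S) {p : α} (hp : S p) (xs : List α)
    (hxs : ∀ x ∈ xs, S x) : (partition cmp p xs).time ≤ (c + 1) * xs.length + 1 := by
  induction xs with
  | nil => simp [partition]
  | cons x xs ih =>
    have hx := (h x p (hxs x (by simp)) hp).2
    have := ih fun y hy => hxs y (by simp [hy])
    simp only [partition, Timed.time_bind, op_time, List.length_cons, mul_add]
    omega

theorem insertSorted_perm (x : α) (xs : List α) : (insertSorted cmp x xs).val.Perm (x :: xs) := by
  induction xs with
  | nil => simp [insertSorted]
  | cons y ys ih =>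
    simp only [insertSorted, Timed.val_bind]
    cases (cmp x y).val
    · simp
    · simp
    · simpa using (ih.cons y).trans (List.Perm.swap x y ys)

theorem insertSorted_sorted (h : ComparesBy cmp key c S) (x : α) (hx : S x) (xs : List α)
    (hxs : ∀ y ∈ xs, S y) (hs : xs.Pairwise fun a b => key a ≤ key b) :
    (insertSorted cmp x xs).val.Pairwise fun a b => key a ≤ key b := by
  induction xs with
  | nil => simp [insertSorted]
  | cons y ys ih =>
    have hxy := (h x y hx (hxs y (by simp))).1
    have ih := ih (fun z hz => hxs z (by simp [hz])) hs.of_cons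
    simp only [insertSorted, Timed.val_bind, hxy]
    rw [List.pairwise_cons] at hs
    have key_le : key x ≤ key y → (x :: y :: ys).Pairwise fun a b => key a ≤ key b := by
      intro hle
      rw [List.pairwise_cons, List.pairwise_cons]
      refine ⟨fun z hz => ?_, hs⟩
      rcases List.mem_cons.1 hz with rfl | hz
      · exact hle
      · exact hle.trans (hs.1 z hz)
    rcases lt_trichotomy (key x) (key y) with hlt | heq | hgt
    · simp only [compare_lt_iff_lt.2 hlt, op_val]
      exact key_le hlt.le
    · simp only [compare_eq_iff_eq.2 heq, op_val]
      exact key_le heq.le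
    · simp only [compare_gt_iff_gt.2 hgt, Timed.val_bind, op_val]
      rw [List.pairwise_cons]
      refine ⟨fun z hz => ?_, ih⟩
      rcases List.mem_cons.1 ((insertSorted_perm x ys).subset hz) with rfl | hz
      · exact hgt.le
      · exact hs.1 z hz

theorem insertSorted_time_le (h : ComparesBy cmp key c S) (x : α) (hx : S x) (xs : List α)
    (hxs : ∀ y ∈ xs, S y) : (insertSorted cmp x xs).time ≤ (c + 1) * xs.length + 1 := by
  induction xs with
  | nil => simp [insertSorted]
  | cons y ys ih =>
    have hxy := (h x y hx (hxs y (by simp))).2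
    have ih := ih (fun z hz => hxs z (by simp [hz]))
    simp only [insertSorted, Timed.time_bind, List.length_cons, mul_add]
    cases (cmp x y).val <;> simp <;> omega

theorem insertionSort_perm (xs : List α) : (insertionSort cmp xs).val.Perm xs := by
  induction xs with
  | nil => simp [insertionSort]
  | cons x xs ih =>
    simp only [insertionSort, Timed.val_bind]
    exact (insertSorted_perm _ _).trans (ih.cons x)

theorem insertionSort_sorted (h : ComparesBy cmp key c S) (xs : List α) (hxs : ∀ y ∈ xs, S y) :
    (insertionSort cmp xs).val.Pairwise fun a b => key a ≤ key b := by
  induction xs with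
  | nil => simp [insertionSort]
  | cons x xs ih =>
    simp only [insertionSort, Timed.val_bind]
    refine insertSorted_sorted h x (hxs x (by simp)) _ (fun y hy => ?_)
      (ih fun y hy => hxs y (by simp [hy]))
    exact hxs y (by simp [(insertionSort_perm xs).subset hy])

theorem insertionSort_time_le (h : ComparesBy cmp key c S) (xs : List α) (hxs : ∀ y ∈ xs, S y) :
    (insertionSort cmp xs).time ≤ (c + 1) * xs.length ^ 2 + xs.length + 1 := by
  induction xs with
  | nil => simp [insertionSort]
  | cons x xs ih =>
    have ih := ih fun y hy => hxs y (by simp [hy])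
    have := insertSorted_time_le h x (hxs x (by simp)) (insertionSort cmp xs).val
      (fun y hy => hxs y (by simp [(insertionSort_perm xs).subset hy]))
    rw [(insertionSort_perm xs).length_eq] at this
    simp only [insertionSort, Timed.time_bind, List.length_cons]
    nlinarith

theorem insertionSort_five (h : ComparesBy cmp key c S) {x₁ x₂ x₃ x₄ x₅ : α}
    (hxs : ∀ y ∈ [x₁, x₂, x₃, x₄, x₅], S y) :
    ∃ y₁ y₂ y₃ y₄ y₅, (insertionSort cmp [x₁, x₂, x₃, x₄, x₅]).val = [y₁, y₂, y₃, y₄, y₅] ∧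
      [y₁, y₂, y₃, y₄, y₅].Perm [x₁, x₂, x₃, x₄, x₅] ∧ key y₁ ≤ key y₃ ∧ key y₂ ≤ key y₃ ∧
      key y₃ ≤ key y₄ ∧ key y₃ ≤ key y₅ := by
  have hp := insertionSort_perm (cmp := cmp) [x₁, x₂, x₃, x₄, x₅]
  have hs := insertionSort_sorted h _ hxs
  have hl := hp.length_eq
  generalize (insertionSort cmp [x₁, x₂, x₃, x₄, x₅]).val = ys at hp hs hl
  match ys, hl with
  | [y₁, y₂, y₃, y₄, y₅], _ =>
    refine ⟨y₁, y₂, y₃, y₄, y₅, rfl, hp, ?_⟩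
    simp only [List.pairwise_cons, List.mem_cons, forall_eq_or_imp] at hs
    tauto

theorem medians_length (xs : List α) : (medians cmp xs).val.length = xs.length / 5 := by
  induction xs using medians.induct with
  | case1 x₁ x₂ x₃ x₄ x₅ xs ih =>
    simp only [medians, Timed.val_bind, op_val, nth_val]
    have hl := (insertionSort_perm (cmp := cmp) [x₁, x₂, x₃, x₄, x₅]).length_eq
    generalize (insertionSort cmp [x₁, x₂, x₃, x₄, x₅]).val = ys at hl
    match ys, hl with
    | [y₁, y₂, y₃, y₄, y₅], _ => simp [ih]; omega
  | case2 xs h =>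
    rw [medians.eq_2 _ _ h]
    match xs, h with
    | [], _ => simp
    | [_], _ => simp
    | [_, _], _ => simp
    | [_, _, _], _ => simp
    | [_, _, _, _], _ => simp
    | a :: b :: c :: d :: e :: t, h => exact absurd rfl (h a b c d e t)

theorem mem_of_mem_medians (xs : List α) {y : α} (hy : y ∈ (medians cmp xs).val) : y ∈ xs := by
  induction xs using medians.induct with
  | case1 x₁ x₂ x₃ x₄ x₅ xs ih =>
    simp only [medians, Timed.val_bind, op_val, nth_val] at hy
    have hp := insertionSort_perm (cmp := cmp) [x₁, x₂, x₃, x₄, x₅]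
    have hl := hp.length_eq
    generalize (insertionSort cmp [x₁, x₂, x₃, x₄, x₅]).val = ys at hl hp hy
    match ys, hl with
    | [y₁, y₂, y₃, y₄, y₅], _ =>
      simp only [List.getElem?_cons_succ, List.getElem?_cons_zero, List.mem_cons] at hy
      rcases hy with rfl | hy
      · have := hp.subset (a := y) (by simp)
        simp only [List.mem_cons, List.not_mem_nil, or_false] at this ⊢
        tauto
      · simp [ih hy]
  | case2 xs h => rw [medians.eq_2 _ _ h] at hy; simp at hy

/-- A block of five whose median is at most `p` has three members at most `p`, the median and the
two below it; symmetrically for `≥`. This is what makes the median of medians a good pivot. -/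
theorem three_mul_countP_medians_le (h : ComparesBy cmp key c S) (xs : List α)
    (hxs : ∀ y ∈ xs, S y) (p : κ) :
    3 * (medians cmp xs).val.countP (fun x => key x ≤ p) ≤ xs.countP (fun x => key x ≤ p) ∧
    3 * (medians cmp xs).val.countP (fun x => p ≤ key x) ≤ xs.countP (fun x => p ≤ key x) := by
  induction xs using medians.induct with
  | case1 x₁ x₂ x₃ x₄ x₅ xs ih =>
    have ih := ih fun y hy => hxs y (by simp [hy])
    obtain ⟨y₁, y₂, y₃, y₄, y₅, he, hp, h₁, h₂, h₄, h₅⟩ := insertionSort_five h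
      (x₁ := x₁) (x₂ := x₂) (x₃ := x₃) (x₄ := x₄) (x₅ := x₅)
      (fun y hy => hxs y (by simp only [List.mem_cons, List.not_mem_nil, or_false] at hy ⊢; tauto))
    have hc (q : α → Bool) : (x₁ :: x₂ :: x₃ :: x₄ :: x₅ :: xs).countP q =
        [y₁, y₂, y₃, y₄, y₅].countP q + xs.countP q := by
      rw [hp.countP_eq, ← List.countP_append]; rfl
    rw [hc, hc]
    simp only [medians, Timed.val_bind, op_val, nth_val, he]
    simp only [List.getElem?_cons_succ, List.getElem?_cons_zero, List.countP_cons,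
      List.countP_nil, decide_eq_true_eq]
    constructor
    · by_cases h₃ : key y₃ ≤ p
      · rw [if_pos (h₁.trans h₃), if_pos (h₂.trans h₃), if_pos h₃]; omega
      · rw [if_neg h₃]; omega
    · by_cases h₃ : p ≤ key y₃
      · rw [if_pos (h₃.trans h₄), if_pos (h₃.trans h₅), if_pos h₃]; omega
      · rw [if_neg h₃]; omega
  | case2 xs h => rw [medians.eq_2 _ _ h]; simp

theorem medians_time_le (h : ComparesBy cmp key c S) (xs : List α) (hxs : ∀ y ∈ xs, S y) :
    (medians cmp xs).time ≤ 10 * (c + 1) * xs.length + 1 := by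
  induction xs using medians.induct with
  | case1 x₁ x₂ x₃ x₄ x₅ xs ih =>
    have ih := ih fun y hy => hxs y (by simp [hy])
    have hsort := insertionSort_time_le h [x₁, x₂, x₃, x₄, x₅] (fun y hy => hxs y
      (by simp only [List.mem_cons, List.not_mem_nil, or_false] at hy ⊢; tauto))
    have hnth := nth_time_le (insertionSort cmp [x₁, x₂, x₃, x₄, x₅]).val 2
    rw [(insertionSort_perm _).length_eq] at hnth
    simp only [medians, Timed.time_bind, op_time, List.length_cons, List.length_nil] at hsort hnth ⊢
    nlinarith
  | case2 xs h => rw [medians.eq_2 _ _ h]; simp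

/-- `p` is an element of rank `i` (counted from `0`) in `xs`. -/
def HasRank (key : α → κ) (xs : List α) (i : ℕ) (p : α) : Prop :=
  p ∈ xs ∧ xs.countP (fun x => key x < key p) ≤ i ∧ i < xs.countP (fun x => key x ≤ key p)

theorem hasRank_of_sorted {xs ys : List α} (hp : ys.Perm xs)
    (hs : ys.Pairwise fun a b => key a ≤ key b) {i : ℕ} (hi : i < ys.length) :
    HasRank key xs i ys[i] := by
  have hsplit (j : ℕ) (q : α → Bool) : xs.countP q = (ys.take j).countP q + (ys.drop j).countP q := by
    rw [← hp.countP_eq, ← List.countP_append, List.take_append_drop]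
  refine ⟨hp.subset (List.getElem_mem hi), ?_, ?_⟩
  · have h1 : (ys.drop i).countP (fun x => decide (key x < key ys[i])) = 0 := by
      rw [List.countP_eq_zero]
      intro a ha
      obtain ⟨j, hj, rfl⟩ := List.mem_iff_getElem.1 ha
      simp only [List.getElem_drop, decide_eq_true_eq, not_lt]
      rcases Nat.eq_zero_or_pos j with rfl | hj'
      · simp
      · exact List.pairwise_iff_getElem.1 hs _ _ _ _ (by omega)
    have h2 := List.countP_le_length (p := fun x => decide (key x < key ys[i])) (l := ys.take i)
    rw [hsplit i, h1]
    simp only [List.length_take] at h2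
    omega
  · have h1 : (ys.take (i + 1)).countP (fun x => decide (key x ≤ key ys[i])) =
        (ys.take (i + 1)).length := by
      rw [List.countP_eq_length]
      intro a ha
      obtain ⟨j, hj, rfl⟩ := List.mem_iff_getElem.1 ha
      simp only [List.length_take] at hj
      simp only [List.getElem_take, decide_eq_true_eq]
      rcases Nat.lt_or_ge j i with hj' | hj'
      · exact List.pairwise_iff_getElem.1 hs _ _ _ _ (by omega)
      · have : j = i := by omega
        subst this; rfl
    rw [hsplit (i + 1), h1, List.length_take]
    omega

theorem countP_trichotomy (key : α → κ) (xs : List α) (p : κ) :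
    xs.countP (fun x => key x < p) + xs.countP (fun x => key x = p) =
      xs.countP (fun x => key x ≤ p) ∧
    xs.countP (fun x => key x ≤ p) + xs.countP (fun x => p < key x) = xs.length ∧
    xs.countP (fun x => key x < p) + xs.countP (fun x => p ≤ key x) = xs.length := by
  induction xs with
  | nil => simp
  | cons x xs ih =>
    simp only [List.countP_cons, List.length_cons, decide_eq_true_eq]
    rcases lt_trichotomy (key x) p with h | h | h
    · simp only [h, h.ne, h.le, h.not_ge, h.not_gt, if_true, if_false]; omega
    · simp only [h, lt_irrefl, le_refl, if_true, if_false]; omega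
    · simp only [h, h.ne', h.le, h.not_ge, h.not_gt, if_true, if_false]; omega

theorem HasRank.of_filter_lt {xs : List α} {i : ℕ} {p : κ} {q : α}
    (h : HasRank key (xs.filter fun x => key x < p) i q) : HasRank key xs i q := by
  obtain ⟨hqm, hq₁, hq₂⟩ := h
  have hqp : key q < p := by simpa using (List.mem_filter.1 hqm).2
  refine ⟨(List.mem_filter.1 hqm).1, le_trans (le_of_eq ?_) hq₁, hq₂.trans_le ?_⟩
  · rw [List.countP_filter]
    refine List.countP_congr fun x _ => ?_
    simp only [decide_eq_true_eq, Bool.and_eq_true]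
    exact ⟨fun h => ⟨h, h.trans hqp⟩, fun h => h.1⟩
  · rw [List.countP_filter]
    exact List.countP_mono_left fun x _ => by simp +contextual

theorem HasRank.of_filter_gt {xs : List α} {i : ℕ} {p : κ} {q : α}
    (h : HasRank key (xs.filter fun x => p < key x) i q) :
    HasRank key xs (xs.countP (fun x => key x ≤ p) + i) q := by
  obtain ⟨hqm, hq₁, hq₂⟩ := h
  have hpq : p < key q := by simpa using (List.mem_filter.1 hqm).2
  have split (f : α → Bool) (hf : ∀ x, key x ≤ p → f x = true) :
      xs.countP f = xs.countP (fun x => decide (key x ≤ p)) +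
        (xs.filter fun x => p < key x).countP f := by
    rw [List.countP_filter]
    clear * - hf
    induction xs with
    | nil => rfl
    | cons x xs ih =>
      simp only [List.countP_cons, ih]
      rcases le_or_gt (key x) p with h | h
      · simp [hf x h, h, h.not_gt]; omega
      · simp [h, h.not_ge]; omega
  refine ⟨(List.mem_filter.1 hqm).1, ?_, ?_⟩
  · rw [split (fun x => key x < key q) fun x hx => by simpa using hx.trans_lt hpq]; omega
  · rw [split (fun x => key x ≤ key q) fun x hx => by simpa using hx.trans hpq.le]; omega

/-- Insertion sort is quadratic, but the length is below 30, so its cost is linear with a constant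
factor. -/
theorem select_small (h : ComparesBy cmp key c S) (xs : List α) (i : ℕ)
    (hxs : ∀ y ∈ xs, S y) (hi : i < xs.length) (hsmall : xs.length < 30) :
    HasRank key xs i ((insertionSort cmp xs).val[i]'(by rwa [(insertionSort_perm xs).length_eq])) ∧
      (insertionSort cmp xs).time + (nth (insertionSort cmp xs).val i).time + xs.length + 2 ≤
        1000 * (c + 1) * xs.length := by
  have hp := insertionSort_perm (cmp := cmp) xs
  have ht := insertionSort_time_le h xs hxs
  have ht' := nth_time_le (insertionSort cmp xs).val i
  rw [hp.length_eq] at ht'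
  refine ⟨hasRank_of_sorted hp (insertionSort_sorted h xs hxs) _, ?_⟩
  have : xs.length ^ 2 ≤ 30 * xs.length := by nlinarith
  have := Nat.mul_le_mul_left (c + 1) this
  have : 0 ≤ c * xs.length := Nat.zero_le _
  linarith

/-- The predicate `S` is carried along because a comparison need only agree with the order of the
keys on some elements; for solutions these are the ones with entries small relative to the base. -/
theorem select_spec (h : ComparesBy cmp key c S) (fuel : ℕ) (xs : List α) (i : ℕ)
    (hxs : ∀ y ∈ xs, S y) (hfuel : xs.length ≤ fuel) (hi : i < xs.length) :
    (∃ p, (select cmp fuel xs i).val = some p ∧ HasRank key xs i p) ∧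
      (select cmp fuel xs i).time ≤ 1000 * (c + 1) * xs.length := by
  induction fuel generalizing xs i with
  | zero => omega
  | succ fuel ih =>
    simp only [select, Timed.val_bind, Timed.time_bind, op_val, op_time, count_val, count_time,
      decide_eq_true_eq]
    by_cases hsmall : xs.length < 30
    · have := select_small h xs i hxs hi hsmall
      simp only [if_pos hsmall, Timed.val_bind, Timed.time_bind, nth_val]
      exact ⟨⟨_, List.getElem?_eq_getElem _, this.1⟩, by omega⟩
    · have hml := medians_length (cmp := cmp) xs
      obtain ⟨⟨p, hp, hrank⟩, hT⟩ := ih (medians cmp xs).val (xs.length / 10)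
        (fun y hy => hxs y (mem_of_mem_medians xs hy)) (by omega) (by omega)
      have hmt := medians_time_le h xs hxs
      have hpx : p ∈ xs := mem_of_mem_medians xs hrank.1
      have hpS := hxs p hpx
      have hpt := partition_time_le h hpS xs hxs
      have hc := three_mul_countP_medians_le h xs hxs (key p)
      have hm := countP_trichotomy key (medians cmp xs).val (key p)
      have hx := countP_trichotomy key xs (key p)
      obtain ⟨-, hr₁, hr₂⟩ := hrank
      rw [hml] at hm hT
      simp only [if_neg hsmall, Timed.val_bind, Timed.time_bind, op_val, op_time, hp,
        partition_val h hpS xs hxs, count_val, count_time, decide_eq_true_eq]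
      have hlt := ih (xs.filter fun x => key x < key p) i
        (fun y hy => hxs y (List.mem_filter.1 hy).1)
      have hgt := ih (xs.filter fun x => key p < key x)
        (i - xs.countP fun x => key x ≤ key p) (fun y hy => hxs y (List.mem_filter.1 hy).1)
      have hrgt (q : α) := HasRank.of_filter_gt (key := key) (xs := xs)
        (i := i - xs.countP fun x => key x ≤ key p) (p := key p) (q := q)
      have hmid : xs.countP (fun x => key x < key p) ≤ i → i < xs.countP (fun x => key x ≤ key p) →
          HasRank key xs i p := fun h₁ h₂ => ⟨hpx, h₁, h₂⟩
      simp only [← List.countP_eq_length_filter] at hlt hgt ⊢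
      rw [hx.1]
      generalize xs.countP (fun x => decide (key x < key p)) = a at *
      generalize xs.countP (fun x => decide (key x = key p)) = b at *
      generalize xs.countP (fun x => decide (key p < key x)) = d at *
      generalize xs.countP (fun x => decide (key x ≤ key p)) = e at *
      generalize (medians cmp xs).time = T₁ at *
      generalize (select cmp fuel (medians cmp xs).val (xs.length / 10)).time = T₂ at *
      generalize (partition cmp p xs).time = T₃ at *
      have key_time : ∀ m, m ≤ a ∨ m ≤ d →
          1000 * (c + 1) * (xs.length / 5) + 1000 * (c + 1) * m + 60 * (c + 1) * xs.length ≤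
            1000 * (c + 1) * xs.length := by
        intro m hm'
        -- The two recursive calls concern `n / 5` medians and one part of `m` elements. The pivot
        -- has rank `n / 10` among the medians, so each strict part omits about three tenths of the
        -- list. For `n ≥ 30` this leaves `60 n` as the budget for sorting the blocks, partitioning
        -- and counting.
        have h1 : 1000 * (xs.length / 5) + 1000 * m + 60 * xs.length ≤ 1000 * xs.length := by
          omega
        have := Nat.mul_le_mul_left (c + 1) h1
        linarith
      have hbase : 20 ≤ xs.length := by omega
      have hbase' := Nat.mul_le_mul_left (c + 1) hbase
      have hcn : 0 ≤ c * xs.length := Nat.zero_le _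
      have hab : a + b ≤ xs.length := by omega
      by_cases h₁ : i < a
      · rw [if_pos h₁]
        obtain ⟨⟨q, hq, hqr⟩, hqt⟩ := hlt (by omega) h₁
        have := key_time _ (Or.inl le_rfl)
        exact ⟨⟨q, hq, hqr.of_filter_lt⟩, by linarith⟩
      · rw [if_neg h₁]
        by_cases h₂ : i < e
        · rw [if_pos h₂]
          have := key_time 0 (Or.inl (Nat.zero_le _))
          refine ⟨⟨p, rfl, hmid (by omega) h₂⟩, ?_⟩
          simp only [op_time]
          linarith
        · rw [if_neg h₂]
          simp only [Timed.val_bind, Timed.time_bind, op_val, op_time]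
          obtain ⟨⟨q, hq, hqr⟩, hqt⟩ := hgt (by omega) (by omega)
          have := key_time _ (Or.inr le_rfl)
          have hr := hrgt q hqr
          rw [Nat.add_sub_of_le (by omega)] at hr
          exact ⟨⟨q, hq, hr⟩, by linarith⟩

end Selection

end ReplicaPlacement

namespace ReplicaPlacement

open Polynomial

/-! ## Sums over lists -/

section Sums

variable {α β : Type}

theorem card_listSum (l : List (Multiset α)) : l.sum.card = (l.map Multiset.card).sum := by
  induction l with
  | nil => simp
  | cons a l ih => simp [ih]

theorem filter_listSum (S : α → Prop) [DecidablePred S] (l : List (Multiset α)) :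
    l.sum.filter S = (l.map (Multiset.filter S)).sum := by
  induction l with
  | nil => simp
  | cons a l ih => simp [ih, Multiset.filter_add]

theorem mem_listSum {a : α} (l : List (Multiset α)) : a ∈ l.sum ↔ ∃ s ∈ l, a ∈ s := by
  induction l with
  | nil => simp
  | cons b l ih => simp [ih]

theorem coeff_listSum (l : List ℕ[X]) (i : ℕ) :
    l.sum.coeff i = (l.map fun p => p.coeff i).sum := by
  induction l with
  | nil => simp
  | cons a l ih => simp [ih]

theorem eq_of_le_of_listSum_eq (l : List α) (f g : α → Multiset β) (h : ∀ x ∈ l, f x ≤ g x)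
    (hs : (l.map f).sum = (l.map g).sum) : ∀ x ∈ l, f x = g x := by
  induction l with
  | nil => simp
  | cons a l ih =>
    simp only [List.map_cons, List.sum_cons, List.mem_cons, forall_eq_or_imp] at hs h ⊢
    have h1 := Multiset.card_le_card h.1
    have h2 := Multiset.card_le_card (List.sum_le_sum h.2)
    have h3 := congrArg Multiset.card hs
    simp only [Multiset.card_add] at h3
    have ha := Multiset.eq_of_le_of_card_le h.1 (by omega)
    rw [ha] at hs
    exact ⟨ha, ih h.2 (add_left_cancel hs)⟩

/-- Lifts a reordering of the images to the list itself. It is used to reorder shares according to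
their trees, and pairs according to their first components. -/
theorem exists_perm_map_eq {f : α → β} {xs : List α} {l : List β} (h : (xs.map f).Perm l) :
    ∃ ys, xs.Perm ys ∧ ys.map f = l := by
  induction l generalizing xs with
  | nil => exact ⟨[], by simpa using h, rfl⟩
  | cons b l ih =>
    obtain ⟨x, hx, rfl⟩ := List.mem_map.1 (h.symm.subset (List.mem_cons_self ..))
    obtain ⟨s, t, rfl⟩ := List.append_of_mem hx
    have hp : (s ++ x :: t).Perm (x :: (s ++ t)) := List.perm_middle
    obtain ⟨ys, hys, rfl⟩ := ih (List.Perm.cons_inv (((hp.map f).symm.trans h)))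
    exact ⟨x :: ys, hp.trans (hys.cons x), rfl⟩

theorem exists_perm_cons_cons {xs : List α} {a b : α} (ha : a ∈ xs) (hb : b ∈ xs) (hab : a ≠ b) :
    ∃ rest, xs.Perm (a :: b :: rest) := by
  obtain ⟨s, t, rfl⟩ := List.append_of_mem ha
  have hp : (s ++ a :: t).Perm (a :: (s ++ t)) := List.perm_middle
  have hb' : b ∈ s ++ t := by
    rcases List.mem_cons.1 (hp.subset hb) with rfl | h
    · exact absurd rfl hab
    · exact h
  obtain ⟨u, v, huv⟩ := List.append_of_mem hb'
  rw [huv] at hp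
  exact ⟨u ++ v, hp.trans (List.perm_middle.cons a)⟩

end Sums

/-! ## Trees with numbers -/

namespace InfoTree

variable {V : Type}

theorem induction {p : InfoTree V → Prop} (h : ∀ t, (∀ c ∈ t.children, p c) → p t) (t : InfoTree V) :
    p t :=
  InfoTree.rec (motive_1 := p) (motive_2 := fun cs => ∀ c ∈ cs, p c)
    (fun _ _ _ _ _ _ ih => h _ ih) (by simp) (fun _ _ h₁ h₂ => by simpa using ⟨h₁, h₂⟩) t

/-- The numbers stored in the tree are correct. -/
inductive Valid : InfoTree V → Prop
  -- A path contracted into the leaf below it is again a leaf, whose weight is also its size and its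
  -- depth.
  | leaf (w : ℕ) (v : V) (hw : 1 ≤ w) : Valid ⟨w, 1, w, w, v, []⟩
  | node (w l s d : ℕ) (v : V) (cs : List (InfoTree V)) (hw : 1 ≤ w) (hne : cs ≠ [])
      (hl : l = (cs.map leaves).sum) (hs : s = w + (cs.map size).sum)
      (hd : ∃ c ∈ cs, v = c.nearest ∧ d = w + c.depth) (hd' : ∀ c ∈ cs, d ≤ w + c.depth)
      (h : ∀ c ∈ cs, Valid c) : Valid ⟨w, l, s, d, v, cs⟩

theorem Valid.children {t : InfoTree V} (h : t.Valid) : ∀ c ∈ t.children, c.Valid := by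
  cases h with
  | leaf => simp
  | node w l s d v cs hw hne hl hs hd hd' h => exact h

theorem Valid.weight_pos {t : InfoTree V} (h : t.Valid) : 1 ≤ t.weight := by
  cases h <;> assumption

theorem Valid.size_eq {t : InfoTree V} (h : t.Valid) :
    t.size = t.weight + (t.children.map size).sum := by
  cases h with
  | leaf => simp
  | node w l s d v cs hw hne hl hs hd hd' h => exact hs

theorem Valid.leaves_eq {t : InfoTree V} (h : t.Valid) (hne : t.children ≠ []) :
    t.leaves = (t.children.map leaves).sum := by
  cases h with
  | leaf => simp at hne
  | node w l s d v cs hw hne hl hs hd hd' h => exact hl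

theorem Valid.leaves_eq_one {t : InfoTree V} (h : t.Valid) (hne : t.children = []) :
    t.leaves = 1 := by
  cases h with
  | leaf => rfl
  | node w l s d v cs hw hne' hl hs hd hd' h => exact absurd hne hne'

theorem Valid.size_le_of_mem {t c : InfoTree V} (h : t.Valid) (hc : c ∈ t.children) :
    c.size < t.size := by
  have := h.size_eq
  have := h.weight_pos
  have := List.single_le_sum (l := t.children.map size) (by simp) c.size (List.mem_map_of_mem hc)
  omega

theorem Valid.depth_le_size {t : InfoTree V} (h : t.Valid) : t.depth ≤ t.size := by
  induction h with
  | leaf => simp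
  | node w l s d v cs hw hne hl hs hd hd' h ih =>
    obtain ⟨c, hc, -, rfl⟩ := hd
    have := List.single_le_sum (l := cs.map size) (by simp) c.size (List.mem_map_of_mem hc)
    have := ih c hc
    dsimp only at *
    omega

mutual
/-- The leaves of a tree. -/
def leafMultiset : InfoTree V → Multiset V
  | ⟨_, _, _, _, v, []⟩ => {v}
  | ⟨_, _, _, _, _, c :: cs⟩ => leafMultisetList (c :: cs)
/-- The leaves of a list of trees. -/
def leafMultisetList : List (InfoTree V) → Multiset V
  | [] => 0
  | c :: cs => leafMultiset c + leafMultisetList cs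
end

theorem leafMultisetList_eq (cs : List (InfoTree V)) :
    leafMultisetList cs = (cs.map leafMultiset).sum := by
  induction cs with
  | nil => simp [leafMultisetList]
  | cons c cs ih => simp [leafMultisetList, ih]

@[simp] theorem leafMultiset_leaf (w l s d : ℕ) (v : V) :
    leafMultiset ⟨w, l, s, d, v, []⟩ = {v} := by
  simp [leafMultiset]

theorem leafMultiset_node (w l s d : ℕ) (v : V) {cs : List (InfoTree V)} (h : cs ≠ []) :
    leafMultiset ⟨w, l, s, d, v, cs⟩ = (cs.map leafMultiset).sum := by
  cases cs with
  | nil => simp at h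
  | cons c cs => rw [leafMultiset, leafMultisetList_eq]

theorem Valid.card_leafMultiset {t : InfoTree V} (h : t.Valid) :
    t.leafMultiset.card = t.leaves := by
  induction h with
  | leaf => simp
  | node w l s d v cs hw hne hl hs hd hd' h ih =>
    rw [leafMultiset_node _ _ _ _ _ hne, card_listSum, List.map_map, hl]
    exact congrArg _ (List.map_congr_left ih)

theorem Valid.leaves_pos {t : InfoTree V} (h : t.Valid) : 1 ≤ t.leaves := by
  induction h with
  | leaf => simp
  | node w l s d v cs hw hne hl hs hd hd' h ih =>
    obtain ⟨c, hc, -⟩ := hd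
    have := List.single_le_sum (l := cs.map leaves) (by simp) c.leaves (List.mem_map_of_mem hc)
    have := ih c hc
    dsimp only at *
    omega

mutual
/-- The failure aggregate of a tree for the leaves in `S`: the coefficient at `i` is the number of
vertices with failure number `i`. -/
noncomputable def aggregate (S : V → Prop) [DecidablePred S] : InfoTree V → ℕ[X]
  | ⟨w, l, s, d, v, cs⟩ =>
    monomial ((leafMultiset ⟨w, l, s, d, v, cs⟩).countP S) w + aggregateList S cs
/-- The failure aggregate of a list of trees. -/
noncomputable def aggregateList (S : V → Prop) [DecidablePred S] : List (InfoTree V) → ℕ[X]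
  | [] => 0
  | c :: cs => aggregate S c + aggregateList S cs
end

theorem aggregateList_eq (S : V → Prop) [DecidablePred S] (cs : List (InfoTree V)) :
    aggregateList S cs = (cs.map (aggregate S)).sum := by
  induction cs with
  | nil => simp [aggregateList]
  | cons c cs ih => simp [aggregateList, ih]

theorem aggregate_eq (S : V → Prop) [DecidablePred S] (t : InfoTree V) :
    aggregate S t = monomial (t.leafMultiset.countP S) t.weight +
      (t.children.map (aggregate S)).sum := by
  cases t
  rw [aggregate, aggregateList_eq]

/-- The failure aggregate of a tree all of whose leaves are chosen. -/
noncomputable def full (t : InfoTree V) : ℕ[X] := aggregate (fun _ => True) t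

theorem Valid.full_eq {t : InfoTree V} (h : t.Valid) :
    t.full = monomial t.leaves t.weight + (t.children.map full).sum := by
  have := h.card_leafMultiset
  simp only [full, aggregate_eq _ t, Multiset.countP_True, this]
  rfl

theorem Valid.aggregate_false {t : InfoTree V} (h : t.Valid) :
    aggregate (fun _ => False) t = monomial 0 t.size := by
  induction h with
  | leaf w v hw => simp [aggregate_eq]
  | node w l s d v cs hw hne hl hs hd hd' h ih =>
    rw [aggregate_eq]
    simp only [Multiset.countP_False]
    rw [List.map_congr_left ih, hs, map_add, ← map_list_sum_monomial cs]
where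
  map_list_sum_monomial (cs : List (InfoTree V)) :
      (cs.map fun c => (monomial 0 c.size : ℕ[X])).sum = monomial 0 (cs.map size).sum := by
    induction cs with
    | nil => simp
    | cons c cs ih => simp only [List.map_cons, List.sum_cons, ih, map_add]

end InfoTree

/-! ## Placements in trees -/

/-- Some of the leaves of a tree, with a failure aggregate. -/
structure Share (V : Type) where
  tree : InfoTree V
  vec : ℕ[X]
  leaves : Multiset V

namespace Share

variable {V : Type}

/-- The number of leaves. -/
def num (x : Share V) : ℕ := x.leaves.card

/-- The failure aggregate read as a number in base `B`. -/
noncomputable def cost (B : ℕ) (x : Share V) : ℕ := x.vec.eval B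

/-- The leaves are leaves of the tree, and the failure aggregate is theirs. -/
inductive Placed : Share V → Prop
  | leaf_zero (w l s d : ℕ) (v : V) : Placed ⟨⟨w, l, s, d, v, []⟩, monomial 0 w, 0⟩
  | leaf_one (w l s d : ℕ) (v : V) : Placed ⟨⟨w, l, s, d, v, []⟩, monomial 1 w, {v}⟩
  -- The shares match the children only up to order, since labelling and selection rearrange the
  -- children.
  | node (w l s d : ℕ) (v : V) (cs : List (InfoTree V)) (xs : List (Share V)) (hne : cs ≠ [])
      (hp : (xs.map tree).Perm cs) (h : ∀ x ∈ xs, Placed x) :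
      Placed ⟨⟨w, l, s, d, v, cs⟩,
        monomial (xs.map num).sum w + (xs.map vec).sum, (xs.map leaves).sum⟩

theorem Placed.exists_of_children {x : Share V} (h : x.Placed) (hne : x.tree.children ≠ []) :
    ∃ xs : List (Share V), (xs.map tree).Perm x.tree.children ∧ (∀ y ∈ xs, y.Placed) ∧
      x.vec = monomial x.num x.tree.weight + (xs.map vec).sum ∧ x.leaves = (xs.map leaves).sum ∧
      x.num = (xs.map num).sum := by
  cases h with
  | leaf_zero => simp at hne
  | leaf_one => simp at hne
  | node w l s d v cs xs hne hp h =>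
    have : num ⟨⟨w, l, s, d, v, cs⟩, monomial (xs.map num).sum w + (xs.map vec).sum,
        (xs.map leaves).sum⟩ = (xs.map num).sum := by
      rw [num, card_listSum, List.map_map]; rfl
    exact ⟨xs, hp, h, by rw [this], rfl, this⟩

theorem Placed.of_children {t : InfoTree V} (hne : t.children ≠ []) (xs : List (Share V))
    (hp : (xs.map tree).Perm t.children) (h : ∀ x ∈ xs, Placed x) :
    Placed ⟨t, monomial (xs.map num).sum t.weight + (xs.map vec).sum, (xs.map leaves).sum⟩ := by
  cases t
  exact Placed.node _ _ _ _ _ _ xs hne hp h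

theorem num_eq_sum {t : InfoTree V} {p : ℕ[X]} (xs : List (Share V)) :
    num ⟨t, p, (xs.map leaves).sum⟩ = (xs.map num).sum := by
  rw [num, card_listSum, List.map_map]; rfl

theorem Placed.leaves_le {x : Share V} (h : x.Placed) : x.leaves ≤ x.tree.leafMultiset := by
  induction h with
  | leaf_zero => simp
  | leaf_one => simp
  | node w l s d v cs xs hne hp h ih =>
    rw [InfoTree.leafMultiset_node _ _ _ _ _ hne, ← (hp.map _).sum_eq, List.map_map]
    exact List.sum_le_sum ih

theorem Placed.num_le {x : Share V} (h : x.Placed) (hv : x.tree.Valid) :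
    x.num ≤ x.tree.leaves :=
  (Multiset.card_le_card h.leaves_le).trans_eq hv.card_leafMultiset

/-- Turns an arbitrary set of vertices into a share, so that every rival placement in the graph is a
competitor in `Share.Optimal`. -/
theorem placed_aggregate (S : V → Prop) [DecidablePred S] (t : InfoTree V) :
    Placed ⟨t, t.aggregate S, t.leafMultiset.filter S⟩ := by
  induction t using InfoTree.induction with
  | h t ih =>
    obtain ⟨w, l, s, d, v, cs⟩ := t
    rcases eq_or_ne cs [] with rfl | hne
    · rw [InfoTree.aggregate_eq, InfoTree.leafMultiset_leaf]
      by_cases hv : S v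
      · simpa [hv, Multiset.filter_singleton, Multiset.countP_eq_card_filter] using
          Placed.leaf_one w l s d v
      · simpa [hv, Multiset.filter_singleton, Multiset.countP_eq_card_filter] using
          Placed.leaf_zero w l s d v
    · have := Placed.node w l s d v cs
        (cs.map fun c => ⟨c, c.aggregate S, c.leafMultiset.filter S⟩) hne
        (by simp [Function.comp_def]) (by simpa using ih)
      convert this using 2
      · rw [InfoTree.aggregate_eq, InfoTree.leafMultiset_node _ _ _ _ _ hne,
          Multiset.countP_eq_card_filter, filter_listSum, card_listSum]
        simp [Function.comp_def, num]
      · rw [InfoTree.leafMultiset_node _ _ _ _ _ hne, filter_listSum]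
        simp [Function.comp_def]

/-- In each child the chosen leaves form a sub-multiset of the leaves satisfying `S`. The totals
agree, so there is equality in every child, and the induction hypothesis applies to each. -/
theorem Placed.vec_eq_aggregate {x : Share V} (h : x.Placed) (S : V → Prop) [DecidablePred S]
    (hS : x.tree.leafMultiset.filter S = x.leaves) : x.vec = x.tree.aggregate S := by
  induction h with
  | leaf_zero w l s d v =>
    dsimp only at hS ⊢
    rw [InfoTree.aggregate_eq, Multiset.countP_eq_card_filter, hS]
    simp
  | leaf_one w l s d v =>
    dsimp only at hS ⊢
    rw [InfoTree.aggregate_eq, Multiset.countP_eq_card_filter, hS]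
    simp
  | node w l s d v cs xs hne hp h ih =>
    dsimp only at hS ⊢
    rw [InfoTree.aggregate_eq, Multiset.countP_eq_card_filter, hS, card_listSum, List.map_map]
    rw [InfoTree.leafMultiset_node _ _ _ _ _ hne, ← (hp.map _).sum_eq, List.map_map,
      filter_listSum, List.map_map] at hS
    have hmem (v : V) (hv : v ∈ (xs.map leaves).sum) : S v := by
      rw [← hS] at hv
      obtain ⟨_, hs, hv⟩ := (mem_listSum _).1 hv
      obtain ⟨x, -, rfl⟩ := List.mem_map.1 hs
      exact (Multiset.mem_filter.1 hv).2
    have hle : ∀ x ∈ xs, x.leaves ≤ x.tree.leafMultiset.filter S := by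
      intro x hx
      rw [Multiset.le_filter]
      refine ⟨(h x hx).leaves_le, fun v hv => hmem v ?_⟩
      exact (mem_listSum _).2 ⟨_, List.mem_map_of_mem hx, hv⟩
    have heq := eq_of_le_of_listSum_eq xs _ _ hle hS.symm
    congr 1
    rw [← (hp.map _).sum_eq, List.map_map]
    exact congrArg _ (List.map_congr_left fun x hx => ih x hx (heq x hx).symm)

theorem Placed.vec_eq_full {x : Share V} (h : x.Placed) (hv : x.tree.Valid)
    (hn : x.num = x.tree.leaves) : x.vec = x.tree.full := by
  refine h.vec_eq_aggregate _ ?_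
  rw [Multiset.filter_true]
  exact (Multiset.eq_of_le_of_card_le h.leaves_le (by
    rw [hv.card_leafMultiset]; exact hn.ge)).symm

theorem placed_full (t : InfoTree V) : Placed ⟨t, t.full, t.leafMultiset⟩ := by
  simpa [InfoTree.full] using placed_aggregate (fun _ => True) t

theorem sum_le_sum_of_perm {xs : List (Share V)} {cs : List (InfoTree V)}
    (hp : (xs.map tree).Perm cs) {f : Share V → ℕ} {g : InfoTree V → ℕ}
    (h : ∀ x ∈ xs, f x ≤ g x.tree) : (xs.map f).sum ≤ (cs.map g).sum := by
  rw [← (hp.map g).sum_eq, List.map_map]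
  exact List.sum_le_sum h

/-- Bounds the digits of a cost, so that a large enough base separates them. -/
theorem Placed.coeff_le {x : Share V} (h : x.Placed) (hv : x.tree.Valid) (i : ℕ) :
    x.vec.coeff i ≤ x.tree.size := by
  induction h with
  | leaf_zero w l s d v =>
    have := hv.size_eq
    simp only [coeff_monomial]
    split_ifs <;> simp_all
  | leaf_one w l s d v =>
    have := hv.size_eq
    simp only [coeff_monomial]
    split_ifs <;> simp_all
  | node w l s d v cs xs hne hp h ih =>
    have := hv.size_eq
    dsimp only at this ⊢
    rw [this, coeff_add, coeff_listSum, List.map_map]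
    refine add_le_add ?_ (sum_le_sum_of_perm hp fun x hx => ih x hx ?_)
    · rw [coeff_monomial]; split_ifs <;> simp
    · exact hv.children _ (hp.subset (List.mem_map_of_mem hx))

theorem eval_vec_sum (B : ℕ) (xs : List (Share V)) :
    (xs.map vec).sum.eval B = (xs.map (cost B)).sum := by
  rw [eval_listSum, List.map_map]; rfl

/-- The root alone has failure number `num` and accounts for this much. With the upper bound
`Placed.cost_le` it determines the cost up to the factor `size`, which is less than the base; this
drives the exchange argument. -/
theorem Placed.pow_le_cost {B : ℕ} {x : Share V} (h : x.Placed) (hv : x.tree.Valid) :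
    B ^ x.num ≤ x.cost B := by
  have hw := hv.weight_pos
  cases h with
  | leaf_zero w l s d v => simpa [num, cost] using hw
  | leaf_one w l s d v => simpa [num, cost] using Nat.le_mul_of_pos_left B hw
  | node w l s d v cs xs hne hp h =>
    rw [num_eq_sum, cost, eval_add, eval_monomial]
    exact (Nat.le_mul_of_pos_left _ hw).trans (Nat.le_add_right _ _)

/-- No failure number in the tree exceeds the number of chosen leaves, so each vertex costs at most
`B ^ num`. -/
theorem Placed.cost_le {B : ℕ} (hB : 1 ≤ B) {x : Share V} (h : x.Placed) (hv : x.tree.Valid) :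
    x.cost B ≤ x.tree.size * B ^ x.num := by
  induction h with
  | leaf_zero w l s d v => have := hv.size_eq; simp_all [num, cost]
  | leaf_one w l s d v => have := hv.size_eq; simp_all [num, cost]
  | node w l s d v cs xs hne hp h ih =>
    have := hv.size_eq
    dsimp only at this
    simp only [num_eq_sum, cost, eval_add, eval_monomial, this, eval_vec_sum, add_mul]
    refine Nat.add_le_add_left ?_ _
    rw [← List.sum_map_mul_right]
    refine sum_le_sum_of_perm hp fun x hx => ?_
    refine (ih x hx (hv.children _ (hp.subset (List.mem_map_of_mem hx)))).trans ?_
    refine Nat.mul_le_mul_left _ (Nat.pow_le_pow_right hB ?_)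
    exact List.single_le_sum (by simp) _ (List.mem_map_of_mem hx)

theorem exists_placed {t : InfoTree V} (hv : t.Valid) {r : ℕ} (hr : r ≤ t.leaves) :
    ∃ x : Share V, x.tree = t ∧ x.num = r ∧ x.Placed := by
  induction hv generalizing r with
  | leaf w v hw =>
    dsimp only at hr
    interval_cases r
    · exact ⟨_, rfl, by simp [num], Placed.leaf_zero _ _ _ _ _⟩
    · exact ⟨_, rfl, by simp [num], Placed.leaf_one _ _ _ _ _⟩
  | node w l s d v cs hw hne hl hs hd hd' h ih =>
    have key : ∀ (cs : List (InfoTree V)) (r : ℕ), r ≤ (cs.map InfoTree.leaves).sum →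
        (∀ c ∈ cs, ∀ {r}, r ≤ c.leaves → ∃ x : Share V, x.tree = c ∧ x.num = r ∧ x.Placed) →
        ∃ xs : List (Share V), xs.map tree = cs ∧ (xs.map num).sum = r ∧ ∀ x ∈ xs, x.Placed := by
      intro cs
      induction cs with
      | nil => intro r hr _; exact ⟨[], rfl, by simpa using (hr.antisymm (by simp)).symm, by simp⟩
      | cons c cs ihc =>
        intro r hr hc
        rw [List.map_cons, List.sum_cons] at hr
        obtain ⟨x, rfl, hx, hx'⟩ := hc c (by simp) (min_le_right r _)
        obtain ⟨xs, rfl, hxs, hxs'⟩ := ihc (r - min r x.tree.leaves) (by omega)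
          fun c hc' => hc c (by simp [hc'])
        exact ⟨x :: xs, rfl, by simp only [List.map_cons, List.sum_cons]; omega,
          by simpa using ⟨hx', hxs'⟩⟩
    obtain ⟨xs, hxs, rfl, hx⟩ := key cs r (hr.trans_eq hl) ih
    exact ⟨_, rfl, num_eq_sum xs, Placed.node w l s d v cs xs hne (by rw [hxs]) hx⟩

/-- Every vertex costs at least 1. If some leaf is chosen, the vertices above it cost at least `B`,
and together with it they have total weight at least `depth`. The bound is attained by the empty
share and by a nearest leaf, which settles the cases of zero and one replica. -/
theorem Placed.size_add_le_cost {B : ℕ} (hB : 1 ≤ B) {x : Share V} (h : x.Placed)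
    (hv : x.tree.Valid) : x.tree.size + (if x.num = 0 then 0 else x.tree.depth * (B - 1)) ≤
      x.cost B := by
  have hsub : B = 1 + (B - 1) := by omega
  generalize B - 1 = b at hsub
  subst hsub
  induction h with
  | leaf_zero w l s d v => have := hv.size_eq; simp_all [num, cost]
  | leaf_one w l s d v =>
    generalize ht : InfoTree.mk w l s d v [] = t at *
    cases hv with
    | leaf w' v' hw =>
      cases ht
      simp [num, cost, mul_add]
    | node w l s d v cs hw hne => cases ht; exact absurd rfl hne
  | node w l s d v cs xs hne hp h ih =>
    have hs := hv.size_eq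
    dsimp only at hs
    have hxv : ∀ x ∈ xs, x.tree.Valid := fun x hx =>
      hv.children _ (hp.subset (List.mem_map_of_mem hx))
    have hd : ∀ x ∈ xs, d ≤ w + x.tree.depth := by
      intro x hx
      have := hp.subset (List.mem_map_of_mem (f := tree) hx)
      cases hv with
      | leaf => exact absurd rfl hne
      | node w l s d v cs hw hne hl hs hd hd' h => exact hd' _ this
    have hsum : (xs.map fun x => x.tree.size).sum = (cs.map InfoTree.size).sum := by
      rw [← (hp.map _).sum_eq, List.map_map]; rfl
    simp only [num_eq_sum, cost, eval_add, eval_monomial, hs, eval_vec_sum, ← hsum]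
    split_ifs with h0
    · simp only [h0, pow_zero, mul_one, add_zero]
      refine Nat.add_le_add_left (List.sum_le_sum fun x hx => ?_) _
      exact (Nat.le_add_right _ _).trans (ih x hx (hxv x hx))
    · obtain ⟨x, hx, hx0⟩ : ∃ x ∈ xs, x.num ≠ 0 := by
        by_contra! hall
        refine h0 (List.sum_eq_zero ?_)
        simpa using hall
      obtain ⟨s', t', rfl⟩ := List.append_of_mem hx
      have hperm : (s' ++ x :: t').Perm (x :: (s' ++ t')) := List.perm_middle
      have h1 : ((s' ++ t').map fun x => x.tree.size).sum ≤ ((s' ++ t').map (cost (1 + b))).sum :=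
        List.sum_le_sum fun y hy => by
          have hy' : y ∈ s' ++ x :: t' := hperm.symm.subset (by simp only [List.mem_cons, hy, or_true])
          exact (Nat.le_add_right _ _).trans (ih y hy' (hxv y hy'))
      have h2 := ih x hx (hxv x hx)
      rw [if_neg hx0] at h2
      rw [(hperm.map (cost (1 + b))).sum_eq, (hperm.map fun x => x.tree.size).sum_eq]
      simp only [List.map_cons, List.sum_cons]
      have h3 : w * (1 + b) ≤ w * (1 + b) ^ ((s' ++ x :: t').map num).sum :=
        Nat.mul_le_mul_left _ (Nat.le_self_pow h0 _)
      have h4 : d * b ≤ (w + x.tree.depth) * b := Nat.mul_le_mul_right _ (hd x hx)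
      simp only [add_mul, mul_add] at *
      omega

theorem placed_nearest {t : InfoTree V} (hv : t.Valid) :
    Placed ⟨t, monomial 0 (t.size - t.depth) + monomial 1 t.depth, {t.nearest}⟩ := by
  induction hv with
  | leaf w v hw => simpa using Placed.leaf_one w 1 w w v
  | node w l s d v cs hw hne hl hs hd hd' h ih =>
    obtain ⟨c, hc, rfl, rfl⟩ := hd
    obtain ⟨s', t', rfl⟩ := List.append_of_mem hc
    have hperm : (s' ++ c :: t').Perm (c :: (s' ++ t')) := List.perm_middle
    let z : InfoTree V → Share V := fun c => ⟨c, monomial 0 c.size, 0⟩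
    have hz : ∀ c' ∈ s' ++ t', (z c').Placed := by
      intro c' hc'
      have := placed_aggregate (fun _ => False) c'
      rwa [(h c' (hperm.symm.subset (by simp only [List.mem_cons, hc', or_true]))).aggregate_false,
        Multiset.filter_false] at this
    have hcv := h c hc
    have := Placed.node w l s (w + c.depth) c.nearest (s' ++ c :: t')
      (⟨c, monomial 0 (c.size - c.depth) + monomial 1 c.depth, {c.nearest}⟩ :: (s' ++ t').map z)
      hne (by simpa [z, Function.comp_def] using hperm.symm) (by
        simp only [List.mem_cons, forall_eq_or_imp, List.mem_map, forall_exists_index, and_imp]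
        refine ⟨ih c hc, ?_⟩
        rintro _ x hx rfl
        exact hz x hx)
    convert this using 2
    · have h0 : ∀ l : List (InfoTree V), ((l.map z).map num).sum = 0 := by
        intro l; induction l with
        | nil => rfl
        | cons a l ih => simpa [num, z] using ih
      have h1 : ∀ l : List (InfoTree V), ((l.map z).map vec).sum =
          monomial 0 (l.map InfoTree.size).sum := by
        intro l; induction l with
        | nil => simp
        | cons a l ih => simp only [List.map_cons, List.sum_cons, ih, map_add, z]
      simp only [List.map_cons, List.sum_cons, h0, h1, num, Multiset.card_singleton, add_zero]
      have h2 := hcv.depth_le_size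
      have h3 : s - (w + c.depth) = (c.size - c.depth) + ((s' ++ t').map InfoTree.size).sum := by
        rw [hs, (hperm.map _).sum_eq, List.map_cons, List.sum_cons]; omega
      rw [h3, map_add, map_add]
      abel
    · have h0 : ∀ l : List (InfoTree V), ((l.map z).map leaves).sum = 0 := by
        intro l; induction l with
        | nil => rfl
        | cons a l ih => simpa [z] using ih
      simp only [List.map_cons, List.sum_cons, h0, add_zero]

end Share

end ReplicaPlacement

namespace ReplicaPlacement

open Polynomial

variable {V : Type}

/-! ## Optimal placements -/

/-- The share `x` of a tree with `r` leaves has the least cost in base `B`. -/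
def Share.Optimal (B r : ℕ) (x : Share V) : Prop :=
  x.Placed ∧ x.num = r ∧
    ∀ y : Share V, y.Placed → y.tree = x.tree → y.num = r → x.cost B ≤ y.cost B

theorem Share.optimal_zero {t : InfoTree V} (hv : t.Valid) {B : ℕ} (hB : 1 ≤ B) :
    Share.Optimal B 0 ⟨t, monomial 0 t.size, 0⟩ := by
  refine ⟨?_, rfl, fun y hy ht hn => ?_⟩
  · have := placed_aggregate (fun _ => False) t
    rwa [hv.aggregate_false, Multiset.filter_false] at this
  · subst ht
    have := hy.size_add_le_cost hB hv
    simpa [cost, hn] using this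

theorem Share.optimal_one {t : InfoTree V} (hv : t.Valid) {B : ℕ} (hB : 1 ≤ B) :
    Share.Optimal B 1 ⟨t, monomial 0 (t.size - t.depth) + monomial 1 t.depth, {t.nearest}⟩ := by
  refine ⟨placed_nearest hv, rfl, fun y hy ht hn => ?_⟩
  subst ht
  refine le_trans ?_ (hy.size_add_le_cost hB hv)
  have := hv.depth_le_size
  obtain ⟨b, rfl⟩ : ∃ b, B = 1 + b := ⟨B - 1, by omega⟩
  simp only [cost, hn, eval_add, eval_monomial, pow_zero, pow_one, mul_one, mul_add,
    Nat.add_sub_cancel_left, if_neg one_ne_zero]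
  omega

/-- In a cheapest distribution to the children, a child that is not full has at most one leaf less
than every other child. -/
theorem Share.num_le_num_add_one {t : InfoTree V} (hv : t.Valid) {B : ℕ} (hB : 2 * t.size < B)
    {xs : List (Share V)} (hp : (xs.map tree).Perm t.children) (hx : ∀ x ∈ xs, x.Placed)
    (hmin : ∀ ys : List (Share V), (ys.map tree).Perm t.children → (∀ y ∈ ys, y.Placed) →
      (ys.map num).sum = (xs.map num).sum → (xs.map (cost B)).sum ≤ (ys.map (cost B)).sum) :
    ∀ a ∈ xs, ∀ b ∈ xs, b.num < b.tree.leaves → a.num ≤ b.num + 1 := by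
  intro a ha b hb hlt
  by_contra! hab
  have hne : a ≠ b := by rintro rfl; omega
  obtain ⟨rest, hperm⟩ := exists_perm_cons_cons ha hb hne
  have hxv : ∀ x ∈ xs, x.tree.Valid := fun x hx =>
    hv.children _ (hp.subset (List.mem_map_of_mem hx))
  have hva := hxv a ha
  have hvb := hxv b hb
  have hna := (hx a ha).num_le hva
  -- Only the numbers of leaves matter in the exchange: any share of `a.tree` with one leaf less and
  -- any share of `b.tree` with one leaf more will do.
  obtain ⟨a', hta, hna', hpa⟩ := exists_placed hva (r := a.num - 1) (by omega)
  obtain ⟨b', htb, hnb', hpb⟩ := exists_placed hvb (r := b.num + 1) hlt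
  have hm := hmin (a' :: b' :: rest) (by
      refine List.Perm.trans ?_ hp
      refine List.Perm.trans ?_ (hperm.symm.map tree)
      simp [hta, htb]) (by
      simp only [List.mem_cons, forall_eq_or_imp]
      exact ⟨hpa, hpb, fun y hy => hx y (hperm.symm.subset (by simp [hy]))⟩) (by
      rw [(hperm.map num).sum_eq]
      simp only [List.map_cons, List.sum_cons]
      omega)
  rw [(hperm.map (cost B)).sum_eq] at hm
  simp only [List.map_cons, List.sum_cons] at hm
  have h1 := hpa.cost_le (B := B) (by omega) (hta ▸ hva)
  have h2 := hpb.cost_le (B := B) (by omega) (htb ▸ hvb)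
  have h3 := (hx a ha).pow_le_cost (B := B) hva
  have h4 : B ^ b'.num ≤ B ^ a'.num := Nat.pow_le_pow_right (by omega) (by omega)
  have h5 : B ^ a.num = B * B ^ a'.num := by
    rw [← pow_succ', hna']; congr 1; omega
  have h6 : 0 < B ^ a'.num := Nat.pow_pos (by omega)
  have hsa := hv.size_le_of_mem (hp.subset (List.mem_map_of_mem (f := tree) ha))
  have hsb := hv.size_le_of_mem (hp.subset (List.mem_map_of_mem (f := tree) hb))
  have h7 := Nat.mul_le_mul_left b'.tree.size h4
  -- The new shares have at most `a.num - 1` leaves each and cost at most the sum of their sizes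
  -- times `B ^ (a.num - 1)`. This is less than `B ^ a.num`, which `a` alone costs at least, so the
  -- exchange is a strict improvement.
  have h8 : (a'.tree.size + b'.tree.size + 1) * B ^ a'.num ≤ B * B ^ a'.num :=
    Nat.mul_le_mul_right _ (by rw [hta, htb]; omega)
  simp only [add_mul, one_mul] at h8
  omega

/-- The children `F` of `t` are filled, and each of the children `U` receives `q` or `q - 1` leaves
when `t` receives `r` or `r - 1`; `high` of them receive `q` if `t` receives `r`. -/
structure Split (t : InfoTree V) (r : ℕ) (F U : List (InfoTree V)) (q high : ℕ) : Prop where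
  perm : (F ++ U).Perm t.children
  total : r = (F.map InfoTree.leaves).sum + U.length * (q - 1) + high
  high_pos : 1 ≤ high
  high_le : high ≤ U.length
  q_pos : 1 ≤ q
  q_le : ∀ c ∈ U, q ≤ c.leaves
  filled : ∀ c ∈ F, (t.children.map fun d => min d.leaves c.leaves).sum < r

theorem Split.children_ne_nil {t : InfoTree V} {r : ℕ} {F U : List (InfoTree V)} {q high : ℕ}
    (h : Split t r F U q high) : t.children ≠ [] := by
  intro hnil
  have := h.perm.length_eq
  have := h.high_pos
  have := h.high_le
  simp_all

/-- If a filled child `c` were not full, balance would give every child `d` at most `min (ℓ d) (ℓ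
c)` leaves, and `c` strictly less. By the labelling criterion the total would then be at most `r -
2`, but it is `r` or `r - 1`. Similarly, an unfilled child below `q - 1` would keep all unfilled
children at most `q - 1` and their sum too small, and one above `q` would force all to at least `q`
and make the sum too large. -/
theorem Split.num_bounds {t : InfoTree V} (hv : t.Valid) {r q high : ℕ}
    {F U : List (InfoTree V)} (hs : Split t r F U q high) {xF xU : List (Share V)}
    (hF : xF.map Share.tree = F) (hU : (xU.map Share.tree).Perm U)
    (hx : ∀ x ∈ xF ++ xU, x.Placed)
    (hbal : ∀ a ∈ xF ++ xU, ∀ b ∈ xF ++ xU, b.num < b.tree.leaves → a.num ≤ b.num + 1)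
    {j : ℕ} (hj : j = high ∨ j + 1 = high)
    (hn : ((xF ++ xU).map Share.num).sum =
      (F.map InfoTree.leaves).sum + U.length * (q - 1) + j) :
    (∀ x ∈ xF, x.num = x.tree.leaves) ∧ (∀ x ∈ xU, q - 1 ≤ x.num ∧ x.num ≤ q) ∧
      (xU.map Share.num).sum = U.length * (q - 1) + j := by
  have hperm : ((xF ++ xU).map Share.tree).Perm t.children := by
    rw [List.map_append, hF]
    exact (hU.append_left F).trans hs.perm
  have hxv : ∀ x ∈ xF ++ xU, x.tree.Valid := fun x hx =>
    hv.children _ (hperm.subset (List.mem_map_of_mem hx))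
  have htot := hs.total
  have hfill : ∀ x ∈ xF, x.num = x.tree.leaves := by
    intro x hxF
    have hxm : x ∈ xF ++ xU := List.mem_append_left _ hxF
    by_contra hne
    have hlt := lt_of_le_of_ne ((hx x hxm).num_le (hxv x hxm)) hne
    have h1 := hs.filled x.tree (hF ▸ List.mem_map_of_mem hxF)
    have h2 : ((xF ++ xU).map Share.num).sum <
        ((xF ++ xU).map fun y => min y.tree.leaves x.tree.leaves).sum := by
      refine List.sum_lt_sum _ _ (fun y hy => ?_) ⟨x, hxm, by simpa using hlt⟩
      exact le_min ((hx y hy).num_le (hxv y hy)) ((hbal y hy x hxm hlt).trans hlt)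
    rw [← (hperm.map _).sum_eq, List.map_map] at h1
    simp only [Function.comp_def] at h1
    omega
  have hsumF : (xF.map Share.num).sum = (F.map InfoTree.leaves).sum := by
    rw [← hF, List.map_map]
    exact congrArg _ (List.map_congr_left hfill)
  have hlen : xU.length = U.length := by simpa using hU.length_eq
  rw [List.map_append, List.sum_append, hsumF] at hn
  have hsumU : (xU.map Share.num).sum = U.length * (q - 1) + j := by omega
  have hq : ∀ x ∈ xU, q ≤ x.tree.leaves := fun x hx => hs.q_le _ (hU.subset (List.mem_map_of_mem hx))
  have hqp := hs.q_pos
  have hhl := hs.high_le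
  refine ⟨hfill, fun x hxU => ⟨?_, ?_⟩, hsumU⟩
  · by_contra! hlt
    have : (xU.map Share.num).sum < (xU.map fun _ => q - 1).sum := by
      refine List.sum_lt_sum _ _ (fun y hy => ?_) ⟨x, hxU, hlt⟩
      have := hbal y (List.mem_append_right _ hy) x (List.mem_append_right _ hxU)
        (by have := hq x hxU; omega)
      omega
    simp [hlen] at this
    omega
  · by_contra! hlt
    have : (xU.map fun _ => q).sum < (xU.map Share.num).sum := by
      refine List.sum_lt_sum _ _ (fun y hy => ?_) ⟨x, hxU, hlt⟩
      by_cases hy' : y.num < y.tree.leaves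
      · have := hbal x (List.mem_append_right _ hxU) y (List.mem_append_right _ hy) hy'
        omega
      · exact (hq y hy).trans (not_lt.1 hy')
    obtain ⟨q, rfl⟩ : ∃ q', q = q' + 1 := ⟨q - 1, by omega⟩
    simp [hlen, mul_add] at this hsumU
    omega

-- The price of one more leaf at each child

/-- Shares of a tree with `q - 1` (`lo`) and `q` (`hi`) leaves. -/
structure Offer (V : Type) where
  tree : InfoTree V
  lo : ℕ[X]
  hi : ℕ[X]
  loLeaves : Multiset V
  hiLeaves : Multiset V

namespace Offer

/-- The share with fewer leaves. -/
def loShare (z : Offer V) : Share V := ⟨z.tree, z.lo, z.loLeaves⟩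

/-- The share with more leaves. -/
def hiShare (z : Offer V) : Share V := ⟨z.tree, z.hi, z.hiLeaves⟩

/-- Both shares have the least cost. -/
def Optimal (B q : ℕ) (z : Offer V) : Prop :=
  z.loShare.Optimal B (q - 1) ∧ z.hiShare.Optimal B q

/-- The price of one more leaf. -/
noncomputable def gain (B : ℕ) (z : Offer V) : ℤ := z.hiShare.cost B - z.loShare.cost B

/-- Lagrangian lower bound: with `θ` charged for each leaf beyond `q - 1`, a child taken at its
smaller share contributes `0` to the correction and one taken at its larger share contributes `gain
- θ`; both are at least `min (gain - θ) 0`. `sum_hi_eq` and `sum_lo_eq` are the cases of equality,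
for prices on the proper side of `θ`. -/
theorem sum_cost_ge {B q : ℕ} (hq : 1 ≤ q) (θ : ℤ) (zs : List (Offer V)) (xs : List (Share V))
    (htree : xs.map Share.tree = zs.map tree) (hx : ∀ x ∈ xs, x.Placed)
    (hz : ∀ z ∈ zs, z.Optimal B q) (hn : ∀ x ∈ xs, q - 1 ≤ x.num ∧ x.num ≤ q) :
    (zs.map fun z => (z.loShare.cost B : ℤ)).sum +
        ((xs.map Share.num).sum - zs.length * ((q : ℤ) - 1)) * θ +
        (zs.map fun z => min (z.gain B - θ) 0).sum ≤ ((xs.map (Share.cost B)).sum : ℕ) := by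
  induction zs generalizing xs with
  | nil =>
    obtain rfl : xs = [] := by simpa using htree
    simp
  | cons z zs ih =>
    cases xs with
    | nil => simp at htree
    | cons x xs =>
      simp only [List.map_cons, List.cons.injEq] at htree
      simp only [List.mem_cons, forall_eq_or_imp] at hx hz hn
      have ih := ih xs htree.2 hx.2 hz.2 hn.2
      have hxz : (z.loShare.cost B : ℤ) + (x.num - ((q : ℤ) - 1)) * θ +
          min (z.gain B - θ) 0 ≤ x.cost B := by
        obtain ⟨⟨hlo, hlo', hlo''⟩, ⟨hhi, hhi', hhi''⟩⟩ := hz.1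
        rcases (by omega : x.num = q - 1 ∨ x.num = q) with h | h
        · have h1 : (z.loShare.cost B : ℤ) ≤ x.cost B := by
            exact_mod_cast hlo'' x hx.1 htree.1 h
          have h2 : (x.num : ℤ) = q - 1 := by omega
          rw [h2]
          have := min_le_right (z.gain B - θ) 0
          simp only [sub_self, zero_mul]
          omega
        · have h1 : (z.hiShare.cost B : ℤ) ≤ x.cost B := by
            exact_mod_cast hhi'' x hx.1 htree.1 h
          have := min_le_left (z.gain B - θ) 0
          rw [h]
          have h3 : ((q : ℤ) - (q - 1)) * θ = θ := by ring
          rw [h3]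
          unfold gain at *
          omega
      simp only [List.map_cons, List.sum_cons, List.length_cons]
      push_cast at ih ⊢
      linarith

theorem sum_hi_eq {B : ℕ} (θ : ℤ) (zs : List (Offer V)) (h : ∀ z ∈ zs, z.gain B ≤ θ) :
    (((zs.map fun z => z.hiShare.cost B).sum : ℕ) : ℤ) =
      (zs.map fun z => (z.loShare.cost B : ℤ)).sum + zs.length * θ +
        (zs.map fun z => min (z.gain B - θ) 0).sum := by
  induction zs with
  | nil => simp
  | cons z zs ih =>
    simp only [List.mem_cons, forall_eq_or_imp] at h
    have ih := ih h.2
    have : min (z.gain B - θ) 0 = z.gain B - θ := min_eq_left (by linarith [h.1])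
    simp only [List.map_cons, List.sum_cons, List.length_cons, this, Nat.cast_add, ih,
      Nat.cast_one]
    rw [gain]
    ring

theorem sum_lo_eq {B : ℕ} (θ : ℤ) (zs : List (Offer V)) (h : ∀ z ∈ zs, θ ≤ z.gain B) :
    (((zs.map fun z => z.loShare.cost B).sum : ℕ) : ℤ) =
      (zs.map fun z => (z.loShare.cost B : ℤ)).sum +
        (zs.map fun z => min (z.gain B - θ) 0).sum := by
  induction zs with
  | nil => simp
  | cons z zs ih =>
    simp only [List.mem_cons, forall_eq_or_imp] at h
    have ih := ih h.2
    have : min (z.gain B - θ) 0 = 0 := min_eq_right (by linarith [h.1])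
    simp only [List.map_cons, List.sum_cons, this, Nat.cast_add, ih]
    ring

end Offer

/-- The share of a tree with filled children `F`, in which the children of `as` receive the larger
and those of `bs` the smaller number of leaves. -/
noncomputable def combinedShare (t : InfoTree V) (r : ℕ) (F : List (InfoTree V))
    (as bs : List (Offer V)) : Share V :=
  ⟨t, monomial r t.weight + (F.map InfoTree.full).sum + (as.map Offer.hi).sum +
      (bs.map Offer.lo).sum,
    (F.map InfoTree.leafMultiset).sum + (as.map Offer.hiLeaves).sum +
      (bs.map Offer.loLeaves).sum⟩

/-- The shares of the children in a combined share. -/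
noncomputable def childShares (F : List (InfoTree V)) (as bs : List (Offer V)) : List (Share V) :=
  F.map (fun c => ⟨c, c.full, c.leafMultiset⟩) ++ (as.map Offer.hiShare ++ bs.map Offer.loShare)

/-- Balance of a cheapest distribution reduces the problem to choosing which unfilled children
receive `q` leaves, and the Lagrangian bound is attained because the prices in `as` are at most `θ`
and those in `bs` at least `θ`. The length of `as` may be `high` or `high - 1`, which covers `r` and
`r - 1` at once. -/
theorem Split.optimal_combinedShare {t : InfoTree V} (hv : t.Valid) {B : ℕ}
    (hB : 2 * t.size < B) {r q high : ℕ} {F U : List (InfoTree V)} (hs : Split t r F U q high)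
    (as bs : List (Offer V)) (hU : ((as ++ bs).map Offer.tree).Perm U)
    (hz : ∀ z ∈ as ++ bs, z.Optimal B q) (hj : as.length = high ∨ as.length + 1 = high)
    (θ : ℤ) (has : ∀ z ∈ as, z.gain B ≤ θ) (hbs : ∀ z ∈ bs, θ ≤ z.gain B) {r' : ℕ}
    (hr' : r' + high = r + as.length) :
    (combinedShare t r' F as bs).Optimal B r' := by
  have hlen : as.length + bs.length = U.length := by simpa using hU.length_eq
  have htot := hs.total
  have hqp := hs.q_pos
  have hFv : ∀ c ∈ F, c.Valid := fun c hc =>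
    hv.children _ (hs.perm.subset (List.mem_append_left _ hc))
  have htree : (childShares F as bs).map Share.tree = F ++ (as ++ bs).map Offer.tree := by
    simp [childShares, Function.comp_def, Offer.hiShare, Offer.loShare]
  have hzp : ∀ x ∈ childShares F as bs, x.Placed := by
    intro x hx
    simp only [childShares, List.mem_append, List.mem_map] at hx
    rcases hx with ⟨c, -, rfl⟩ | ⟨z, hz', rfl⟩ | ⟨z, hz', rfl⟩
    · exact Share.placed_full c
    · exact (hz z (List.mem_append_left _ hz')).2.1
    · exact (hz z (List.mem_append_right _ hz')).1.1
  have hnum : ((childShares F as bs).map Share.num).sum = r' := by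
    have h1 : ∀ l : List (InfoTree V), (∀ c ∈ l, c.Valid) →
        ((l.map fun c => (⟨c, c.full, c.leafMultiset⟩ : Share V)).map Share.num).sum =
          (l.map InfoTree.leaves).sum := by
      intro l hl
      rw [List.map_map]
      exact congrArg _ (List.map_congr_left fun c hc => (hl c hc).card_leafMultiset)
    have h2 : ((as.map Offer.hiShare).map Share.num).sum = as.length * q := by
      rw [List.map_map, List.map_congr_left (f := Share.num ∘ Offer.hiShare) (g := fun _ => q)
        fun z hz' => (hz z (List.mem_append_left _ hz')).2.2.1]
      simp
    have h3 : ((bs.map Offer.loShare).map Share.num).sum = bs.length * (q - 1) := by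
      rw [List.map_map, List.map_congr_left (f := Share.num ∘ Offer.loShare) (g := fun _ => q - 1)
        fun z hz' => (hz z (List.mem_append_right _ hz')).1.2.1]
      simp
    rw [childShares, List.map_append, List.map_append, List.sum_append, List.sum_append, h1 F hFv,
      h2, h3]
    obtain ⟨p, rfl⟩ : ∃ p, q = p + 1 := ⟨q - 1, by omega⟩
    rw [← hlen] at htot
    simp only [Nat.add_sub_cancel, mul_add, add_mul, mul_one] at htot ⊢
    omega
  have hperm : ((childShares F as bs).map Share.tree).Perm t.children := by
    rw [htree]; exact (hU.append_left F).trans hs.perm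
  have hshare : (combinedShare t r' F as bs) = ⟨t, monomial ((childShares F as bs).map
      Share.num).sum t.weight + ((childShares F as bs).map Share.vec).sum,
      ((childShares F as bs).map Share.leaves).sum⟩ := by
    rw [hnum]
    simp [combinedShare, childShares, Function.comp_def, Offer.hiShare, Offer.loShare, add_assoc]
  have hcost : (combinedShare t r' F as bs).cost B = t.weight * B ^ r' +
      (F.map fun c => c.full.eval B).sum + (as.map fun z => z.hiShare.cost B).sum +
        (bs.map fun z => z.loShare.cost B).sum := by
    simp [combinedShare, Share.cost, eval_listSum, Function.comp_def, Offer.hiShare, Offer.loShare]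
  have hplaced : (combinedShare t r' F as bs).Placed := by
    rw [hshare]
    exact Share.Placed.of_children hs.children_ne_nil _ hperm hzp
  refine ⟨hplaced, by rw [hshare, Share.num_eq_sum, hnum], fun y hy hyt hyn => ?_⟩
  change y.tree = t at hyt
  subst hyt
  obtain ⟨xs₀, hp₀, hx₀, hvec₀, -, hn₀⟩ := hy.exists_of_children hs.children_ne_nil
  -- a cheapest distribution to the children
  obtain ⟨xs, ⟨hp, hx, hn⟩, hmin⟩ : ∃ xs : List (Share V),
      ((xs.map Share.tree).Perm y.tree.children ∧ (∀ x ∈ xs, x.Placed) ∧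
        (xs.map Share.num).sum = r') ∧ ∀ ys : List (Share V),
      ((ys.map Share.tree).Perm y.tree.children ∧ (∀ x ∈ ys, x.Placed) ∧
        (ys.map Share.num).sum = r') → (xs.map (Share.cost B)).sum ≤
          (ys.map (Share.cost B)).sum := by
    have hex : ∃ n, ∃ xs : List (Share V), ((xs.map Share.tree).Perm y.tree.children ∧
        (∀ x ∈ xs, x.Placed) ∧ (xs.map Share.num).sum = r') ∧
          (xs.map (Share.cost B)).sum = n := ⟨_, xs₀, ⟨hp₀, hx₀, by omega⟩, rfl⟩
    classical
    obtain ⟨xs, hxs, hxn⟩ := Nat.find_spec hex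
    exact ⟨xs, hxs, fun ys hys => hxn.trans_le (Nat.find_min' hex ⟨ys, hys, rfl⟩)⟩
  have hbal := Share.num_le_num_add_one hv hB hp hx fun ys h1 h2 h3 =>
    hmin ys ⟨h1, h2, h3.trans hn⟩
  -- The cheapest distribution is reordered to list the filled children first and then the unfilled
  -- ones in the order of `as ++ bs`, so that it can be compared with the offers one by one.
  obtain ⟨zs, hzs, hzt⟩ := exists_perm_map_eq (l := F ++ (as ++ bs).map Offer.tree)
    (hp.trans (hs.perm.symm.trans (hU.symm.append_left F)))
  obtain ⟨xF, xU, rfl, hxF, hxU⟩ := List.map_eq_append_iff.1 hzt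
  have hx' : ∀ x ∈ xF ++ xU, x.Placed := fun x h => hx x (hzs.symm.subset h)
  obtain ⟨hfill, hnU, hsU⟩ := hs.num_bounds hv hxF (hxU ▸ hU) hx'
    (fun a ha b hb => hbal a (hzs.symm.subset ha) b (hzs.symm.subset hb)) hj (by
      rw [← (hzs.map _).sum_eq, hn]; omega)
  have hlow := Offer.sum_cost_ge hqp θ (as ++ bs) xU hxU
    (fun x h => hx' x (List.mem_append_right _ h)) hz hnU
  have hhi := Offer.sum_hi_eq θ as has
  have hlo := Offer.sum_lo_eq θ bs hbs
  have hFcost : (xF.map (Share.cost B)).sum = (F.map fun c => c.full.eval B).sum := by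
    rw [← hxF, List.map_map]
    refine congrArg _ (List.map_congr_left fun x h => ?_)
    rw [Share.cost, (hx' x (List.mem_append_left _ h)).vec_eq_full
      (hFv _ (hxF ▸ List.mem_map_of_mem h)) (hfill x h)]
    rfl
  have hycost : y.tree.weight * B ^ r' + (xs.map (Share.cost B)).sum ≤ y.cost B := by
    rw [Share.cost, hvec₀, eval_add, eval_monomial, Share.eval_vec_sum, hyn]
    exact Nat.add_le_add_left (hmin xs₀ ⟨hp₀, hx₀, by omega⟩) _
  rw [(hzs.map _).sum_eq, List.map_append, List.sum_append, hFcost] at hycost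
  rw [hcost]
  refine le_trans ?_ hycost
  have hsU' : ((xU.map Share.num).sum : ℤ) =
      (as.length + bs.length : ℤ) * (q - 1) + as.length := by
    rw [hsU]
    push_cast [Nat.cast_sub hqp, ← hlen]
    rfl
  have : (((as.map fun z => z.hiShare.cost B).sum : ℕ) +
      ((bs.map fun z => z.loShare.cost B).sum : ℕ) : ℤ) ≤
      ((xU.map (Share.cost B)).sum : ℕ) := by
    refine le_trans (le_of_eq ?_) hlow
    rw [hhi, hlo, hsU']
    simp only [List.map_append, List.sum_append, List.length_append]
    push_cast
    ring
  have : (as.map fun z => z.hiShare.cost B).sum + (bs.map fun z => z.loShare.cost B).sum ≤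
      (xU.map (Share.cost B)).sum := by exact_mod_cast this
  omega

end ReplicaPlacement

namespace ReplicaPlacement

open Polynomial

variable {V : Type}

/-! ## Rooted trees and their graphs -/

namespace RoseTree

/-- The subtrees at the children of the root. -/
def children : RoseTree V → List (RoseTree V)
  | node _ cs => cs

theorem induction {p : RoseTree V → Prop} (h : ∀ v cs, (∀ c ∈ cs, p c) → p (node v cs))
    (t : RoseTree V) : p t :=
  RoseTree.rec (motive_1 := p) (motive_2 := fun cs => ∀ c ∈ cs, p c)
    (fun _ _ ih => h _ _ ih) (by simp) (fun _ _ h₁ h₂ => by simpa using ⟨h₁, h₂⟩) t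

mutual
/-- The subtrees at all vertices. -/
def subtrees : RoseTree V → List (RoseTree V)
  | node v cs => node v cs :: subtreesList cs
/-- The subtrees at all vertices of a list of trees. -/
def subtreesList : List (RoseTree V) → List (RoseTree V)
  | [] => []
  | c :: cs => subtrees c ++ subtreesList cs
end

theorem subtrees_node (v : V) (cs : List (RoseTree V)) :
    subtrees (node v cs) = node v cs :: cs.flatMap subtrees := by
  rw [subtrees]
  congr 1
  induction cs with
  | nil => simp [subtreesList]
  | cons c cs ih => simp [subtreesList, ih]

theorem vertices_node (v : V) (cs : List (RoseTree V)) :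
    vertices (node v cs) = v :: cs.flatMap vertices := by
  rw [vertices]
  congr 1
  induction cs with
  | nil => simp [verticesList]
  | cons c cs ih => simp [verticesList, ih]

theorem arcs_node (v : V) (cs : List (RoseTree V)) :
    arcs (node v cs) = cs.map (fun c => (v, c.root)) ++ cs.flatMap arcs := by
  rw [arcs]
  congr 1
  induction cs with
  | nil => simp [arcsList]
  | cons c cs ih => simp [arcsList, ih]

theorem vertices_eq (t : RoseTree V) : t.vertices = t.subtrees.map root := by
  induction t using induction with
  | h v cs ih =>
    rw [vertices_node, subtrees_node, List.map_cons, List.map_flatMap]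
    exact congrArg _ (List.flatMap_congr ih)

theorem mem_subtrees_self (t : RoseTree V) : t ∈ t.subtrees := by
  cases t; simp [subtrees_node]

theorem mem_subtrees {s t : RoseTree V} :
    s ∈ t.subtrees ↔ s = t ∨ ∃ c ∈ t.children, s ∈ c.subtrees := by
  cases t; simp [subtrees_node, children]

theorem subtrees_trans {r s t : RoseTree V} (hrs : r ∈ s.subtrees) (hst : s ∈ t.subtrees) :
    r ∈ t.subtrees := by
  induction t using induction with
  | h v cs ih =>
    rcases mem_subtrees.1 hst with rfl | ⟨c, hc, hs⟩
    · exact hrs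
    · exact mem_subtrees.2 (Or.inr ⟨c, hc, ih c hc hs⟩)

theorem mem_subtrees_of_mem_children {c s : RoseTree V} (hc : c ∈ s.children) : c ∈ s.subtrees :=
  mem_subtrees.2 (Or.inr ⟨c, hc, mem_subtrees_self c⟩)

theorem mem_arcs {t : RoseTree V} {u v : V} :
    (u, v) ∈ t.arcs ↔ ∃ s ∈ t.subtrees, s.root = u ∧ ∃ c ∈ s.children, c.root = v := by
  induction t using induction with
  | h w cs ih =>
    rw [arcs_node, List.mem_append, List.mem_flatMap, subtrees_node]
    simp only [List.mem_cons, List.mem_flatMap, exists_eq_or_imp, List.mem_map, Prod.mk.injEq,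
      root, children]
    refine or_congr ⟨?_, ?_⟩ ⟨?_, ?_⟩
    · rintro ⟨c, hc, rfl, rfl⟩; exact ⟨rfl, c, hc, rfl⟩
    · rintro ⟨rfl, c, hc, rfl⟩; exact ⟨c, hc, rfl, rfl⟩
    · rintro ⟨c, hc, h⟩
      obtain ⟨s, hs, h⟩ := (ih c hc).1 h
      exact ⟨s, ⟨c, hc, hs⟩, h⟩
    · rintro ⟨s, ⟨c, hc, hs⟩, h⟩
      exact ⟨c, hc, (ih c hc).2 ⟨s, hs, h⟩⟩

/-- The leaves of a tree. -/
def leafList (t : RoseTree V) : List V :=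
  (t.subtrees.filter fun s => s.children.isEmpty).map root

@[simp] theorem leafList_leaf (v : V) : leafList (node v []) = [v] := by
  simp [leafList, subtrees_node, children, root]

theorem leafList_node (v : V) {cs : List (RoseTree V)} (h : cs ≠ []) :
    leafList (node v cs) = cs.flatMap leafList := by
  unfold leafList
  rw [subtrees_node, List.filter_cons_of_neg (by simpa [children] using h), List.filter_flatMap,
    List.map_flatMap]

/-- The failure aggregate of a tree for the leaves in `S`. -/
noncomputable def aggregate (S : V → Prop) [DecidablePred S] (t : RoseTree V) : ℕ[X] :=
  (t.subtrees.map fun s => monomial (s.leafList.countP S) 1).sum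

theorem aggregate_node (S : V → Prop) [DecidablePred S] (v : V) (cs : List (RoseTree V)) :
    aggregate S (node v cs) =
      monomial ((node v cs).leafList.countP S) 1 + (cs.map (aggregate S)).sum := by
  rw [aggregate, subtrees_node, List.map_cons, List.sum_cons]
  congr 1
  induction cs with
  | nil => simp
  | cons c cs ih => simp [aggregate, ih]

theorem coeff_aggregate (S : V → Prop) [DecidablePred S] (t : RoseTree V) (i : ℕ) :
    (t.aggregate S).coeff i = t.subtrees.countP fun s => s.leafList.countP S = i := by
  rw [aggregate, coeff_listSum, List.map_map]
  generalize t.subtrees = l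
  induction l with
  | nil => simp
  | cons s l ih =>
    simp only [List.map_cons, List.sum_cons, ih, Function.comp, coeff_monomial, List.countP_cons,
      decide_eq_true_eq]
    exact add_comm _ _

theorem nodup_vertices_of_mem {s t : RoseTree V} (ht : t.vertices.Nodup) (hs : s ∈ t.subtrees) :
    s.vertices.Nodup := by
  induction t using induction with
  | h v cs ih =>
    rcases mem_subtrees.1 hs with rfl | ⟨c, hc, hs⟩
    · exact ht
    · rw [vertices_node, List.nodup_cons, List.nodup_flatMap] at ht
      exact ih c hc (ht.2.1 c hc) hs

theorem nodup_leafList {t : RoseTree V} (ht : t.vertices.Nodup) : t.leafList.Nodup := by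
  rw [vertices_eq] at ht
  exact ht.sublist (List.filter_sublist.map root)

-- Reachability and failure numbers in the represented graph

section Represents

variable {t : RoseTree V} {A : V → V → Prop}

/-- Vertices of the tree are distinct, so subtrees can stand for the vertices of the graph. -/
theorem Represents.eq_of_root_eq (h : t.Represents A) {s s' : RoseTree V} (hs : s ∈ t.subtrees)
    (hs' : s' ∈ t.subtrees) (he : s.root = s'.root) : s = s' := by
  have := h.1
  rw [vertices_eq] at this
  exact List.inj_on_of_nodup_map this hs hs' he

theorem Represents.arc_iff (h : t.Represents A) {s : RoseTree V} (hs : s ∈ t.subtrees) {v : V} :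
    A s.root v ↔ ∃ c ∈ s.children, c.root = v := by
  rw [h.2.2, mem_arcs]
  constructor
  · rintro ⟨s', hs', he, hc⟩
    rwa [← h.eq_of_root_eq hs' hs he]
  · exact fun hc => ⟨s, hs, rfl, hc⟩

theorem Represents.reflTransGen_iff (h : t.Represents A) {s : RoseTree V} (hs : s ∈ t.subtrees)
    {v : V} : Relation.ReflTransGen A s.root v ↔ v ∈ s.vertices := by
  constructor
  · intro hr
    induction hr with
    | refl => rw [vertices_eq]; exact List.mem_map_of_mem (mem_subtrees_self s)
    | tail _ ha ih =>
      rw [vertices_eq, List.mem_map] at ih ⊢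
      obtain ⟨s', hs', rfl⟩ := ih
      obtain ⟨c, hc, rfl⟩ := (h.arc_iff (subtrees_trans hs' hs)).1 ha
      exact ⟨c, subtrees_trans (mem_subtrees_of_mem_children hc) hs', rfl⟩
  · intro hv
    induction s using induction with
    | h w cs ih =>
      rw [vertices_node, List.mem_cons, List.mem_flatMap] at hv
      rcases hv with rfl | ⟨c, hc, hv⟩
      · exact .refl
      · have hcs : c ∈ t.subtrees :=
          subtrees_trans (mem_subtrees_of_mem_children (s := node w cs) hc) hs
        exact Relation.ReflTransGen.head ((h.arc_iff hs).2 ⟨c, hc, rfl⟩) (ih c hc hcs hv)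

variable [Fintype V]

theorem Represents.card (h : t.Represents A) : Fintype.card V = t.subtrees.length := by
  classical
  have h1 : t.vertices.toFinset = Finset.univ := by
    ext v; simp [h.2.1 v]
  rw [← Finset.card_univ, ← h1, List.toFinset_card_of_nodup h.1, vertices_eq, List.length_map]

theorem Represents.root_mem_leafSet (h : t.Represents A) {s : RoseTree V} (hs : s ∈ t.subtrees) :
    s.root ∈ leafSet A ↔ s.children = [] := by
  simp only [leafSet, Finset.mem_filter, Finset.mem_univ, true_and, h.arc_iff hs]
  constructor
  · intro hn
    by_contra hne
    obtain ⟨c, hc⟩ := List.exists_mem_of_ne_nil _ hne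
    exact hn c.root ⟨c, hc, rfl⟩
  · rintro hnil w ⟨c, hc, -⟩
    simp [hnil] at hc

theorem Represents.mem_leafList (h : t.Represents A) {s : RoseTree V} (hs : s ∈ t.subtrees) {v : V} :
    v ∈ s.leafList ↔ v ∈ s.vertices ∧ v ∈ leafSet A := by
  simp only [leafList, vertices_eq, List.mem_map, List.mem_filter, List.isEmpty_iff]
  constructor
  · rintro ⟨s', ⟨hs', hnil⟩, rfl⟩
    exact ⟨⟨s', hs', rfl⟩, (h.root_mem_leafSet (subtrees_trans hs' hs)).2 hnil⟩
  · rintro ⟨⟨s', hs', rfl⟩, hl⟩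
    exact ⟨s', ⟨hs', (h.root_mem_leafSet (subtrees_trans hs' hs)).1 hl⟩, rfl⟩

theorem Represents.leafSet_eq [DecidableEq V] (h : t.Represents A) :
    leafSet A = t.leafList.toFinset := by
  ext v
  simp [h.mem_leafList (mem_subtrees_self t), h.2.1 v]

open Classical in
theorem Represents.failureNumber_eq (h : t.Represents A) {s : RoseTree V} (hs : s ∈ t.subtrees)
    {P : Finset V} (hP : P ⊆ leafSet A) :
    failureNumber A s.root P = s.leafList.countP (· ∈ P) := by
  have hn := nodup_leafList (nodup_vertices_of_mem h.1 hs)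
  rw [failureNumber, List.countP_eq_length_filter, ← List.toFinset_card_of_nodup (hn.filter _)]
  congr 1
  ext p
  simp only [Finset.mem_filter, h.reflTransGen_iff hs, List.mem_toFinset, List.mem_filter,
    h.mem_leafList hs, decide_eq_true_eq]
  exact ⟨fun ⟨h1, h2⟩ => ⟨⟨h2, hP h1⟩, h1⟩, fun ⟨⟨h1, _⟩, h2⟩ => ⟨h2, h1⟩⟩

-- The bridge between the graph and the polynomials: everything before concerns trees, and the
-- algorithm never refers to reachability.
open Classical in
theorem Represents.failureCount_eq (h : t.Represents A) {P : Finset V} (hP : P ⊆ leafSet A)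
    (i : ℕ) : failureCount A Finset.univ P i = (t.aggregate (· ∈ P)).coeff i := by
  rw [coeff_aggregate, failureCount]
  have h1 : (Finset.univ.filter fun e => failureNumber A e P = i) =
      (t.vertices.filter fun e => failureNumber A e P = i).toFinset := by
    ext v; simp [h.2.1 v]
  rw [h1, List.toFinset_card_of_nodup (h.1.filter _), ← List.countP_eq_length_filter, vertices_eq,
    List.countP_map]
  refine List.countP_congr fun s hs => ?_
  simp only [Function.comp, h.failureNumber_eq hs hP]

end Represents

end RoseTree

/-! ## Preprocessing -/

namespace InfoTree

theorem leafMultiset_eq (t : InfoTree V) (h : t.children ≠ []) :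
    t.leafMultiset = (t.children.map leafMultiset).sum := by
  cases t; exact leafMultiset_node _ _ _ _ _ h

/-- No vertex has exactly one child. -/
inductive Branching : InfoTree V → Prop
  | mk (t : InfoTree V) (h : t.children.length ≠ 1) (h' : ∀ c ∈ t.children, Branching c) :
    Branching t

end InfoTree

/-- The information in `a` is correct for the tree `t`. -/
structure Describes (a : InfoTree V) (t : RoseTree V) : Prop where
  valid : a.Valid
  leaves : a.leafMultiset = (t.leafList : Multiset V)
  size : a.size = t.subtrees.length
  aggregate : ∀ (S : V → Prop) [DecidablePred S], a.aggregate S = t.aggregate S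

/-- Each intermediate result is itself a valid node of weight one above the children read so far.
Its root is already included in size and depth, so adding a child adds only that child's size. -/
theorem joinInfo_spec (c : InfoTree V) (cs : List (InfoTree V)) (h : ∀ d ∈ c :: cs, d.Valid) :
    (joinInfo c cs).val.Valid ∧ (joinInfo c cs).val.children = c :: cs ∧
      (joinInfo c cs).val.weight = 1 ∧ (joinInfo c cs).time = 2 * cs.length + 1 := by
  induction cs generalizing c with
  | nil =>
    simp only [List.mem_singleton, forall_eq] at h
    refine ⟨?_, rfl, rfl, rfl⟩
    exact InfoTree.Valid.node _ _ _ _ _ _ le_rfl (by simp) (by simp) (by simp [add_comm])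
      ⟨c, by simp, rfl, add_comm _ _⟩ (by simp [add_comm]) (by simpa using h)
  | cons d cs ih =>
    obtain ⟨hv, hc, hw, ht⟩ := ih d fun e he => h e (by simp at he ⊢; tauto)
    simp only [joinInfo, Timed.val_bind, Timed.time_bind, op_val, op_time, decide_eq_true_eq]
    generalize (joinInfo d cs).val = t at *
    generalize (joinInfo d cs).time = T at *
    have hsize := hv.size_eq
    have hleaves := hv.leaves_eq (by simp [hc])
    cases hv with
    | leaf => simp at hc
    | node w l s dep v ds hw' hne hl hs hd hd' hds =>
      dsimp only at hc hw
      subst hc hw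
      have hle : l = ((d :: cs).map InfoTree.leaves).sum := hleaves
      dsimp only at hsize
      split_ifs with hlt
      · refine ⟨?_, rfl, rfl, by simp; omega⟩
        refine InfoTree.Valid.node _ _ _ _ _ _ le_rfl (by simp) ?_ ?_
          ⟨c, by simp, rfl, add_comm _ _⟩ ?_ h
        · simp only [List.map_cons, List.sum_cons] at hle ⊢; omega
        · simp only [List.map_cons, List.sum_cons] at hsize ⊢; omega
        · intro e he
          rcases List.mem_cons.1 he with rfl | he
          · omega
          · have := hd' e he; dsimp only at hlt; omega
      · refine ⟨?_, rfl, rfl, by simp; omega⟩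
        refine InfoTree.Valid.node _ _ _ _ _ _ le_rfl (by simp) ?_ ?_ ?_ ?_ h
        · simp only [List.map_cons, List.sum_cons] at hle ⊢; omega
        · simp only [List.map_cons, List.sum_cons] at hsize ⊢; omega
        · obtain ⟨e, he, h1, h2⟩ := hd
          exact ⟨e, List.mem_cons_of_mem _ he, h1, h2⟩
        · intro e he
          rcases List.mem_cons.1 he with rfl | he
          · dsimp only at hlt ⊢; omega
          · exact hd' e he

theorem annotateList_val (b : Bool) (cs : List (RoseTree V)) :
    (annotateList b cs).val = cs.map fun c => (annotate b c).val := by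
  induction cs with
  | nil => simp [annotateList]
  | cons c cs ih => simp [annotateList, ih]

theorem annotateList_time (b : Bool) (cs : List (RoseTree V)) :
    (annotateList b cs).time = (cs.map fun c => (annotate b c).time).sum + cs.length + 1 := by
  induction cs with
  | nil => simp [annotateList]
  | cons c cs ih => simp [annotateList, ih]; omega

/-- A vertex of weight one above described trees. -/
theorem Describes.node {a : InfoTree V} {v : V} {cs : List (RoseTree V)} {f : RoseTree V → InfoTree V}
    (hv : a.Valid) (hw : a.weight = 1) (hne : cs ≠ []) (hc : a.children = cs.map f)
    (h : ∀ c ∈ cs, Describes (f c) c) : Describes a (.node v cs) := by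
  have hl : a.leafMultiset = ((RoseTree.node v cs).leafList : Multiset V) := by
    rw [a.leafMultiset_eq (by simpa [hc] using hne), hc, RoseTree.leafList_node v hne, List.map_map,
      List.map_congr_left (f := InfoTree.leafMultiset ∘ f)
        (g := fun c => (c.leafList : Multiset V)) fun c hc' => (h c hc').leaves]
    clear * -
    induction cs with
    | nil => simp
    | cons c cs ih => simp [ih]
  refine ⟨hv, hl, ?_, fun S _ => ?_⟩
  · rw [hv.size_eq, hc, hw, RoseTree.subtrees_node, List.map_map, List.length_cons,
      List.length_flatMap, List.map_congr_left (f := InfoTree.size ∘ f) fun c hc' => (h c hc').size]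
    exact add_comm _ _
  · rw [InfoTree.aggregate_eq, hl, hw, RoseTree.aggregate_node, hc, List.map_map,
      List.map_congr_left (f := InfoTree.aggregate S ∘ f) fun c hc' => (h c hc').aggregate S]
    simp [Multiset.coe_countP]

theorem annotate_spec (b : Bool) (t : RoseTree V) :
    Describes (annotate b t).val t ∧ (b = true → (annotate b t).val.Branching) ∧
      (annotate b t).time + 3 ≤ 5 * t.subtrees.length := by
  induction t using RoseTree.induction with
  | h v cs ih =>
    -- The slack of 3 per child pays for its list cell and for its two steps in `joinInfo`.
    have htime : (annotateList b cs).time + 2 * cs.length ≤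
        5 * (cs.flatMap RoseTree.subtrees).length + 1 := by
      rw [annotateList_time]
      clear * - ih
      induction cs with
      | nil => simp
      | cons c cs ihc =>
        have := ihc fun d hd => ih d (by simp [hd])
        have := (ih c (by simp)).2.2
        simp only [List.map_cons, List.sum_cons, List.length_cons, List.flatMap_cons,
          List.length_append] at *
        omega
    have hval := annotateList_val b cs
    rw [RoseTree.subtrees_node, List.length_cons]
    simp only [annotate, Timed.val_bind, Timed.time_bind, hval]
    generalize (annotateList b cs).time = T at *
    have hvalid : ∀ d ∈ cs.map (fun c => (annotate b c).val), d.Valid := by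
      simpa using fun c hc => (ih c hc).1.valid
    match cs with
    | [] =>
      refine ⟨⟨.leaf 1 v le_rfl, by simp, by simp [RoseTree.subtrees_node], fun S _ => ?_⟩,
        fun _ => ⟨_, by simp, by simp⟩, ?_⟩
      · rw [InfoTree.aggregate_eq, RoseTree.aggregate_node]
        simp only [op_val, List.map_nil, RoseTree.leafList_leaf, InfoTree.leafMultiset_leaf,
          ← Multiset.coe_countP, Multiset.coe_singleton]
      · simp at htime ⊢; omega
    | [c] =>
      simp only [List.map_cons, List.map_nil] at hvalid ⊢
      obtain ⟨hd, hbr, -⟩ := ih c (by simp)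
      have htc : 1 ≤ c.subtrees.length := List.length_pos_of_mem (RoseTree.mem_subtrees_self c)
      simp only [List.length_cons, List.length_nil, List.flatMap_cons, List.flatMap_nil,
        List.append_nil] at htime ⊢
      cases b with
      | false =>
        obtain ⟨h1, h2, h3, h4⟩ := joinInfo_spec (annotate false c).val [] hvalid
        simp only [Bool.false_eq_true, if_false, false_imp_iff, true_and]
        refine ⟨Describes.node (f := fun c => (annotate false c).val) h1 h3 (by simp) h2
          (by simpa using hd), ?_⟩
        rw [h4]; simp; omega
      | true =>
        simp only [if_true, op_val, op_time]
        have hb := hbr rfl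
        generalize (annotate true c).val = a at *
        have hl : InfoTree.leafMultiset ⟨a.weight + 1, a.leaves, a.size + 1, a.depth + 1, a.nearest,
            a.children⟩ = a.leafMultiset := by
          obtain ⟨w, l, s, d, v, cs⟩ := a
          cases cs <;> simp [InfoTree.leafMultiset]
        have hl' : (RoseTree.node v [c]).leafList = c.leafList := by
          rw [RoseTree.leafList_node v (by simp)]; simp
        refine ⟨⟨?_, ?_, ?_, fun S _ => ?_⟩, fun _ => ?_, by omega⟩
        · cases hd.valid with
          | leaf w v hw => exact .leaf _ _ (by omega)
          | node w l s d v cs hw hne hlv hsv hdv hdv' h =>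
            refine .node _ _ _ _ _ _ (by dsimp only; omega) hne hlv (by dsimp only; omega) ?_ ?_ h
            · obtain ⟨e, he, h1, h2⟩ := hdv
              exact ⟨e, he, h1, by dsimp only; omega⟩
            · intro e he
              have := hdv' e he
              dsimp only; omega
        · rw [hl, hl', hd.leaves]
        · simp [RoseTree.subtrees_node, hd.size]
        -- A vertex with a single child has the same leaves below it as the child, hence the same
        -- failure number for every `S`. Contraction therefore only merges two monomials of equal
        -- degree.
        · rw [InfoTree.aggregate_eq, hl, RoseTree.aggregate_node, hl', List.map_singleton,
            List.sum_singleton, ← hd.aggregate S, InfoTree.aggregate_eq S a, hd.leaves]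
          simp only [map_add, Multiset.coe_countP]
          abel
        · cases hb with
          | mk _ h h' => exact ⟨_, h, h'⟩
    | c :: d :: es =>
      simp only [List.map_cons] at hvalid ⊢
      obtain ⟨h1, h2, h3, h4⟩ := joinInfo_spec _ _ hvalid
      refine ⟨Describes.node (f := fun c => (annotate b c).val) h1 h3 (by simp) h2
          fun e he => (ih e he).1, fun hb => ⟨_, by rw [h2]; simp, ?_⟩, ?_⟩
      · rw [h2]
        simp only [List.mem_cons, List.mem_map]
        rintro e (rfl | rfl | ⟨e, he, rfl⟩)
        · exact (ih c (by simp)).2.1 hb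
        · exact (ih d (by simp)).2.1 hb
        · exact (ih e (by simp [he])).2.1 hb
      · rw [h4]
        simp only [List.length_cons, List.length_map] at htime ⊢
        omega

end ReplicaPlacement

namespace ReplicaPlacement

variable {V : Type}

/-! ## Divide phase -/

theorem comparesBy_compareLeaves :
    ComparesBy (compareLeaves (V := V)) InfoTree.leaves 1 fun _ => True :=
  fun _ _ _ _ => ⟨rfl, le_rfl⟩

@[simp] theorem sumLeaves_val (cs : List (InfoTree V)) :
    (sumLeaves cs).val = (cs.map InfoTree.leaves).sum := by
  induction cs with
  | nil => rfl
  | cons c cs ih => simp [sumLeaves, ih]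

@[simp] theorem sumLeaves_time (cs : List (InfoTree V)) :
    (sumLeaves cs).time = cs.length + 1 := by
  induction cs with
  | nil => rfl
  | cons c cs ih => simp [sumLeaves, ih]

theorem perm_filter_trichotomy {α κ : Type} [LinearOrder κ] (key : α → κ) (xs : List α) (p : κ) :
    ((xs.filter fun x => key x < p) ++ (xs.filter fun x => key x = p) ++
      (xs.filter fun x => p < key x)).Perm xs := by
  induction xs with
  | nil => simp
  | cons x xs ih =>
    rcases lt_trichotomy (key x) p with h | h | h
    · simpa [h, h.ne, h.not_gt] using ih
    · simp only [List.filter_cons, h, lt_irrefl, decide_false, decide_true, if_true,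
        Bool.false_eq_true, if_false]
      exact (List.perm_middle.append_right _).trans (ih.cons x)
    · simp only [List.filter_cons, h, h.ne', h.not_gt, decide_false, decide_true, if_true,
        Bool.false_eq_true, if_false]
      exact List.perm_middle.trans (ih.cons x)

/-- The sum of the capacities of the trees in `cs`, each cut off at `m`. -/
def cappedLeaves (cs : List (InfoTree V)) (m : ℕ) : ℕ := (cs.map fun d => min d.leaves m).sum

theorem cappedLeaves_mono (cs : List (InfoTree V)) {m m' : ℕ} (h : m ≤ m') :
    cappedLeaves cs m ≤ cappedLeaves cs m' :=
  List.sum_le_sum fun _ _ => min_le_min_left _ h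

theorem cappedLeaves_of_le {cs : List (InfoTree V)} {m : ℕ} (h : ∀ c ∈ cs, c.leaves ≤ m) :
    cappedLeaves cs m = (cs.map InfoTree.leaves).sum :=
  congrArg _ (List.map_congr_left fun c hc => min_eq_left (h c hc))

theorem cappedLeaves_of_ge {cs : List (InfoTree V)} {m : ℕ} (h : ∀ c ∈ cs, m ≤ c.leaves) :
    cappedLeaves cs m = cs.length * m := by
  rw [cappedLeaves, List.map_congr_left (g := fun _ => m) fun c hc => min_eq_right (h c hc)]
  simp

theorem cappedLeaves_append (cs ds : List (InfoTree V)) (m : ℕ) :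
    cappedLeaves (cs ++ ds) m = cappedLeaves cs m + cappedLeaves ds m := by
  simp [cappedLeaves]

theorem cappedLeaves_perm {cs ds : List (InfoTree V)} (h : cs.Perm ds) (m : ℕ) :
    cappedLeaves cs m = cappedLeaves ds m :=
  (h.map _).sum_eq

/-- `D` is a correct labelling of the members of `C` that are not in `M`. -/
structure Labelling.Correct (C : List (InfoTree V)) (r : ℕ) (D : Labelling V)
    (M : List (InfoTree V)) : Prop where
  perm : (D.filled ++ D.unfilled ++ M).Perm C
  filledLeaves : D.filledLeaves = (D.filled.map InfoTree.leaves).sum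
  unfilledCount : D.unfilledCount = D.unfilled.length
  filled_le : ∀ c ∈ D.filled, ∀ d ∈ M, c.leaves ≤ d.leaves
  le_unfilled : ∀ c ∈ D.unfilled, ∀ d ∈ M, d.leaves ≤ c.leaves
  filled : ∀ c ∈ D.filled, cappedLeaves C c.leaves < r
  unfilled : ∀ c ∈ D.unfilled, r ≤ cappedLeaves C c.leaves

/-- The capped sum is monotone in the cap, so a decision at the median settles all smaller or all
larger children along with it. At most half of `M` remains, and the recursion costs `5000 · n / 2`,
which leaves `2500 n` for the selection and the linear work of one round. -/
theorem getFilled_spec (C : List (InfoTree V)) (r fuel : ℕ) (M : List (InfoTree V))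
    (D : Labelling V) (hM : M.length ≤ fuel) (h : D.Correct C r M) :
    (getFilled r fuel M D).val.Correct C r [] ∧
      (getFilled r fuel M D).time ≤ 5000 * M.length + 1 := by
  induction fuel generalizing M D with
  | zero =>
    obtain rfl : M = [] := List.length_eq_zero_iff.1 (by omega)
    exact ⟨h, le_rfl⟩
  | succ fuel ih =>
    rcases eq_or_ne M [] with rfl | hne
    · exact ⟨h, le_rfl⟩
    have hpos : 0 < M.length := List.length_pos_iff.2 hne
    obtain ⟨⟨m, hm, hmM, hr₁, hr₂⟩, hst⟩ := select_spec comparesBy_compareLeaves M.length M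
      (M.length / 2) (by simp) le_rfl (by omega)
    have hpv := partition_val comparesBy_compareLeaves (p := m) trivial M (by simp)
    have hpt := partition_time_le comparesBy_compareLeaves (p := m) trivial M (by simp)
    have htri := countP_trichotomy InfoTree.leaves M m.leaves
    have hperm := perm_filter_trichotomy InfoTree.leaves M m.leaves
    have hlt_lt : ∀ c ∈ M.filter (fun c => c.leaves < m.leaves), c ∈ M ∧ c.leaves < m.leaves := by
      intro c hc; simpa using hc
    have heq_eq : ∀ c ∈ M.filter (fun c => c.leaves = m.leaves), c ∈ M ∧ c.leaves = m.leaves := by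
      intro c hc; simpa using hc
    have hgt_gt : ∀ c ∈ M.filter (fun c => m.leaves < c.leaves), c ∈ M ∧ m.leaves < c.leaves := by
      intro c hc; simpa using hc
    obtain ⟨c, cs, hcs⟩ := List.exists_cons_of_ne_nil hne
    rw [hcs]
    simp only [getFilled]
    rw [← hcs]
    simp only [Timed.val_bind, Timed.time_bind, op_val, op_time, count_val, count_time, hm, hpv,
      sumLeaves_val, sumLeaves_time, decide_eq_true_eq]
    simp only [List.countP_eq_length_filter] at htri hr₁ hr₂
    generalize M.filter (fun c => c.leaves < m.leaves) = lt at *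
    generalize M.filter (fun c => c.leaves = m.leaves) = eq at *
    generalize M.filter (fun c => m.leaves < c.leaves) = gt at *
    generalize (select compareLeaves M.length M (M.length / 2)).time = T₁ at *
    generalize (partition compareLeaves m M).time = T₂ at *
    -- Children labelled filled earlier are no larger than the median and count in full; those
    -- labelled unfilled are no smaller and count as `m.leaves` each. The quantity computed from the
    -- running totals is thus the capped sum over all children.
    have hsum : cappedLeaves C m.leaves = D.filledLeaves + (lt.map InfoTree.leaves).sum +
        (eq.map InfoTree.leaves).sum + m.leaves * (D.unfilledCount + gt.length) := by
      rw [← cappedLeaves_perm h.perm, cappedLeaves_append, ← cappedLeaves_perm hperm,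
        cappedLeaves_append, cappedLeaves_append, cappedLeaves_append,
        cappedLeaves_of_le fun c hc => h.filled_le c hc m hmM,
        cappedLeaves_of_ge fun c hc => h.le_unfilled c hc m hmM,
        cappedLeaves_of_le fun c hc => (hlt_lt c hc).2.le,
        cappedLeaves_of_le fun c hc => (heq_eq c hc).2.le,
        cappedLeaves_of_ge fun c hc => (hgt_gt c hc).2.le, h.filledLeaves, h.unfilledCount]
      ring
    split_ifs with hfill
    · simp only [Timed.val_bind, Timed.time_bind, op_val, op_time, append_val, append_time]
      obtain ⟨hv, ht⟩ := ih gt ⟨lt ++ (eq ++ D.filled), D.unfilled, D.filledLeaves +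
        (lt.map InfoTree.leaves).sum + (eq.map InfoTree.leaves).sum, D.unfilledCount⟩ (by omega) (by
          refine ⟨List.Perm.trans ?_ h.perm, ?_, h.unfilledCount, ?_, ?_, ?_, h.unfilled⟩
          · refine List.Perm.trans ?_ (hperm.append_left _)
            classical
            rw [List.perm_iff_count]
            intro a
            simp only [List.count_append]
            ring
          · simp only [h.filledLeaves, List.map_append, List.sum_append]
            ring
          · intro c hc d hd
            have hd := hgt_gt d hd
            rcases List.mem_append.1 hc with hc | hc
            · exact ((hlt_lt c hc).2.trans hd.2).le
            · rcases List.mem_append.1 hc with hc | hc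
              · exact ((heq_eq c hc).2.trans_lt hd.2).le
              · exact h.filled_le c hc d hd.1
          · exact fun c hc d hd => h.le_unfilled c hc d (hgt_gt d hd).1
          · intro c hc
            rcases List.mem_append.1 hc with hc | hc
            · exact (cappedLeaves_mono C (hlt_lt c hc).2.le).trans_lt (hsum ▸ hfill)
            · rcases List.mem_append.1 hc with hc | hc
              · exact (cappedLeaves_mono C (heq_eq c hc).2.le).trans_lt (hsum ▸ hfill)
              · exact h.filled c hc)
      exact ⟨hv, by omega⟩
    · simp only [Timed.val_bind, Timed.time_bind, op_val, op_time, append_val, append_time]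
      obtain ⟨hv, ht⟩ := ih lt ⟨D.filled, gt ++ (eq ++ D.unfilled), D.filledLeaves,
        D.unfilledCount + eq.length + gt.length⟩ (by omega) (by
          refine ⟨List.Perm.trans ?_ h.perm, h.filledLeaves, ?_, ?_, ?_, h.filled, ?_⟩
          · refine List.Perm.trans ?_ (hperm.append_left _)
            classical
            rw [List.perm_iff_count]
            intro a
            simp only [List.count_append]
            ring
          · simp only [h.unfilledCount, List.length_append]
            ring
          · exact fun c hc d hd => h.filled_le c hc d (hlt_lt d hd).1
          · intro c hc d hd
            have hd := hlt_lt d hd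
            rcases List.mem_append.1 hc with hc | hc
            · exact (hd.2.trans (hgt_gt c hc).2).le
            · rcases List.mem_append.1 hc with hc | hc
              · exact hd.2.le.trans_eq (heq_eq c hc).2.symm
              · exact h.le_unfilled c hc d hd.1
          · intro c hc
            have hr := hsum.ge.trans' (not_lt.1 hfill)
            rcases List.mem_append.1 hc with hc | hc
            · exact hr.trans (cappedLeaves_mono C (hgt_gt c hc).2.le)
            · rcases List.mem_append.1 hc with hc | hc
              · exact hr.trans (cappedLeaves_mono C (heq_eq c hc).2.ge)
              · exact h.unfilled c hc)
      exact ⟨hv, by omega⟩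

theorem exists_forall_leaves_le {cs : List (InfoTree V)} (h : cs ≠ []) :
    ∃ c ∈ cs, ∀ d ∈ cs, d.leaves ≤ c.leaves := by
  induction cs with
  | nil => simp at h
  | cons c cs ih =>
    rcases eq_or_ne cs [] with rfl | hne
    · exact ⟨c, by simp, by simp⟩
    · obtain ⟨d, hd, hmax⟩ := ih hne
      rcases le_total c.leaves d.leaves with hle | hle
      · exact ⟨d, by simp [hd], by simpa using ⟨hle, hmax⟩⟩
      · exact ⟨c, by simp, by simpa using fun e he => (hmax e he).trans hle⟩

theorem Labelling.Correct.split {t : InfoTree V} (hv : t.Valid) (hne : t.children ≠ []) {r : ℕ}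
    (hr : 1 ≤ r) (hr' : r ≤ t.leaves) {D : Labelling V} (h : D.Correct t.children r []) {s k q : ℕ}
    (hs : s = r - D.filledLeaves) (hk : k = D.unfilledCount) (hq : q = (s + k - 1) / k) :
    Split t r D.filled D.unfilled q (s - k * (q - 1)) := by
  obtain ⟨F, U, f, u⟩ := D
  obtain ⟨hp, hf, hu, -, -, hF, hU⟩ := h
  dsimp only at *
  subst hf hu
  rw [List.append_nil] at hp
  rw [hv.leaves_eq hne] at hr'
  -- Capped at the capacity of a largest filled child, the sum contains all filled children in full,
  -- and it is below `r` by the criterion for that child.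
  have hFr : (F.map InfoTree.leaves).sum < r := by
    rcases eq_or_ne F [] with rfl | hFne
    · simp; omega
    · obtain ⟨c, hc, hmax⟩ := exists_forall_leaves_le hFne
      have := hF c hc
      rw [← cappedLeaves_perm hp, cappedLeaves_append, cappedLeaves_of_le hmax] at this
      omega
  have hUne : U ≠ [] := by
    rintro rfl
    rw [List.append_nil] at hp
    have := (hp.map InfoTree.leaves).sum_eq
    omega
  have hkpos : 0 < k := hk ▸ List.length_pos_iff.2 hUne
  have hdiv := Nat.div_add_mod (s + k - 1) k
  have hmod := Nat.mod_lt (s + k - 1) hkpos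
  rw [← hq] at hdiv
  have hq1 : 1 ≤ q := by
    rw [hq, Nat.one_le_div_iff hkpos]
    omega
  obtain ⟨p, rfl⟩ : ∃ p, q = p + 1 := ⟨q - 1, by omega⟩
  rw [mul_add, mul_one] at hdiv
  simp only [Nat.add_sub_cancel]
  refine ⟨hp, ?_, by omega, by omega, hq1, fun c hc => ?_, hF⟩
  · have := Nat.mul_comm k p
    rw [← hk, Nat.add_sub_cancel]
    omega
  -- For an unfilled `c` the criterion gives `r ≤ Σ_F ℓ + k ℓ(c)`, that is `s ≤ k ℓ(c)`. Hence the
  -- ceiling `q` of `s / k` is at most the capacity of `c`.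
  · have h1 := hU c hc
    rw [← cappedLeaves_perm hp, cappedLeaves_append] at h1
    have h2 : cappedLeaves F c.leaves ≤ (F.map InfoTree.leaves).sum :=
      List.sum_le_sum fun _ _ => min_le_left _ _
    have h3 : cappedLeaves U c.leaves ≤ (U.map fun _ => c.leaves).sum :=
      List.sum_le_sum fun _ _ => min_le_right _ _
    rw [List.map_const', List.sum_replicate, smul_eq_mul, ← hk] at h3
    have h4 : k * p < k * c.leaves := by omega
    exact Nat.lt_of_mul_lt_mul_left h4

/-- `d` is the tree of subproblems for the tree `t` and `r` or `r - 1` replicas. -/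
inductive IsDivision (early : Bool) : DividedTree V → InfoTree V → ℕ → Prop
  | single (t : InfoTree V) (hv : t.Valid) (h : early = true ∨ t.children = []) :
      IsDivision early (.single t) t 1
  | node (t : InfoTree V) (r : ℕ) (F : List (InfoTree V)) (zs : List (DividedTree V × InfoTree V))
      (q high : ℕ) (hv : t.Valid) (hr : early = true → 2 ≤ r)
      (hs : Split t r F (zs.map Prod.snd) q high) (h : ∀ z ∈ zs, IsDivision early z.1 z.2 q) :
      IsDivision early (.node r t.weight F (zs.map Prod.fst) high) t r

/-- The slack 5012 left by each subproblem pays for that child's part of the linear work at its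
parent. Filled children start no subproblem, and their own sizes pay for them. -/
theorem divide_spec (early : Bool) (fuel : ℕ) (t : InfoTree V) (r : ℕ) (hv : t.Valid)
    (hfuel : t.size ≤ fuel) (hr : 1 ≤ r) (hr' : r ≤ t.leaves) :
    IsDivision early (divide early fuel t r).val t r ∧
      (divide early fuel t r).time + 5012 ≤ 10024 * t.size := by
  induction fuel generalizing t r with
  | zero =>
    have := hv.size_eq
    have := hv.weight_pos
    omega
  | succ fuel ih =>
    have hsize := hv.size_eq
    have hw := hv.weight_pos
    simp only [divide, Timed.val_bind, Timed.time_bind, op_val, op_time]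
    by_cases hdone : (t.children.isEmpty || early && decide (r = 1)) = true
    · rw [if_pos hdone]
      simp only [Bool.or_eq_true, List.isEmpty_iff, Bool.and_eq_true, decide_eq_true_eq] at hdone
      obtain rfl : r = 1 := by
        rcases hdone with h | h
        · have := hv.leaves_eq_one h; omega
        · exact h.2
      exact ⟨.single t hv (hdone.symm.imp_left And.left), by simp; omega⟩
    · rw [if_neg hdone]
      simp only [Bool.or_eq_true, List.isEmpty_iff, Bool.and_eq_true, decide_eq_true_eq,
        not_or, not_and] at hdone
      obtain ⟨hne, hearly⟩ := hdone
      obtain ⟨hD, hDt⟩ := getFilled_spec t.children r t.children.length t.children ⟨[], [], 0, 0⟩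
        le_rfl ⟨by simp, rfl, rfl, by simp, by simp, by simp, by simp⟩
      simp only [Timed.val_bind, Timed.time_bind, op_val, op_time, count_val, count_time,
        mapList_val, mapList_time]
      have hlen : 0 < t.children.length := List.length_pos_iff.2 hne
      generalize (getFilled r t.children.length t.children ⟨[], [], 0, 0⟩).time = T at *
      generalize (getFilled r t.children.length t.children ⟨[], [], 0, 0⟩).val = D at *
      have hs := hD.split hv hne hr hr' rfl rfl rfl
      generalize (r - D.filledLeaves + D.unfilledCount - 1) / D.unfilledCount = q at *
      have hmem : ∀ c ∈ D.unfilled, c ∈ t.children := fun c hc =>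
        hs.perm.subset (List.mem_append_right _ hc)
      have ih' : ∀ c ∈ D.unfilled, _ := fun c hc => ih c q (hv.children c (hmem c hc))
        (by have := hv.size_le_of_mem (hmem c hc); omega) hs.q_pos (hs.q_le c hc)
      constructor
      · have := IsDivision.node t r D.filled
          (D.unfilled.map fun c => ((divide early fuel c q).val, c)) q _ hv
          (fun he => by have := hearly he; omega) (by simpa [Function.comp_def] using hs)
          (by simpa using fun c hc => (ih' c hc).1)
        simpa [Function.comp_def] using this
      · have h1 : (D.unfilled.map fun c => (divide early fuel c q).time).sum +
            5012 * D.unfilled.length ≤ 10024 * (D.unfilled.map InfoTree.size).sum := by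
          rw [← List.sum_map_mul_left]
          have := List.sum_le_sum fun c hc => (ih' c hc).2
          rw [List.sum_map_add] at this
          simpa [mul_comm] using this
        have h2 : 5012 * D.filled.length ≤ 10024 * (D.filled.map InfoTree.size).sum := by
          rw [← List.sum_map_mul_left]
          refine le_trans (le_of_eq ?_) (List.sum_le_sum (f := fun _ => 5012) fun c hc => ?_)
          · simp [mul_comm]
          · have hc := hv.children c (hs.perm.subset (List.mem_append_left _ hc))
            have := hc.size_eq
            have := hc.weight_pos
            omega
        have h3 := (hs.perm.map InfoTree.size).sum_eq
        rw [List.map_append, List.sum_append] at h3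
        have h4 := hs.perm.length_eq
        rw [List.length_append] at h4
        omega

end ReplicaPlacement

namespace ReplicaPlacement

open Polynomial

variable {V : Type}

/-! ## Vectors -/

/-- The entries of the array `w` are the coefficients of `p`. -/
def Rep (w : Array ℕ) (p : ℕ[X]) : Prop := ∀ i, w.getD i 0 = p.coeff i

theorem rep_replicate (n : ℕ) : Rep (Array.replicate n 0) 0 := by
  intro i
  simp [Array.getD_eq_getD_getElem?, Array.getElem?_replicate]
  split_ifs <;> rfl

theorem rep_addAt {w : Array ℕ} {p : ℕ[X]} (h : Rep w p) {i : ℕ} (hi : i < w.size) (x : ℕ) :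
    Rep (addAt w i x).val (p + monomial i x) ∧ (addAt w i x).val.size = w.size := by
  refine ⟨fun j => ?_, by simp [addAt]⟩
  have := h j
  simp only [addAt, op_val, Array.getD_eq_getD_getElem?, Array.getElem?_setIfInBounds, coeff_add,
    coeff_monomial] at this ⊢
  by_cases hij : i = j
  · subst hij; simp [hi, ← this]
  · simp [hij, this]

@[simp] theorem addAt_time (w : Array ℕ) (i x : ℕ) : (addAt w i x).time = 1 := rfl

theorem addEntries_spec (v w : Array ℕ) (m : ℕ) (hm : m ≤ w.size) :
    (∀ i, (addEntries v m w).val.getD i 0 = w.getD i 0 + if i < m then v.getD i 0 else 0) ∧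
      (addEntries v m w).val.size = w.size ∧ (addEntries v m w).time = m + 1 := by
  induction m generalizing w with
  | zero => simp [addEntries]
  | succ m ih =>
    have hsize : (addAt w m (v.getD m 0)).val.size = w.size := by simp [addAt]
    obtain ⟨h1, h2, h3⟩ := ih (addAt w m (v.getD m 0)).val (by omega)
    simp only [addEntries, Timed.val_bind, Timed.time_bind, addAt_time]
    refine ⟨fun i => ?_, by omega, by omega⟩
    rw [h1]
    simp only [addAt, op_val, Array.getD_eq_getD_getElem?, Array.getElem?_setIfInBounds]
    rcases lt_trichotomy i m with h | rfl | h
    · simp [h, h.ne', Nat.lt_succ_of_lt h]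
    · simp [show i < w.size by omega]
    · simp [h.ne, show ¬ i < m by omega, show ¬ i < m + 1 by omega]

theorem addVector_spec {v w : Array ℕ} {p q : ℕ[X]} (hv : Rep v p) (hw : Rep w q)
    (hle : v.size ≤ w.size) : Rep (addVector v w).val (q + p) ∧
      (addVector v w).val.size = w.size ∧ (addVector v w).time = v.size + 1 := by
  obtain ⟨h1, h2, h3⟩ := addEntries_spec v w v.size hle
  refine ⟨fun i => ?_, h2, h3⟩
  rw [addVector, h1, coeff_add, hw i, ← hv i]
  congr 1
  split_ifs with h
  · rfl
  · simp

/-- Stated relative to what is known of the members, so that it can be applied to the children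
inside the induction of `addFilled_spec`. -/
theorem addFilledList_spec_of (cs : List (InfoTree V))
    (h : ∀ c ∈ cs, ∀ {w : Array ℕ} {p : ℕ[X]}, Rep w p → c.leaves < w.size →
      Rep (addFilled c w).val (p + c.full) ∧ (addFilled c w).val.size = w.size ∧
        (addFilled c w).time ≤ 2 * c.size)
    {w : Array ℕ} {p : ℕ[X]} (hw : Rep w p) (hl : ∀ c ∈ cs, c.leaves < w.size) :
    Rep (addFilledList cs w).val (p + (cs.map InfoTree.full).sum) ∧
      (addFilledList cs w).val.size = w.size ∧
        (addFilledList cs w).time ≤ 2 * (cs.map InfoTree.size).sum + 1 := by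
  induction cs generalizing w p with
  | nil => simpa [addFilledList] using hw
  | cons c cs ih =>
    simp only [List.mem_cons, forall_eq_or_imp] at hl
    obtain ⟨h1, h2, h3⟩ := h c (by simp) hw hl.1
    obtain ⟨h4, h5, h6⟩ := ih (fun d hd => h d (by simp [hd])) h1 (by rw [h2]; exact hl.2)
    simp only [addFilledList, Timed.val_bind, Timed.time_bind, List.map_cons, List.sum_cons]
    exact ⟨by rwa [← add_assoc], by omega, by omega⟩

theorem addFilled_spec {t : InfoTree V} (hv : t.Valid) {w : Array ℕ} {p : ℕ[X]} (hw : Rep w p)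
    (hl : t.leaves < w.size) : Rep (addFilled t w).val (p + t.full) ∧
      (addFilled t w).val.size = w.size ∧ (addFilled t w).time ≤ 2 * t.size := by
  induction t using InfoTree.induction generalizing w p with
  | h t ih =>
    obtain ⟨h1, h2⟩ := rep_addAt hw hl t.weight
    have hcl : ∀ c ∈ t.children, c.leaves < (addAt w t.leaves t.weight).val.size := by
      intro c hc
      rw [h2]
      refine lt_of_le_of_lt ?_ hl
      rw [hv.leaves_eq (List.ne_nil_of_mem hc)]
      exact List.single_le_sum (by simp) _ (List.mem_map_of_mem hc)
    obtain ⟨h3, h4, h5⟩ := addFilledList_spec_of t.children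
      (fun c hc => ih c hc (hv.children c hc)) h1 hcl
    have hsize := hv.size_eq
    have hpos := hv.weight_pos
    rw [hv.full_eq, ← add_assoc]
    cases t
    simp only [addFilled, Timed.val_bind, Timed.time_bind, addAt_time]
    exact ⟨h3, h4.trans h2, by dsimp only at *; omega⟩

theorem addFilledList_spec {cs : List (InfoTree V)} (hv : ∀ c ∈ cs, c.Valid) {w : Array ℕ}
    {p : ℕ[X]} (hw : Rep w p) (hl : ∀ c ∈ cs, c.leaves < w.size) :
    Rep (addFilledList cs w).val (p + (cs.map InfoTree.full).sum) ∧
      (addFilledList cs w).val.size = w.size ∧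
        (addFilledList cs w).time ≤ 2 * (cs.map InfoTree.size).sum + 1 :=
  addFilledList_spec_of cs (fun c hc _ _ hw hl => addFilled_spec (hv c hc) hw hl) hw hl

/-! ## Plans -/

/-- The leaves chosen by a plan. -/
def Plan.leaves : Plan V → Multiset V
  | .empty => 0
  | .leaf v => {v}
  | .all t => t.leafMultiset
  | .join p q => p.leaves + q.leaves

theorem writeLeavesList_val_of (cs : List (InfoTree V))
    (h : ∀ c ∈ cs, ∀ out, ((writeLeaves c out).val : Multiset V) = c.leafMultiset + out)
    (out : List V) :
    ((writeLeavesList cs out).val : Multiset V) = (cs.map InfoTree.leafMultiset).sum + out := by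
  induction cs with
  | nil => simp [writeLeavesList]
  | cons c cs ih =>
    simp only [writeLeavesList, Timed.val_bind, List.map_cons, List.sum_cons]
    rw [h c (by simp), ih fun d hd => h d (by simp [hd]), add_assoc]

theorem writeLeaves_val (t : InfoTree V) (out : List V) :
    ((writeLeaves t out).val : Multiset V) = t.leafMultiset + out := by
  induction t using InfoTree.induction generalizing out with
  | h t ih =>
    have := writeLeavesList_val_of t.children ih out
    obtain ⟨w, l, s, d, v, cs⟩ := t
    cases cs with
    | nil => simp [writeLeaves, ← Multiset.cons_coe, ← Multiset.singleton_add]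
    | cons c cs =>
      simp only [writeLeaves]
      rwa [InfoTree.leafMultiset_node _ _ _ _ _ (by simp)]

theorem writeLeavesList_time_le_of (cs : List (InfoTree V))
    (h : ∀ c ∈ cs, ∀ out, (writeLeaves c out).time + 1 ≤ 2 * c.size) (out : List V) :
    (writeLeavesList cs out).time ≤ 2 * (cs.map InfoTree.size).sum + 1 := by
  induction cs with
  | nil => simp [writeLeavesList]
  | cons c cs ih =>
    have := ih fun d hd => h d (by simp [hd])
    have := h c (by simp) (writeLeavesList cs out).val
    simp only [writeLeavesList, Timed.time_bind, List.map_cons, List.sum_cons]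
    omega

theorem writeLeaves_time_lt {t : InfoTree V} (hv : t.Valid) (out : List V) :
    (writeLeaves t out).time + 1 ≤ 2 * t.size := by
  induction t using InfoTree.induction generalizing out with
  | h t ih =>
    have := writeLeavesList_time_le_of t.children (fun c hc => ih c hc (hv.children c hc)) out
    have hsize := hv.size_eq
    have hpos := hv.weight_pos
    obtain ⟨w, l, s, d, v, cs⟩ := t
    cases cs with
    | nil => simp [writeLeaves] at *; omega
    | cons c cs =>
      simp only [writeLeaves] at *
      omega

theorem writePlan_time_empty (out : List V) : (writePlan .empty out).time = 1 := by
  simp [writePlan]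

theorem writePlan_time_join {p q : Plan V} {m n : ℕ} (hp : ∀ out, (writePlan p out).time ≤ m)
    (hq : ∀ out, (writePlan q out).time ≤ n) (out : List V) :
    (writePlan (.join p q) out).time ≤ m + n + 1 := by
  have h1 := hq out
  have h2 := hp (writePlan q out).val
  simp only [writePlan, Timed.time_bind, op_time]
  omega

theorem planFilled_spec {F : List (InfoTree V)} (hv : ∀ c ∈ F, c.Valid) (p : Plan V) {n : ℕ}
    (hp : ∀ out, (writePlan p out).time ≤ n) :
    (planFilled F p).val.leaves = (F.map InfoTree.leafMultiset).sum + p.leaves ∧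
      (∀ out, (writePlan (planFilled F p).val out).time ≤ n + 2 * (F.map InfoTree.size).sum) ∧
        (planFilled F p).time = F.length + 1 := by
  induction F generalizing p n with
  | nil => simpa [planFilled] using hp
  | cons c F ih =>
    have hc : ∀ out, (writePlan (.all c) out).time ≤ 2 * c.size - 1 := fun out => by
      have := writeLeaves_time_lt (hv c (by simp)) out
      simp only [writePlan]
      omega
    have hpos : 1 ≤ c.size := by
      have := (hv c (by simp)).size_eq
      have := (hv c (by simp)).weight_pos
      omega
    obtain ⟨h1, h2, h3⟩ := ih (fun d hd => hv d (by simp [hd])) (.join (.all c) p)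
      (writePlan_time_join hc hp)
    simp only [planFilled, Timed.val_bind, Timed.time_bind, op_val, op_time, List.map_cons,
      List.sum_cons, List.length_cons]
    refine ⟨?_, fun out => ?_, by omega⟩
    · rw [h1, Plan.leaves, Plan.leaves]; abel
    · have := h2 out; omega

theorem writePlan_val (p : Plan V) (out : List V) :
    ((writePlan p out).val : Multiset V) = p.leaves + out := by
  induction p generalizing out with
  | empty => simp [writePlan, Plan.leaves]
  | leaf v => simp [writePlan, Plan.leaves, ← Multiset.cons_coe, ← Multiset.singleton_add]
  | all t => simp [writePlan, Plan.leaves, writeLeaves_val]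
  | join p q ihp ihq =>
    simp only [writePlan, Timed.val_bind, op_val, Plan.leaves, ihp, ihq, add_assoc]

/-! ## Conquer phase -/

/-- The vectors, of length `D`, and the plans in `x` are those of the shares in `z`. -/
structure Solution.Represents (x : Solution V) (D : ℕ) (z : Offer V) : Prop where
  lo_size : x.lo.size = D
  hi_size : x.hi.size = D
  lo : Rep x.lo z.lo
  hi : Rep x.hi z.hi
  loPlan : x.loPlan.leaves = z.loLeaves
  hiPlan : x.hiPlan.leaves = z.hiLeaves
  -- The spare step pays for the `join` under which the plan is placed at the parent.
  loTime : ∀ out, (writePlan x.loPlan out).time + 1 ≤ 2 * z.tree.size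
  hiTime : ∀ out, (writePlan x.hiPlan out).time + 1 ≤ 2 * z.tree.size

-- Lexicographic order as order of numbers in base `B`

theorem abs_digitSum_lt {B : ℤ} (hB : 1 ≤ B) (e : ℕ → ℤ) (h : ∀ i, |e i| ≤ B - 1) (m : ℕ) :
    |∑ i ∈ Finset.range m, e i * B ^ i| < B ^ m := by
  induction m with
  | zero => simp
  | succ m ih =>
    rw [Finset.sum_range_succ]
    have h1 := abs_add_le (∑ i ∈ Finset.range m, e i * B ^ i) (e m * B ^ m)
    have h2 : |e m * B ^ m| ≤ (B - 1) * B ^ m := by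
      rw [abs_mul, abs_of_pos (by positivity : (0 : ℤ) < B ^ m)]
      exact mul_le_mul_of_nonneg_right (h m) (by positivity)
    rw [pow_succ]
    linarith

/-- Lower positions change the difference by less than `B ^ m`, which a difference of at least one
at position `m` outweighs. Digits may be negative; only their differences are bounded. -/
theorem digitSum_lt_digitSum {B : ℤ} (hB : 1 ≤ B) {f g : ℕ → ℤ} (h : ∀ i, |f i - g i| ≤ B - 1)
    {m : ℕ} (hm : f m < g m) :
    ∑ i ∈ Finset.range (m + 1), f i * B ^ i < ∑ i ∈ Finset.range (m + 1), g i * B ^ i := by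
  have h1 := (abs_lt.1 (abs_digitSum_lt hB (fun i => f i - g i) h m)).2
  simp only [sub_mul, Finset.sum_sub_distrib] at h1
  rw [Finset.sum_range_succ, Finset.sum_range_succ]
  have h2 : (0 : ℤ) < B ^ m := by positivity
  nlinarith

/-- The difference of the two vectors, read as a number in base `B`. -/
def Solution.gain (B : ℕ) (x : Solution V) : ℤ :=
  ∑ i ∈ Finset.range x.hi.size, ((x.hi.getD i 0 : ℤ) - x.lo.getD i 0) * (B : ℤ) ^ i

/-- The vector `x.hi` has length `D`, and the entries are small with respect to `B`. -/
def Solution.Small (B D : ℕ) (x : Solution V) : Prop :=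
  x.hi.size = D ∧ ∀ i, 2 * x.hi.getD i 0 < B ∧ 2 * x.lo.getD i 0 < B

theorem compareEntries_spec {B D : ℕ} {x y : Solution V} (hx : x.Small B D) (hy : y.Small B D)
    (m : ℕ) :
    (compareEntries x y m).val =
      compare (∑ i ∈ Finset.range m, ((x.hi.getD i 0 : ℤ) - x.lo.getD i 0) * (B : ℤ) ^ i)
        (∑ i ∈ Finset.range m, ((y.hi.getD i 0 : ℤ) - y.lo.getD i 0) * (B : ℤ) ^ i) ∧
      (compareEntries x y m).time ≤ 4 * m + 1 := by
  have hB : (1 : ℤ) ≤ B := by have := hx.2 0; omega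
  -- All four entries are below `B / 2`, so a difference of two differences stays within `B - 1`.
  -- This requires the factor 2 in the bounds on `B`.
  have hdig : ∀ i, |((x.hi.getD i 0 : ℤ) - x.lo.getD i 0) -
      ((y.hi.getD i 0 : ℤ) - y.lo.getD i 0)| ≤ (B : ℤ) - 1 := fun i => by
    have := hx.2 i
    have := hy.2 i
    rw [abs_le]; constructor <;> omega
  have hdig' : ∀ i, |((y.hi.getD i 0 : ℤ) - y.lo.getD i 0) -
      ((x.hi.getD i 0 : ℤ) - x.lo.getD i 0)| ≤ (B : ℤ) - 1 := fun i => by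
    rw [abs_sub_comm]; exact hdig i
  induction m with
  | zero => simp [compareEntries]
  | succ m ih =>
    simp only [compareEntries, Timed.val_bind, Timed.time_bind, op_val, op_time]
    rcases lt_trichotomy ((x.hi.getD m 0 : ℤ) - x.lo.getD m 0)
      ((y.hi.getD m 0 : ℤ) - y.lo.getD m 0) with h | h | h
    · rw [compare_lt_iff_lt.2 h]
      exact ⟨(compare_lt_iff_lt.2 (digitSum_lt_digitSum hB hdig h)).symm, by simp; omega⟩
    · rw [compare_eq_iff_eq.2 h, Finset.sum_range_succ, Finset.sum_range_succ, h]
      refine ⟨ih.1.trans ?_, by dsimp only; omega⟩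
      generalize ∑ i ∈ Finset.range m, ((x.hi.getD i 0 : ℤ) - x.lo.getD i 0) * (B : ℤ) ^ i = a
      generalize ∑ i ∈ Finset.range m, ((y.hi.getD i 0 : ℤ) - y.lo.getD i 0) * (B : ℤ) ^ i = b
      rcases lt_trichotomy a b with h | h | h
      · rw [compare_lt_iff_lt.2 h, compare_lt_iff_lt.2 (by linarith)]
      · rw [compare_eq_iff_eq.2 h, compare_eq_iff_eq.2 (by linarith)]
      · rw [compare_gt_iff_gt.2 h, compare_gt_iff_gt.2 (by linarith)]
    · rw [compare_gt_iff_gt.2 h]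
      exact ⟨(compare_gt_iff_gt.2 (digitSum_lt_digitSum hB hdig' h)).symm, by simp; omega⟩

theorem comparesBy_compareGain (B D : ℕ) :
    ComparesBy (compareGain (V := V)) (Solution.gain B) (4 * D + 1) (Solution.Small B D) := by
  intro x y hx hy
  obtain ⟨h1, h2⟩ := compareEntries_spec hx hy x.hi.size
  refine ⟨?_, ?_⟩
  · rw [compareGain, h1, Solution.gain, Solution.gain, hx.1, hy.1]
  · rw [compareGain]; rwa [hx.1] at h2 ⊢

/-- The pivot has rank `m - 1`, so position `m - 1` of the rearranged list lies in the block of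
solutions with the same price as the pivot. The element `z` found there separates the prices before
it from those after it, and so it is a valid threshold for taking the first `m` as well as the first
`m - 1`. -/
theorem bringForward_spec {B D : ℕ} {xs : List (Solution V)} (hxs : ∀ x ∈ xs, x.Small B D) {m : ℕ}
    (hm : 1 ≤ m) (hm' : m ≤ xs.length) :
    (∃ as z bs, (bringForward m xs).val = as ++ z :: bs ∧ (as ++ z :: bs).Perm xs ∧
      as.length + 1 = m ∧ (∀ a ∈ as, a.gain B ≤ z.gain B) ∧ ∀ b ∈ bs, z.gain B ≤ b.gain B) ∧
    (bringForward m xs).time ≤ 1010 * (4 * D + 2) * xs.length := by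
  have hcmp := comparesBy_compareGain (V := V) B D
  obtain ⟨⟨p, hp, hpm, hr₁, hr₂⟩, hst⟩ := select_spec hcmp xs.length xs (m - 1) hxs le_rfl (by omega)
  have hpS := hxs p hpm
  have hpt := partition_time_le hcmp hpS xs hxs
  have htri := countP_trichotomy (Solution.gain B) xs (p.gain B)
  have hperm := perm_filter_trichotomy (Solution.gain B) xs (p.gain B)
  simp only [bringForward, Timed.val_bind, Timed.time_bind, count_val, count_time, hp,
    partition_val hcmp hpS xs hxs, append_val, append_time]
  have hlt_lt : ∀ c ∈ xs.filter (fun c => c.gain B < p.gain B), c.gain B < p.gain B := by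
    intro c hc; simpa using (List.mem_filter.1 hc).2
  have heq_eq : ∀ c ∈ xs.filter (fun c => c.gain B = p.gain B), c.gain B = p.gain B := by
    intro c hc; simpa using (List.mem_filter.1 hc).2
  have hgt_gt : ∀ c ∈ xs.filter (fun c => p.gain B < c.gain B), p.gain B < c.gain B := by
    intro c hc; simpa using (List.mem_filter.1 hc).2
  simp only [List.countP_eq_length_filter] at htri hr₁ hr₂
  generalize xs.filter (fun c => c.gain B < p.gain B) = lt at *
  generalize xs.filter (fun c => c.gain B = p.gain B) = eq at *
  generalize xs.filter (fun c => p.gain B < c.gain B) = gt at *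
  constructor
  · have hi : m - 1 - lt.length < eq.length := by omega
    have hsplit : eq = eq.take (m - 1 - lt.length) ++
        eq[m - 1 - lt.length] :: eq.drop (m - 1 - lt.length + 1) := by
      rw [← List.drop_eq_getElem_cons, List.take_append_drop]
    have hval : lt ++ (eq ++ gt) = lt ++ eq.take (m - 1 - lt.length) ++
        eq[m - 1 - lt.length] :: (eq.drop (m - 1 - lt.length + 1) ++ gt) := by
      have := congrArg (fun l => lt ++ (l ++ gt)) hsplit
      simpa only [List.append_assoc, List.cons_append] using this
    have hz := heq_eq _ (List.getElem_mem hi)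
    refine ⟨lt ++ eq.take (m - 1 - lt.length), eq[m - 1 - lt.length],
      eq.drop (m - 1 - lt.length + 1) ++ gt, ?_, ?_, ?_, ?_, ?_⟩
    · exact hval
    · exact List.Perm.trans (List.Perm.of_eq (by rw [← hval, List.append_assoc])) hperm
    · simp; omega
    · intro a ha
      rw [hz]
      rcases List.mem_append.1 ha with ha | ha
      · exact (hlt_lt a ha).le
      · exact (heq_eq a (List.mem_of_mem_take ha)).le
    · intro a ha
      rw [hz]
      rcases List.mem_append.1 ha with ha | ha
      · exact (heq_eq a (List.mem_of_mem_drop ha)).ge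
      · exact (hgt_gt a ha).le
  · have h1 : 1 ≤ xs.length := by omega
    have h2 : eq.length + lt.length ≤ xs.length := by omega
    have : 0 ≤ D * xs.length := Nat.zero_le _
    linarith

theorem combine_spec {D : ℕ} (as bs : List (Solution V × Offer V))
    (h : ∀ z ∈ as ++ bs, z.1.Represents D z.2) {w : Array ℕ} {f : ℕ[X]} (hw : Rep w f)
    (hD : D ≤ w.size) {p : Plan V} {n : ℕ} (hp : ∀ out, (writePlan p out).time ≤ n) :
    Rep (combine as.length ((as ++ bs).map Prod.fst) w p).val.1
        (f + (as.map fun z => z.2.hi).sum + (bs.map fun z => z.2.lo).sum) ∧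
      (combine as.length ((as ++ bs).map Prod.fst) w p).val.1.size = w.size ∧
      (combine as.length ((as ++ bs).map Prod.fst) w p).val.2.leaves =
        p.leaves + (as.map fun z => z.2.hiLeaves).sum + (bs.map fun z => z.2.loLeaves).sum ∧
      (∀ out, (writePlan (combine as.length ((as ++ bs).map Prod.fst) w p).val.2 out).time ≤
        n + 2 * ((as ++ bs).map fun z => z.2.tree.size).sum) ∧
      (combine as.length ((as ++ bs).map Prod.fst) w p).time ≤
        (D + 2) * (as.length + bs.length) + 1 := by
  induction as generalizing w f p n with
  | nil =>
    induction bs generalizing w f p n with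
    | nil => simpa [combine] using ⟨hw, hp⟩
    | cons z bs ih =>
      have hz := h z (by simp)
      obtain ⟨h1, h2, h3⟩ := addVector_spec hz.lo hw (hz.lo_size.trans_le hD)
      have hpz : ∀ out, (writePlan (.join z.1.loPlan p) out).time ≤ n + 2 * z.2.tree.size :=
        fun out => (writePlan_time_join (m := 2 * z.2.tree.size - 1)
          (fun out => by have := hz.loTime out; omega) hp out).trans
            (by have := hz.loTime out; omega)
      obtain ⟨h4, h5, h6, h7, h8⟩ := ih (fun y hy => h y (by simp at hy ⊢; tauto)) h1 (h2 ▸ hD) hpz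
      simp only [List.nil_append, List.length_nil, List.map_nil, List.sum_nil, add_zero,
        zero_add, List.map_cons, List.sum_cons, combine, Timed.val_bind, Timed.time_bind, op_val,
        op_time, List.length_cons] at *
      rw [hz.lo_size] at h3
      refine ⟨by rwa [← add_assoc], by omega, ?_, fun out => ?_, ?_⟩
      · rw [h6, Plan.leaves, hz.loPlan]; abel
      · have := h7 out; omega
      · simp only [add_mul, mul_add] at *; omega
  | cons z as ih =>
    have hz := h z (by simp)
    obtain ⟨h1, h2, h3⟩ := addVector_spec hz.hi hw (hz.hi_size.trans_le hD)
    have hpz : ∀ out, (writePlan (.join z.1.hiPlan p) out).time ≤ n + 2 * z.2.tree.size :=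
      fun out => (writePlan_time_join (m := 2 * z.2.tree.size - 1)
        (fun out => by have := hz.hiTime out; omega) hp out).trans
          (by have := hz.hiTime out; omega)
    obtain ⟨h4, h5, h6, h7, h8⟩ := ih (fun y hy => h y (by simp at hy ⊢; tauto)) h1 (h2 ▸ hD) hpz
    simp only [List.cons_append, List.map_cons, List.sum_cons, combine, Timed.val_bind,
      Timed.time_bind, op_val, op_time, List.length_cons] at *
    rw [hz.hi_size] at h3
    refine ⟨by rwa [← add_assoc f], by omega, ?_, fun out => ?_, ?_⟩
    · rw [h6, Plan.leaves, hz.hiPlan]; abel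
    · have := h7 out; omega
    · simp only [add_mul, mul_add] at *; omega

end ReplicaPlacement

-- The conquer step at a single node

namespace ReplicaPlacement

open Polynomial

variable {V : Type}

/-- Entries beyond the end of an array read as the default `0`, so `Rep` also bounds the degree of
the polynomial by the length of the array. -/
theorem eval_eq_digitSum {w : Array ℕ} {p : ℕ[X]} (h : Rep w p) (B : ℕ) :
    p.eval B = ∑ i ∈ Finset.range w.size, w.getD i 0 * B ^ i := by
  have hzero : ∀ i, w.size ≤ i → p.coeff i = 0 := fun i hi => by rw [← h i]; simp [hi]
  have hdeg : p.natDegree < w.size + 1 :=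
    Nat.lt_succ_of_le (natDegree_le_iff_coeff_eq_zero.2 fun i hi => hzero i hi.le)
  rw [eval_eq_sum_range' hdeg, Finset.sum_range_succ, hzero _ le_rfl, zero_mul, add_zero]
  exact Finset.sum_congr rfl fun i _ => by rw [h i]

theorem Solution.Represents.gain_eq {x : Solution V} {D : ℕ} {z : Offer V} (h : x.Represents D z)
    (B : ℕ) : x.gain B = z.gain B := by
  rw [Solution.gain, Offer.gain, Share.cost, Share.cost, Offer.hiShare, Offer.loShare,
    eval_eq_digitSum h.hi, eval_eq_digitSum h.lo, h.lo_size, h.hi_size]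
  push_cast
  rw [← Finset.sum_sub_distrib]
  exact Finset.sum_congr rfl fun i _ => by ring

theorem Solution.Represents.small {x : Solution V} {D : ℕ} {z : Offer V} (h : x.Represents D z)
    (hv : z.tree.Valid) {B q : ℕ} (hB : 2 * z.tree.size < B) (ho : z.Optimal B q) :
    x.Small B D := by
  refine ⟨h.hi_size, fun i => ?_⟩
  have h1 := ho.1.1.coeff_le hv i
  have h2 := ho.2.1.coeff_le hv i
  rw [h.hi i, h.lo i]
  dsimp only [Offer.loShare, Offer.hiShare] at h1 h2
  omega

theorem Split.le {t : InfoTree V} {r q high : ℕ} {F U : List (InfoTree V)}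
    (h : Split t r F U q high) : q ≤ r := by
  have h1 := h.total
  have h2 := h.high_pos
  have h3 := h.high_le
  have h4 : 1 * (q - 1) ≤ U.length * (q - 1) := Nat.mul_le_mul_right _ (by omega)
  omega

theorem Split.filled_lt {t : InfoTree V} {r q high : ℕ} {F U : List (InfoTree V)}
    (h : Split t r F U q high) : ∀ c ∈ F, c.leaves < r := by
  intro c hc
  have h1 := h.total
  have h2 := h.high_pos
  have := List.single_le_sum (l := F.map InfoTree.leaves) (by simp) c.leaves
    (List.mem_map_of_mem hc)
  omega

theorem Split.filled_valid {t : InfoTree V} (hv : t.Valid) {r q high : ℕ} {F U : List (InfoTree V)}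
    (h : Split t r F U q high) : ∀ c ∈ F, c.Valid :=
  fun c hc => hv.children c (h.perm.subset (List.mem_append_left _ hc))

theorem Split.mem_children {t : InfoTree V} {r q high : ℕ} {F U : List (InfoTree V)}
    (h : Split t r F U q high) : ∀ c ∈ U, c ∈ t.children :=
  fun _ hc => h.perm.subset (List.mem_append_right _ hc)

theorem Split.size_eq {t : InfoTree V} (hv : t.Valid) {r q high : ℕ} {F U : List (InfoTree V)}
    (h : Split t r F U q high) :
    t.size = t.weight + (F.map InfoTree.size).sum + (U.map InfoTree.size).sum := by
  rw [hv.size_eq, ← (h.perm.map _).sum_eq, List.map_append, List.sum_append, add_assoc]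

theorem length_le_sum_size {F : List (InfoTree V)} (h : ∀ c ∈ F, c.Valid) :
    F.length ≤ (F.map InfoTree.size).sum := by
  induction F with
  | nil => simp
  | cons c F ih =>
    have := ih fun d hd => h d (by simp [hd])
    have := (h c (by simp)).size_eq
    have := (h c (by simp)).weight_pos
    simp only [List.map_cons, List.sum_cons, List.length_cons]
    omega

theorem conquer_single {dim : ℕ → ℕ} (hdim : 2 ≤ dim 1) {t : InfoTree V} (hv : t.Valid) {B : ℕ}
    (hB : 1 ≤ B) :
    ∃ z : Offer V, z.tree = t ∧ (conquer dim (.single t)).val.Represents (dim 1) z ∧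
      z.Optimal B 1 ∧ (conquer dim (.single t)).time ≤ 2 * dim 1 + 6 := by
  refine ⟨⟨t, monomial 0 t.size, monomial 0 (t.size - t.depth) + monomial 1 t.depth, 0,
    {t.nearest}⟩, rfl, ?_, ⟨Share.optimal_zero hv hB, Share.optimal_one hv hB⟩, ?_⟩
  · have h0 := rep_replicate (dim 1)
    obtain ⟨h1, h2⟩ := rep_addAt h0 (i := 0) (by simp; omega) t.size
    obtain ⟨h3, h4⟩ := rep_addAt h0 (i := 0) (by simp; omega) (t.size - t.depth)
    obtain ⟨h5, h6⟩ := rep_addAt h3 (i := 1) (by rw [h4]; simp; omega) t.depth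
    have hpos := hv.weight_pos
    have hsize := hv.size_eq
    simp only [zero_add, Array.size_replicate] at h1 h2 h3 h4 h5 h6
    refine ⟨?_, ?_, ?_, ?_, rfl, rfl, fun out => ?_, fun out => ?_⟩
    · simpa [conquer] using h2
    · simpa [conquer] using h6.trans h4
    · simpa [conquer] using h1
    · simpa [conquer] using h5
    · simp [conquer, writePlan]; omega
    · simp [conquer, writePlan]; omega
  · simp [conquer]; omega

/-- The two solutions differ only in the pivot child `z`: it counts with `lo` for `r - 1` and with
`hi` for `r`. Its price is the multiplier in both applications of `Split.optimal_combinedShare`. The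
pairs in `ps` attach to each computed solution the offer it represents, so that the statement is
independent of the recursion. -/
theorem conquer_node {dim : ℕ → ℕ} {B r q high : ℕ} {t : InfoTree V} {F : List (InfoTree V)}
    {us : List (DividedTree V)} (ps : List (Solution V × Offer V)) (hv : t.Valid)
    (hB : 2 * t.size < B) (hs : Split t r F (ps.map fun z => z.2.tree) q high)
    (hsol : (conquerList dim us).val = ps.map Prod.fst)
    (hrep : ∀ z ∈ ps, z.1.Represents (dim q) z.2) (hopt : ∀ z ∈ ps, z.2.Optimal B q)
    (hq : dim q ≤ dim r) (hr : r < dim r) :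
    ∃ z : Offer V, z.tree = t ∧
      (conquer dim (.node r t.weight F us high)).val.Represents (dim r) z ∧ z.Optimal B r ∧
      (conquer dim (.node r t.weight F us high)).time ≤ (conquerList dim us).time +
        10000 * ((dim q + 1) * ps.length) + 8 * dim r + 4 * (F.map InfoTree.size).sum + 20 := by
  have hcv : ∀ z ∈ ps, z.2.tree ∈ t.children := fun z hz =>
    hs.mem_children _ (List.mem_map_of_mem (f := fun z : Solution V × Offer V => z.2.tree) hz)
  have hlen : high ≤ ps.length := by simpa using hs.high_le
  have hsmall : ∀ x ∈ ps.map Prod.fst, x.Small B (dim q) := by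
    intro x hx
    obtain ⟨z, hz, rfl⟩ := List.mem_map.1 hx
    have := hv.size_le_of_mem (hcv z hz)
    exact (hrep z hz).small (hv.children _ (hcv z hz)) (by omega) (hopt z hz)
  obtain ⟨⟨as₀, z₀, bs₀, hval, hperm, hlas, hle, hge⟩, hbt⟩ :=
    bringForward_spec hsmall hs.high_pos (by simpa using hlen)
  obtain ⟨ps', hps, hps'⟩ := exists_perm_map_eq hperm.symm
  obtain ⟨as, cs, rfl, rfl, hcs⟩ := List.map_eq_append_iff.1 hps'
  obtain ⟨z, bs, rfl, rfl, rfl⟩ := List.map_eq_cons_iff.1 hcs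
  have hrep' : ∀ y ∈ as ++ z :: bs, y.1.Represents (dim q) y.2 := fun y hy =>
    hrep y (hps.symm.subset hy)
  have hopt' : ∀ y ∈ as ++ z :: bs, y.2.Optimal B q := fun y hy => hopt y (hps.symm.subset hy)
  have hgain : ∀ y ∈ as ++ z :: bs, y.1.gain B = y.2.gain B := fun y hy =>
    (hrep' y hy).gain_eq B
  rw [List.length_map] at hlas
  have hzg := hgain z (by simp)
  have hle' : ∀ y ∈ as, y.2.gain B ≤ z.2.gain B := fun y hy => by
    rw [← hzg, ← hgain y (by simp [hy])]; exact hle _ (List.mem_map_of_mem hy)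
  have hge' : ∀ y ∈ bs, z.2.gain B ≤ y.2.gain B := fun y hy => by
    rw [← hzg, ← hgain y (by simp [hy])]; exact hge _ (List.mem_map_of_mem hy)
  have hU : ((as ++ z :: bs).map fun z => z.2.tree).Perm (ps.map fun z => z.2.tree) :=
    hps.symm.map _
  have htot := hs.total
  have hrpos : 1 ≤ r := by have := hs.high_pos; omega
  -- the shares with the smaller and the larger number of leaves
  have hlo := hs.optimal_combinedShare hv hB (as.map Prod.snd) ((z :: bs).map Prod.snd)
    (by simpa [Function.comp_def] using hU)
    (by
      rw [← List.map_append]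
      intro y hy
      obtain ⟨x, hx, rfl⟩ := List.mem_map.1 hy
      exact hopt' x hx)
    (Or.inr (by simpa using hlas)) (z.2.gain B) (by simpa using fun b a hb => hle' (a, b) hb)
    (by simpa using fun b a hb => hge' (a, b) hb) (r' := r - 1) (by rw [List.length_map]; omega)
  have hhi := hs.optimal_combinedShare hv hB ((as ++ [z]).map Prod.snd) (bs.map Prod.snd)
    (by simpa [Function.comp_def] using hU)
    (by
      rw [← List.map_append]
      intro y hy
      obtain ⟨x, hx, rfl⟩ := List.mem_map.1 hy
      exact hopt' x (by simpa using hx))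
    (Or.inl (by simpa using hlas)) (z.2.gain B)
    (by
      intro y hy
      obtain ⟨x, hx, rfl⟩ := List.mem_map.1 hy
      rcases List.mem_append.1 hx with hx | hx
      · exact hle' x hx
      · rw [List.mem_singleton.1 hx])
    (by simpa using fun b a hb => hge' (a, b) hb) (r' := r)
    (by simp only [List.length_map, List.length_append, List.length_singleton]; omega)
  have hFv := hs.filled_valid hv
  have hFr := hs.filled_lt
  have hFlen := length_le_sum_size hFv
  -- the arrays
  have h0 := rep_replicate (dim r)
  have hs0 : (Array.replicate (dim r) 0).size = dim r := Array.size_replicate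
  obtain ⟨hf, hfs, hft⟩ := addFilledList_spec hFv h0 (fun c hc => by
    have := hFr c hc; rw [hs0]; omega)
  obtain ⟨hpl, hpt, hpt'⟩ := planFilled_spec hFv Plan.empty
    (fun out => (writePlan_time_empty out).le)
  obtain ⟨hfl, hfls, hflt⟩ := addVector_spec hf h0 hfs.le
  obtain ⟨hlo₁, hlo₁s⟩ := rep_addAt hfl (i := r - 1) (by omega) t.weight
  obtain ⟨hhi₁, hhi₁s⟩ := rep_addAt hfl (i := r) (by omega) t.weight
  obtain ⟨c1, c2, c3, c4, c5⟩ := combine_spec as (z :: bs) hrep' hlo₁ (by omega) hpt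
  obtain ⟨d1, d2, d3, d4, d5⟩ := combine_spec (as ++ [z]) bs
    (by simpa using hrep') hhi₁ (by omega) hpt
  have hsizes := hs.size_eq hv
  have hsum := (hU.map InfoTree.size).sum_eq
  rw [← (hU.map InfoTree.size).sum_eq, List.map_map] at hsizes
  simp only [Function.comp_def] at hsizes
  have hpos := hv.weight_pos
  have hlen' := hps.length_eq
  rw [hs0] at hfs hfls
  rw [hfs] at hflt
  rw [hfls] at hlo₁s hhi₁s
  rw [hlo₁s] at c2
  rw [hhi₁s] at d2
  have hcomb : as ++ [z] ++ bs = as ++ z :: bs := by simp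
  have hhigh : (as ++ [z]).length = high := by simpa using hlas
  rw [hcomb, hhigh] at d1 d2 d3 d4 d5
  have hlas' : as.length = high - 1 := by omega
  rw [hlas'] at c1 c2 c3 c4 c5
  refine ⟨⟨t, _, _, _, _⟩, rfl, ?_, ⟨hlo, hhi⟩, ?_⟩
  · simp only [conquer, Timed.val_bind, op_val, hsol, hval, zeros_val]
    rw [← List.map_cons, ← List.map_append]
    refine ⟨c2, d2, ?_, ?_, ?_, ?_, fun out => ?_, fun out => ?_⟩
    · convert c1 using 1
      simp only [List.map_map, Function.comp_def, List.map_cons, List.sum_cons]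
      abel
    · convert d1 using 1
      simp only [List.map_map, Function.comp_def]
      abel
    · rw [c3, hpl]
      simp only [List.map_map, Function.comp_def, List.map_cons, List.sum_cons,
        Plan.leaves]
      abel
    · rw [d3, hpl]
      simp only [List.map_map, Function.comp_def,
        Plan.leaves]
      abel
    · have := c4 out
      dsimp only
      omega
    · have := d4 out
      dsimp only
      omega
  · simp only [conquer, Timed.time_bind, op_time, hsol, hval, zeros_val,
      zeros_time, addAt_time]
    rw [← List.map_cons, ← List.map_append]
    clear * - c5 d5 hbt hft hflt hpt' hFlen hlen' hlas
    simp only [List.length_append, List.length_cons, List.length_map] at *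
    rw [show high - 1 + (bs.length + 1) = ps.length by omega] at c5
    rw [show high + bs.length = ps.length by omega] at d5
    have hk : 1 ≤ ps.length := by omega
    have e1 : 1010 * (4 * dim q + 2) * ps.length =
      4040 * (dim q * ps.length) + 2020 * ps.length := by ring
    simp only [add_mul, one_mul] at c5 d5 ⊢
    omega

end ReplicaPlacement

namespace ReplicaPlacement

open Polynomial

variable {V : Type}

/-! ## The recursion of the conquer phase -/

theorem conquerList_val (dim : ℕ → ℕ) (ds : List (DividedTree V)) :
    (conquerList dim ds).val = ds.map fun d => (conquer dim d).val := by
  induction ds with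
  | nil => simp [conquerList]
  | cons d ds ih => simp [conquerList, ih]

theorem conquerList_time (dim : ℕ → ℕ) (ds : List (DividedTree V)) :
    (conquerList dim ds).time = (ds.map fun d => (conquer dim d).time).sum + ds.length + 1 := by
  induction ds with
  | nil => simp [conquerList]
  | cons d ds ih => simp [conquerList, ih]; omega

/-- The conquer phase finds for `d` shares of `t` with `r - 1` and `r` leaves of least cost. -/
def Conquers (dim : ℕ → ℕ) (B r : ℕ) (d : DividedTree V) (t : InfoTree V) : Prop :=
  ∃ z : Offer V, z.tree = t ∧ (conquer dim d).val.Represents (dim r) z ∧ z.Optimal B r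

theorem Conquers.exists_list {dim : ℕ → ℕ} {B q : ℕ} {zs : List (DividedTree V × InfoTree V)}
    (h : ∀ z ∈ zs, Conquers dim B q z.1 z.2) :
    ∃ ps : List (Solution V × Offer V), (ps.map fun z => z.2.tree) = zs.map Prod.snd ∧
      ps.map Prod.fst = zs.map (fun z => (conquer dim z.1).val) ∧
      (∀ z ∈ ps, z.1.Represents (dim q) z.2) ∧ ∀ z ∈ ps, z.2.Optimal B q := by
  induction zs with
  | nil => exact ⟨[], by simp⟩
  | cons z zs ih =>
    obtain ⟨ps, h1, h2, h3, h4⟩ := ih fun y hy => h y (by simp [hy])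
    obtain ⟨o, h5, h6, h7⟩ := h z (by simp)
    exact ⟨((conquer dim z.1).val, o) :: ps, by simp [h1, h5], by simp [h2], by simpa using ⟨h6, by simpa using h3⟩,
      by simpa using ⟨h7, by simpa using h4⟩⟩

theorem Conquers.node {dim : ℕ → ℕ} {B r q high : ℕ} {t : InfoTree V} {F : List (InfoTree V)}
    {zs : List (DividedTree V × InfoTree V)} (hv : t.Valid) (hB : 2 * t.size < B)
    (hs : Split t r F (zs.map Prod.snd) q high) (h : ∀ z ∈ zs, Conquers dim B q z.1 z.2)
    (hq : dim q ≤ dim r) (hr : r < dim r) :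
    Conquers dim B r (.node r t.weight F (zs.map Prod.fst) high) t ∧
      (conquer dim (.node r t.weight F (zs.map Prod.fst) high)).time ≤
        (zs.map fun z => (conquer dim z.1).time).sum + 10001 * ((dim q + 1) * zs.length) +
          8 * dim r + 4 * (F.map InfoTree.size).sum + 21 := by
  obtain ⟨ps, h1, h2, h3, h4⟩ := Conquers.exists_list h
  have hlen : ps.length = zs.length := by simpa using congrArg List.length h1
  obtain ⟨z, hz, hz1, hz2, hz3⟩ := conquer_node (us := zs.map Prod.fst) ps hv hB (h1 ▸ hs)
    (by rw [conquerList_val, h2, List.map_map]; rfl) h3 h4 hq hr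
  refine ⟨⟨z, hz, hz1, hz2⟩, hz3.trans ?_⟩
  rw [conquerList_time, List.map_map, List.length_map, hlen]
  simp only [Function.comp_def, add_mul, one_mul]
  omega

theorem Split.length_mul_le {t : InfoTree V} {r q high : ℕ} {F U : List (InfoTree V)}
    (h : Split t r F U q high) :
    U.length * (q - 1) + (F.map InfoTree.leaves).sum ≤ r - 1 := by
  have := h.total
  have := h.high_pos
  omega

theorem sum_time_le {ι : Type} (l : List ι) (f g : ι → ℕ) (a b c : ℕ)
    (h : ∀ x ∈ l, f x + a ≤ b * g x + c) :
    (l.map f).sum + l.length * a ≤ b * (l.map g).sum + l.length * c := by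
  induction l with
  | nil => simp
  | cons x l ih =>
    have := ih fun y hy => h y (by simp [hy])
    have := h x (by simp)
    simp only [List.map_cons, List.sum_cons, List.length_cons, mul_add, add_mul, one_mul]
    omega

theorem InfoTree.Valid.size_pos {t : InfoTree V} (h : t.Valid) : 1 ≤ t.size := by
  have := h.size_eq
  have := h.weight_pos
  omega

/-- The basic version. -/
theorem IsDivision.conquers_basic {ρ B : ℕ} (hρ : 1 ≤ ρ) {d : DividedTree V} {t : InfoTree V}
    {r : ℕ} (h : IsDivision false d t r) (hB : 2 * t.size < B) (hr : r ≤ ρ) :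
    Conquers (fun _ => ρ + 1) B r d t ∧
      (conquer (fun _ => ρ + 1) d).time + 10002 * (ρ + 2) ≤ 20000 * (ρ + 2) * t.size := by
  induction h with
  | single t hv h =>
    obtain ⟨z, h1, h2, h3, h4⟩ := conquer_single (dim := fun _ => ρ + 1) (by simpa using hρ) hv
      (B := B) (by omega)
    refine ⟨⟨z, h1, h2, h3⟩, ?_⟩
    rw [mul_assoc]
    have := Nat.mul_le_mul_left (ρ + 2) hv.size_pos
    generalize (ρ + 2) * t.size = Y at *
    omega
  | node t r F zs q high hv hr' hs h ih =>
    have hsz := hs.size_eq hv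
    have hw := hv.weight_pos
    have ih' : ∀ z ∈ zs, _ := fun z hz => ih z hz
      (by have := hv.size_le_of_mem (hs.mem_children z.2 (List.mem_map_of_mem hz)); omega)
      (hs.le.trans hr)
    obtain ⟨h1, h2⟩ := Conquers.node hv hB hs (fun z hz => (ih' z hz).1) le_rfl (by omega)
    refine ⟨h1, ?_⟩
    -- The slack `10002 (ρ + 2)` of each subproblem covers its `10001 (ρ + 2)` in the selection and
    -- summation at this node. The weight of the node pays for its own vectors and its own slack.
    have h3 := sum_time_le zs _ (fun z => z.2.size) _ _ 0 fun z hz => (ih' z hz).2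
    rw [List.map_map] at hsz
    simp only [Function.comp_def] at hsz
    rw [hsz]
    generalize hX : ρ + 2 = X at *
    have h4 := Nat.mul_le_mul_left (20000 * X) hw
    have h5 := Nat.mul_le_mul_right (F.map InfoTree.size).sum (by omega : 4 ≤ 20000 * X)
    have h6 : zs.length * (10002 * X) = 10002 * (X * zs.length) := by ring
    have h7 := Nat.mul_le_mul_right zs.length (by omega : 1 ≤ X)
    simp only [mul_add, mul_zero] at h3 ⊢
    omega

/-- The compact version. -/
theorem IsDivision.conquers_compact {B : ℕ} {d : DividedTree V} {t : InfoTree V} {r : ℕ}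
    (h : IsDivision true d t r) (ht : t.Branching) (hB : 2 * t.size < B) :
    Conquers (fun r => r + 1) B r d t ∧
      (conquer (fun r => r + 1) d).time + 40000 ≤ 80100 * t.size + 10100 * (r - 1) ^ 2 := by
  induction h with
  | single t hv h =>
    obtain ⟨z, h1, h2, h3, h4⟩ := conquer_single (dim := fun r => r + 1) le_rfl hv
      (B := B) (by omega)
    refine ⟨⟨z, h1, h2, h3⟩, ?_⟩
    have := hv.size_pos
    omega
  | node t r F zs q high hv hr' hs h ih =>
    have hsz := hs.size_eq hv
    have hw := hv.weight_pos
    have hr2 := hr' rfl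
    obtain ⟨_, hne, hbr⟩ := ht
    have hmem : ∀ z ∈ zs, z.2 ∈ t.children := fun z hz => hs.mem_children z.2 (List.mem_map_of_mem hz)
    have ih' : ∀ z ∈ zs, _ := fun z hz => ih z hz (hbr _ (hmem z hz))
      (by have := hv.size_le_of_mem (hmem z hz); omega)
    obtain ⟨h1, h2⟩ := Conquers.node hv hB hs (fun z hz => (ih' z hz).1)
      (by have := hs.le; omega) (by omega)
    refine ⟨h1, ?_⟩
    have h3 := sum_time_le zs _ (fun z => z.2.size) _ _ _ fun z hz => (ih' z hz).2
    rw [List.map_map] at hsz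
    simp only [Function.comp_def] at hsz
    have hm := hs.length_mul_le
    have hqp := hs.q_pos
    have hk := hs.high_le
    have hk' := hs.high_pos
    have hFl := hs.perm.length_eq
    simp only [List.length_append, List.length_map] at hm hk hFl
    obtain ⟨p, rfl⟩ : ∃ p, r = p + 1 := ⟨r - 1, by omega⟩
    obtain ⟨s, rfl⟩ : ∃ s, q = s + 1 := ⟨q - 1, by omega⟩
    simp only [Nat.add_sub_cancel] at *
    -- The request falls strictly from parent to child. A single unfilled child has a filled
    -- sibling, by `Branching`, which takes at least one leaf; with two or more unfilled children,
    -- `2 s ≤ p` and `p ≥ 1`.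
    have hsp : s + 1 ≤ p := by
      rcases (by omega : zs.length = 1 ∨ 2 ≤ zs.length) with h | h
      · obtain ⟨c, F', rfl⟩ : ∃ c F', F = c :: F' := List.exists_cons_of_length_pos (by omega)
        have := (hs.filled_valid hv c (by simp)).leaves_pos
        simp only [h, one_mul, List.map_cons, List.sum_cons] at hm
        omega
      · have := Nat.mul_le_mul_right s h
        omega
    -- The potentials of the children sum to at most `p s ≤ p² - p` times 10100, because `k s ≤ p`.
    -- The drop of `10100 p` pays for the vectors handled at this node.
    have h4 : zs.length * (10100 * s ^ 2) ≤ 10100 * (p * s) := by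
      rw [show zs.length * (10100 * s ^ 2) = 10100 * ((zs.length * s) * s) by ring]
      exact Nat.mul_le_mul_left _ (Nat.mul_le_mul_right _ (by omega))
    have h5 : p * s + p ≤ p ^ 2 := by
      rw [sq, ← Nat.mul_succ]; exact Nat.mul_le_mul_left _ hsp
    have h6 : (s + 1 + 1 + 1) * zs.length = zs.length * s + 3 * zs.length := by ring
    rw [h6] at h2
    omega

end ReplicaPlacement

namespace ReplicaPlacement

open Polynomial

variable {V : Type}

/-! ## Degenerate chains -/

/-- Shares of least cost for `t'` with `r' - 1` and `r'` leaves become shares of least cost for `t`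
with `r - 1` and `r` leaves when `lo` and `hi` are added to the vectors and `P` to the leaves. -/
def Extends (B r : ℕ) (t : InfoTree V) (r' : ℕ) (t' : InfoTree V) (lo hi : ℕ[X])
    (P : Multiset V) : Prop :=
  ∀ z : Offer V, z.tree = t' → z.Optimal B r' →
    Offer.Optimal B r ⟨t, lo + z.lo, hi + z.hi, P + z.loLeaves, P + z.hiLeaves⟩

theorem Extends.refl (B r : ℕ) (t : InfoTree V) : Extends B r t r t 0 0 0 := by
  rintro ⟨t, lo, hi, P, Q⟩ rfl h
  simpa using h

/-- With a single unfilled child `high` is 1: the child's smaller share is used for `r - 1` and its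
larger one for `r`, and no choice depends on prices. The contribution of the chain can therefore be
fixed before the conquer phase. -/
theorem Extends.step {B r q high r' : ℕ} {t c t' : InfoTree V} {F : List (InfoTree V)}
    {lo hi : ℕ[X]} {P : Multiset V} (hv : t.Valid) (hB : 2 * t.size < B)
    (hs : Split t r F [c] q high) (h : Extends B q c r' t' lo hi P) :
    Extends B r t r' t' (monomial (r - 1) t.weight + (F.map InfoTree.full).sum + lo)
      (monomial r t.weight + (F.map InfoTree.full).sum + hi)
      ((F.map InfoTree.leafMultiset).sum + P) := by
  intro z hz hopt
  have hc := h z hz hopt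
  generalize ho : (⟨c, lo + z.lo, hi + z.hi, P + z.loLeaves, P + z.hiLeaves⟩ : Offer V) = o at hc
  have htot := hs.total
  have hpos := hs.high_pos
  have hle := hs.high_le
  simp only [List.length_singleton] at hle
  have h1 := hs.optimal_combinedShare hv hB [] [o] (by simp [← ho]) (by simpa using hc)
    (Or.inr (by simp; omega)) (o.gain B) (by simp) (by simp) (r' := r - 1)
    (by simp only [List.length_nil]; omega)
  have h2 := hs.optimal_combinedShare hv hB [o] [] (by simp [← ho]) (by simpa using hc)
    (Or.inl (by simp; omega)) (o.gain B) (by simp) (by simp) (r' := r)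
    (by simp only [List.length_singleton]; omega)
  subst ho
  constructor
  · simpa [combinedShare, Offer.loShare, add_assoc] using h1
  · simpa [combinedShare, Offer.hiShare, add_assoc] using h2

/-- The part of the chain at and below `t`, which is asked for `r` or `r - 1` leaves, contributes
`x.1`, in arrays of length `L + 1`, to what is found for `x.2`; the leaves contributed and those
found below are written in time `s`. -/
def ContractsTo (B L r s : ℕ) (t : InfoTree V) (x : Contribution V × DividedTree V) : Prop :=
  ∃ r' t' lo hi f, r' ≤ r ∧ Conquers (fun r => r + 1) B r' x.2 t' ∧
    Extends B r t r' t' (lo + f) (hi + f) x.1.plan.leaves ∧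
    x.1.lo.size = L + 1 ∧ x.1.hi.size = L + 1 ∧ x.1.filled.size = L + 1 ∧
    Rep x.1.lo lo ∧ Rep x.1.hi hi ∧ Rep x.1.filled f ∧
    ∃ n, (∀ out, (writePlan x.1.plan out).time ≤ n) ∧ n + 2 * t'.size ≤ s

theorem emptyContribution_time_some (L : ℕ) :
    (emptyContribution (V := V) (some L)).time = 3 * (L + 2) + 1 := by
  simp [emptyContribution]; omega

theorem ContractsTo.empty {B L r : ℕ} {t : InfoTree V} {d : DividedTree V}
    (h : Conquers (fun r => r + 1) B r d t) :
    ContractsTo B L r (2 * t.size + 1) t ((emptyContribution (some L)).val, d) := by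
  refine ⟨r, t, 0, 0, 0, le_rfl, h, ?_, ?_, ?_, ?_, ?_, ?_, ?_, 1, ?_, by omega⟩
  · simpa [emptyContribution, Plan.leaves] using Extends.refl B r t
  · simp [emptyContribution]
  · simp [emptyContribution]
  · simp [emptyContribution]
  · simpa [emptyContribution] using rep_replicate (L + 1)
  · simpa [emptyContribution] using rep_replicate (L + 1)
  · simpa [emptyContribution] using rep_replicate (L + 1)
  · simp [emptyContribution, writePlan]

/-- The contribution of a chain, increased by that of a node of weight `w` with filled children
`F` that is asked for `r` or `r - 1` leaves. -/
def extendContribution (r w : ℕ) (F : List (InfoTree V)) (a : Contribution V) : Contribution V :=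
  ⟨(addAt a.lo (r - 1) w).val, (addAt a.hi r w).val, (addFilledList F a.filled).val,
    (planFilled F a.plan).val⟩

theorem ContractsTo.step {B L r q high s : ℕ} {t c : InfoTree V} {F : List (InfoTree V)}
    {x : Contribution V × DividedTree V} (hv : t.Valid) (hB : 2 * t.size < B)
    (hs : Split t r F [c] q high) (hr : r ≤ L) (h : ContractsTo B L q s c x) :
    ContractsTo B L r (s + 2 * (F.map InfoTree.size).sum) t
        (extendContribution r t.weight F x.1, x.2) ∧
      (addFilledList F x.1.filled).time + (planFilled F x.1.plan).time ≤
        3 * (F.map InfoTree.size).sum + 2 := by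
  obtain ⟨r', t', lo, hi, f, h1, h2, h3, h4, h5, h6, h7, h8, h9, n, h10, h11⟩ := h
  have hFv := hs.filled_valid hv
  have hFr := hs.filled_lt
  obtain ⟨a1, a2, a3⟩ := addFilledList_spec hFv h9 fun c hc => by have := hFr c hc; omega
  obtain ⟨b1, b2, b3⟩ := planFilled_spec hFv _ h10
  obtain ⟨c1, c2⟩ := rep_addAt h7 (i := r - 1) (by omega) t.weight
  obtain ⟨d1, d2⟩ := rep_addAt h8 (i := r) (by omega) t.weight
  have := length_le_sum_size hFv
  refine ⟨⟨r', t', _, _, _, h1.trans hs.le, h2, ?_, c2.trans h4, d2.trans h5, a2.trans h6, c1, d1,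
    a1, _, b2, by omega⟩, by omega⟩
  have := h3.step hv hB hs
  dsimp only [extendContribution]
  rw [b1]
  convert this using 1 <;> abel

/-- The vectors found below the chain are no longer than those allocated for its top, so they are
added in place. The cost is a bounded number of passes over arrays of length `r + 1`, however long
the chain is. -/
theorem ContractsTo.conquers_pseudonode {B r s : ℕ} {t : InfoTree V}
    {x : Contribution V × DividedTree V} (h : ContractsTo B r r s t x) (hs : s + 1 ≤ 2 * t.size) :
    Conquers (fun r => r + 1) B r (makePseudonode x.1 x.2).val t ∧
      (makePseudonode x.1 x.2).time +
        (conquer (fun r => r + 1) (makePseudonode x.1 x.2).val).time ≤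
          (conquer (fun r => r + 1) x.2).time + 4 * (r + 2) + 2 := by
  obtain ⟨r', t', lo, hi, f, h1, ⟨z, rfl, hz, hopt⟩, h3, h4, h5, h6, h7, h8, h9, n, h10, h11⟩ := h
  obtain ⟨a1, a2, a3⟩ := addVector_spec h9 h7 (by omega)
  obtain ⟨b1, b2, b3⟩ := addVector_spec h9 h8 (by omega)
  have e1 : (conquer (fun r => r + 1) x.2).val.lo.size = r' + 1 := hz.lo_size
  have e2 : (conquer (fun r => r + 1) x.2).val.hi.size = r' + 1 := hz.hi_size
  obtain ⟨c1, c2, c3⟩ := addVector_spec hz.lo a1 (by omega)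
  obtain ⟨d1, d2, d3⟩ := addVector_spec hz.hi b1 (by omega)
  have hpos : 1 ≤ z.tree.size := by have := hz.loTime []; omega
  constructor
  · refine ⟨_, rfl, ⟨?_, ?_, ?_, ?_, ?_, ?_, ?_, ?_⟩, h3 z rfl hopt⟩
    · simp [makePseudonode, conquer]; omega
    · simp [makePseudonode, conquer]; omega
    · simpa [makePseudonode, conquer] using c1
    · simpa [makePseudonode, conquer] using d1
    · simp [makePseudonode, conquer, Plan.leaves, hz.loPlan]
    · simp [makePseudonode, conquer, Plan.leaves, hz.hiPlan]
    · intro out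
      have := writePlan_time_join h10 (n := 2 * z.tree.size - 1) (q := _)
        (fun out => Nat.le_sub_of_add_le (hz.loTime out)) out
      simp only [makePseudonode, conquer, Timed.val_bind, op_val]
      omega
    · intro out
      have := writePlan_time_join h10 (n := 2 * z.tree.size - 1) (q := _)
        (fun out => Nat.le_sub_of_add_le (hz.hiTime out)) out
      simp only [makePseudonode, conquer, Timed.val_bind, op_val]
      omega
  · simp only [makePseudonode, conquer, Timed.val_bind, Timed.time_bind, op_val, op_time]
    omega

theorem transformList_val (ds : List (DividedTree V)) :
    (transformList ds).val = ds.map fun d => (transform d none).val.2 := by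
  induction ds with
  | nil => simp [transformList]
  | cons d ds ih => simp [transformList, ih]

theorem transformList_time (ds : List (DividedTree V)) :
    (transformList ds).time = (ds.map fun d => (transform d none).time).sum + ds.length + 1 := by
  induction ds with
  | nil => simp [transformList]
  | cons d ds ih => simp [transformList, ih]; omega

/-- A node at which a chain ends. -/
theorem transform_of_length_ne_one (r w : ℕ) (F : List (InfoTree V)) {us : List (DividedTree V)}
    (high : ℕ) (h : us.length ≠ 1) (chain : Option ℕ) :
    transform (.node r w F us high) chain = (do
      let vs ← transformList us
      let a ← emptyContribution chain
      op (a, .node r w F vs high)) := by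
  match us with
  | [] => rfl
  | [_] => simp at h
  | _ :: _ :: _ => rfl

theorem transform_some (r w : ℕ) (F : List (InfoTree V)) (v : DividedTree V) (high L : ℕ) :
    (transform (.node r w F [v] high) (some L)).val =
        (extendContribution r w F (transform v (some L)).val.1, (transform v (some L)).val.2) ∧
      (transform (.node r w F [v] high) (some L)).time = (transform v (some L)).time +
        (addFilledList F (transform v (some L)).val.1.filled).time +
          (planFilled F (transform v (some L)).val.1.plan).time + 5 := by
  simp only [transform, Timed.val_bind, Timed.time_bind, op_val, op_time, Option.getD_some,
    extendContribution, addAt_time]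
  exact ⟨trivial, by omega⟩

/-- Reduces the top of a chain to the case inside a chain with `L = r`, followed by the construction
of the pseudonode. -/
theorem transform_none (r w : ℕ) (F : List (InfoTree V)) (v : DividedTree V) (high : ℕ) :
    (transform (.node r w F [v] high) none).val.2 =
        (makePseudonode (transform (.node r w F [v] high) (some r)).val.1
          (transform (.node r w F [v] high) (some r)).val.2).val ∧
      (transform (.node r w F [v] high) none).time =
        (transform (.node r w F [v] high) (some r)).time +
          (makePseudonode (transform (.node r w F [v] high) (some r)).val.1
            (transform (.node r w F [v] high) (some r)).val.2).time + 1 := by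
  simp only [transform, Timed.val_bind, Timed.time_bind, op_val, op_time, Option.getD_some,
    Option.getD_none, addAt_time, emptyContribution]
  exact ⟨trivial, by omega⟩

end ReplicaPlacement

-- Running time of the chain version

namespace ReplicaPlacement

variable {V : Type}

/-- The assertion on `d` proved by induction for the chain version: outside a chain, and below the
top of a chain that is asked for `L` or `L - 1` leaves. -/
def ChainSpec (B : ℕ) (d : DividedTree V) (t : InfoTree V) (r : ℕ) : Prop :=
  -- The two bounds differ in the linear term. Inside a chain it is smaller, and the three arrays of
  -- length `L + 1` are listed separately as `3 (L + 2)`. At the top of a chain, where `L = r ≥ 2`,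
  -- the difference `20000 (r - 1)` pays for these arrays and for the pseudonode.
  (Conquers (fun r => r + 1) B r (transform d none).val.2 t ∧
    (transform d none).time + (conquer (fun r => r + 1) (transform d none).val.2).time + 40000 ≤
      80000 * t.size + 40000 * (r - 1) + 40000 * ((r - 1) * Nat.log 2 (r - 1))) ∧
  ∀ L, r ≤ L → ContractsTo B L r (2 * t.size + 1) t (transform d (some L)).val ∧
    (transform d (some L)).time +
      (conquer (fun r => r + 1) (transform d (some L)).val.2).time + 40000 ≤
      80000 * t.size + 20000 * (r - 1) + 40000 * ((r - 1) * Nat.log 2 (r - 1)) + 3 * (L + 2)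

theorem ContractsTo.mono {B L r s s' : ℕ} {t : InfoTree V} {x : Contribution V × DividedTree V}
    (h : ContractsTo B L r s t x) (hs : s ≤ s') : ContractsTo B L r s' t x := by
  obtain ⟨r', t', lo, hi, f, h1, h2, h3, h4, h5, h6, h7, h8, h9, n, h10, h11⟩ := h
  exact ⟨r', t', lo, hi, f, h1, h2, h3, h4, h5, h6, h7, h8, h9, n, h10, h11.trans hs⟩

theorem ChainSpec.of_end {B r T : ℕ} {d d' : DividedTree V} {t : InfoTree V}
    (hval : ∀ chain, (transform d chain).val = ((emptyContribution chain).val, d'))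
    (htime : ∀ chain, (transform d chain).time = T + (emptyContribution (V := V) chain).time)
    (h : Conquers (fun r => r + 1) B r d' t)
    (hT : T + 1 + (conquer (fun r => r + 1) d').time + 40000 ≤
      80000 * t.size + 20000 * (r - 1) + 40000 * ((r - 1) * Nat.log 2 (r - 1))) :
    ChainSpec B d t r := by
  refine ⟨⟨?_, ?_⟩, fun L _ => ⟨?_, ?_⟩⟩
  · rwa [hval]
  · rw [hval, htime]
    simp only [emptyContribution, op_time]
    omega
  · rw [hval]; exact .empty h
  · rw [hval, htime, emptyContribution_time_some]
    dsimp only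
    omega

theorem mul_log_mono {p p' : ℕ} (h : p ≤ p') : p * Nat.log 2 p ≤ p' * Nat.log 2 p' :=
  Nat.mul_le_mul h (Nat.log_mono_right h)

/-- The chain version, with the length of its vectors bounded by potential `p log p`. -/
theorem IsDivision.chainSpec {B : ℕ} {d : DividedTree V} {t : InfoTree V} {r : ℕ}
    (h : IsDivision true d t r) (hB : 2 * t.size < B) : ChainSpec B d t r := by
  induction h with
  | single t hv h =>
    obtain ⟨z, h1, h2, h3, h4⟩ := conquer_single (dim := fun r => r + 1) le_rfl hv
      (B := B) (by omega)
    have := hv.size_pos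
    refine .of_end (T := 1) (d' := .single t) (fun chain => ?_) (fun chain => ?_) ⟨z, h1, h2, h3⟩
      (by omega)
    · simp [transform]
    · simp [transform, add_comm]
  | node t r F zs q high hv hr' hs h ih =>
    have hsz := hs.size_eq hv
    have hw := hv.weight_pos
    have hr2 := hr' rfl
    have hmem : ∀ z ∈ zs, z.2 ∈ t.children := fun z hz =>
      hs.mem_children z.2 (List.mem_map_of_mem hz)
    have ih' : ∀ z ∈ zs, _ := fun z hz => ih z hz
      (by have := hv.size_le_of_mem (hmem z hz); omega)
    have hm := hs.length_mul_le
    have hqp := hs.q_pos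
    have hk := hs.high_le
    have hk' := hs.high_pos
    have hqr := hs.le
    rw [List.map_map] at hsz
    simp only [Function.comp_def] at hsz
    simp only [List.length_map] at hm hk
    rcases (by omega : zs.length = 1 ∨ 2 ≤ zs.length) with hlen | hlen
    · obtain ⟨⟨v, c⟩, rfl⟩ := List.length_eq_one_iff.1 hlen
      clear hlen hk hm ih h hmem
      simp only [List.map_cons, List.map_nil, List.sum_singleton, List.mem_singleton,
        forall_eq] at *
      obtain ⟨-, ih⟩ := ih'
      -- Along a chain `q` may equal `r`, so the potential need not decrease; monotonicity suffices,
      -- because a chain node costs only a constant and the size of its filled subtrees.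
      have hlog := mul_log_mono (by omega : q - 1 ≤ r - 1)
      have key : ∀ L, r ≤ L →
          ContractsTo B L r (2 * c.size + 1 + 2 * (F.map InfoTree.size).sum) t
            (transform (.node r t.weight F [v] high) (some L)).val ∧
          (transform (.node r t.weight F [v] high) (some L)).time +
            (conquer (fun r => r + 1)
              (transform (.node r t.weight F [v] high) (some L)).val.2).time + 40000 ≤
            80000 * c.size + 20000 * (r - 1) + 40000 * ((r - 1) * Nat.log 2 (r - 1)) +
              3 * (L + 2) + 3 * (F.map InfoTree.size).sum + 7 := by
        intro L hL
        obtain ⟨h1, h2⟩ := ih L (hqr.trans hL)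
        obtain ⟨h3, h4⟩ := h1.step hv hB hs hL
        obtain ⟨e1, e2⟩ := transform_some r t.weight F v high L
        rw [e1, e2]
        exact ⟨h3, by dsimp only; omega⟩
      refine ⟨?_, fun L hL => ?_⟩
      · obtain ⟨h1, h2⟩ := key r le_rfl
        obtain ⟨h3, h4⟩ := h1.conquers_pseudonode (by omega)
        obtain ⟨e1, e2⟩ := transform_none r t.weight F v high
        rw [e1, e2]
        exact ⟨h3, by omega⟩
      · obtain ⟨h1, h2⟩ := key L hL
        exact ⟨h1.mono (by omega), by omega⟩
    · obtain ⟨h1, h2⟩ := Conquers.node (dim := fun r => r + 1)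
        (zs := zs.map fun z => ((transform z.1 none).val.2, z.2)) hv hB
        (by simpa [Function.comp_def] using hs) (by
          intro z hz
          obtain ⟨y, hy, rfl⟩ := List.mem_map.1 hz
          exact (ih' y hy).1.1) (by omega) (by omega)
      refine .of_end (T := (transformList (zs.map Prod.fst)).time + 1) (fun chain => ?_)
        (fun chain => ?_) h1 ?_
      · rw [transform_of_length_ne_one _ _ _ _ (by simp; omega)]
        simp [transformList_val, Function.comp_def]
      · rw [transform_of_length_ne_one _ _ _ _ (by simp; omega)]
        simp; omega
      · have h3 := sum_time_le zs _ (fun z => z.2.size) _ _ _ fun z hz =>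
          (ih' z hz).1.2.trans (Nat.add_assoc _ _ _).le
        rw [transformList_time]
        simp only [List.map_map, List.length_map, Function.comp_def, List.sum_map_add] at h2 h3 ⊢
        obtain ⟨p, rfl⟩ : ∃ p, r = p + 1 := ⟨r - 1, by omega⟩
        obtain ⟨s, rfl⟩ : ∃ s, q = s + 1 := ⟨q - 1, by omega⟩
        simp only [Nat.add_sub_cancel] at *
        have h4 : (s + 1 + 1 + 1) * zs.length = zs.length * s + 3 * zs.length := by ring
        -- With at least two unfilled children `2 s ≤ p`, hence `log s + 1 ≤ log p`; multiplied by
        -- `k s ≤ p` this gives the claim. The drop in the logarithmic term absorbs the linear terms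
        -- of all children, and the node's own linear term is left to pay for the combination.
        have h5 : zs.length * (s * Nat.log 2 s) + zs.length * s ≤ p * Nat.log 2 p := by
          rcases Nat.eq_zero_or_pos s with rfl | hs0
          · simp
          · have h2s : s * 2 ≤ p := by
              have := Nat.mul_le_mul_right s hlen
              omega
            have := Nat.log_mono_right (b := 2) h2s
            rw [Nat.log_mul_base one_lt_two hs0.ne'] at this
            calc _ = (zs.length * s) * (Nat.log 2 s + 1) := by ring
              _ ≤ _ := Nat.mul_le_mul (by omega) this
        have h6 : zs.length * (40000 * s + 40000 * (s * Nat.log 2 s)) =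
          40000 * (zs.length * s) + 40000 * (zs.length * (s * Nat.log 2 s)) := by ring
        rw [h4] at h2
        omega

end ReplicaPlacement

namespace ReplicaPlacement

open Polynomial

variable {V : Type}

/-! ## Optimality of the output -/

/-- Position `i` of the aggregate is the digit at `ρ - i`. If the lexicographic order were reversed
at a first position of difference, the digits above would agree and that digit would decide the
comparison of the sums the other way. -/
theorem toLex_le_of_digitSum_le {ρ B : ℕ} {f g : ℕ → ℕ} (hf : ∀ i, f i < B) (hg : ∀ i, g i < B)
    (h : ∑ i ∈ Finset.range (ρ + 1), f i * B ^ i ≤ ∑ i ∈ Finset.range (ρ + 1), g i * B ^ i) :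
    toLex (fun i : Fin (ρ + 1) => f (ρ - i)) ≤ toLex (fun i : Fin (ρ + 1) => g (ρ - i)) := by
  by_contra! hlt
  obtain ⟨i, hi, hlt⟩ := hlt
  have hlt : g (ρ - i) < f (ρ - i) := hlt
  have hle : ρ - i + 1 ≤ ρ + 1 := by omega
  rw [← Finset.sum_range_add_sum_Ico _ hle, ← Finset.sum_range_add_sum_Ico _ hle] at h
  have htop : ∑ j ∈ Finset.Ico (ρ - i + 1) (ρ + 1), f j * B ^ j =
      ∑ j ∈ Finset.Ico (ρ - i + 1) (ρ + 1), g j * B ^ j := by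
    refine Finset.sum_congr rfl fun j hj => ?_
    rw [Finset.mem_Ico] at hj
    have hj' : g (ρ - (ρ - j)) = f (ρ - (ρ - j)) :=
      hi ⟨ρ - j, by omega⟩ (Fin.lt_def.2 (by dsimp only; omega))
    rw [show ρ - (ρ - j) = j by omega] at hj'
    rw [hj']
  have hB : (1 : ℤ) ≤ B := by have := hf 0; omega
  have hlow := digitSum_lt_digitSum hB (f := fun j => (g j : ℤ)) (g := fun j => (f j : ℤ))
    (fun j => by have := hf j; have := hg j; rw [abs_le]; omega) (m := ρ - i) (by exact_mod_cast hlt)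
  have hlow' : ∑ j ∈ Finset.range (ρ - i + 1), g j * B ^ j <
      ∑ j ∈ Finset.range (ρ - i + 1), f j * B ^ j := by exact_mod_cast hlow
  omega

-- Failure counts in the graph and the two sets of events

section

variable {A : V → V → Prop}

theorem failureCount_le_card (A : V → V → Prop) (E P : Finset V) (i : ℕ) :
    failureCount A E P i ≤ E.card := by
  classical
  exact Finset.card_filter_le _ _

theorem failureCount_eq_zero (A : V → V → Prop) (E : Finset V) {P : Finset V} {i : ℕ}
    (h : P.card < i) : failureCount A E P i = 0 := by
  classical
  rw [failureCount, Finset.card_eq_zero, Finset.filter_eq_empty_iff]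
  intro e _ he
  have : failureNumber A e P ≤ P.card := Finset.card_filter_le _ _
  omega

variable [Fintype V]

open Classical in
theorem failureNumber_of_mem_leafSet {e : V} (he : e ∈ leafSet A) (P : Finset V) :
    failureNumber A e P = if e ∈ P then 1 else 0 := by
  have hreach : ∀ p, Relation.ReflTransGen A e p ↔ e = p := by
    refine fun p => ⟨fun h => ?_, fun h => h ▸ .refl⟩
    rcases h.cases_head with h | ⟨c, hc, -⟩
    · exact h
    · exact absurd hc ((Finset.mem_filter.1 he).2 c)
  rw [failureNumber]
  simp only [hreach]
  rw [Finset.filter_eq]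
  split_ifs <;> rfl

/-- The failure numbers of the leaves depend on the size of the placement only. -/
theorem failureCount_leafSet {P P' : Finset V} (hP : P ⊆ leafSet A) (hP' : P' ⊆ leafSet A)
    (h : P.card = P'.card) (i : ℕ) :
    failureCount A (leafSet A) P i = failureCount A (leafSet A) P' i := by
  classical
  have key : ∀ Q ⊆ leafSet A, failureCount A (leafSet A) Q i =
      if i = 1 then Q.card else if i = 0 then (leafSet A).card - Q.card else 0 := by
    intro Q hQ
    rw [failureCount, Finset.filter_congr fun e he => by rw [failureNumber_of_mem_leafSet he]]
    split_ifs with h1 h0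
    · subst h1
      congr 1
      ext e
      simpa using @hQ e
    · subst h0
      rw [← Finset.card_sdiff_of_subset hQ]
      congr 1
      ext e
      simp
    · rw [Finset.card_eq_zero, Finset.filter_eq_empty_iff]
      intro e _
      split_ifs <;> omega
  rw [key P hP, key P' hP', h]

open Classical in
theorem failureCount_univ (P : Finset V) (i : ℕ) : failureCount A Finset.univ P i =
    failureCount A (Finset.univ \ leafSet A) P i + failureCount A (leafSet A) P i := by
  rw [failureCount, failureCount, failureCount, ← Finset.card_union_of_disjoint, ← Finset.filter_union,
    Finset.sdiff_union_of_subset (Finset.subset_univ _)]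
  exact Finset.disjoint_filter_filter Finset.sdiff_disjoint

open Classical in
theorem RoseTree.Represents.eval_aggregate {t : RoseTree V} (h : t.Represents A) {P : Finset V}
    (hP : P ⊆ leafSet A) (B : ℕ) : (t.aggregate (· ∈ P)).eval B =
      ∑ i ∈ Finset.range (P.card + 1), failureCount A Finset.univ P i * B ^ i := by
  have hdeg : (t.aggregate (· ∈ P)).natDegree < P.card + 1 := by
    refine Nat.lt_succ_of_le (natDegree_le_iff_coeff_eq_zero.2 fun i hi => ?_)
    rw [← h.failureCount_eq hP, failureCount_eq_zero A _ hi]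
  rw [eval_eq_sum_range' hdeg]
  exact Finset.sum_congr rfl fun i _ => by rw [h.failureCount_eq hP]

/-- Leaves have the same failure counts under all placements of one size, so their part cancels from
the inequality of sums. What remains is the inequality for the other events. -/
theorem isLexicominimum_of_digitSum_le {ρ B : ℕ} (hB : Fintype.card V < B) {P : Finset V}
    (hP : IsPlacement (leafSet A) ρ P)
    (h : ∀ P', IsPlacement (leafSet A) ρ P' →
      ∑ i ∈ Finset.range (ρ + 1), failureCount A Finset.univ P i * B ^ i ≤
        ∑ i ∈ Finset.range (ρ + 1), failureCount A Finset.univ P' i * B ^ i) :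
    IsLexicominimum A Finset.univ (leafSet A) ρ P ∧
      ∀ E, (∀ Q i, failureCount A Finset.univ Q i =
        failureCount A E Q i + failureCount A (leafSet A) Q i) →
          IsLexicominimum A E (leafSet A) ρ P := by
  have hlt : ∀ (E Q : Finset V) i, failureCount A E Q i < B := fun E Q i =>
    ((failureCount_le_card A E Q i).trans (Finset.card_le_univ E)).trans_lt hB
  refine ⟨⟨hP, fun P' hP' => toLex_le_of_digitSum_le (hlt _ _) (hlt _ _) (h P' hP')⟩,
    fun E hE => ⟨hP, fun P' hP' => toLex_le_of_digitSum_le (hlt _ _) (hlt _ _) ?_⟩⟩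
  have := h P' hP'
  simp only [hE, add_mul, Finset.sum_add_distrib] at this
  simpa only [failureCount_leafSet hP.1 hP'.1 (hP.2.trans hP'.2.symm), add_le_add_iff_right]
    using this

/-- The leaves of the tree are distinct, so the written list has no repetition and its set of
members determines the share. Its vector is therefore the failure aggregate of that set, and least
cost among shares gives least digit sum among placements. -/
theorem isSolution_output {t : RoseTree V} (h : t.Represents A) {a : InfoTree V}
    (ha : Describes a t) {ρ B : ℕ} (hB : 2 * a.size < B) {x : Solution V} {z : Offer V}
    (hz : z.tree = a) (hx : x.Represents (ρ + 1) z) (ho : z.Optimal B ρ) :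
    IsSolution A ρ (output x).val ∧ (output x).time ≤ 2 * a.size := by
  classical
  have hcard : a.size = Fintype.card V := by rw [ha.size, h.card]
  have hmem : ∀ v, v ∈ t.leafList ↔ v ∈ leafSet A := fun v => by simp [h.leafSet_eq]
  have hnd : (a.leafMultiset).Nodup := by
    rw [ha.leaves]; exact Multiset.coe_nodup.2 (RoseTree.nodup_leafList h.1)
  obtain ⟨-, hpl, hnum, hmin⟩ := ho
  have hle : z.hiLeaves ≤ a.leafMultiset := hz ▸ hpl.leaves_le
  set P := (writePlan x.hiPlan []).val with hPdef
  have hP : (P : Multiset V) = z.hiLeaves := by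
    rw [hPdef, writePlan_val, hx.hiPlan]; simp
  have hPnd : P.Nodup := Multiset.coe_nodup.1 (hP ▸ Multiset.nodup_of_le hle hnd)
  have hPl : P.toFinset ⊆ leafSet A := by
    intro v hv
    rw [← hmem, ← Multiset.mem_coe, ← ha.leaves]
    exact Multiset.mem_of_le hle (hP ▸ Multiset.mem_coe.2 (List.mem_toFinset.1 hv))
  have hPc : P.toFinset.card = ρ := by
    rw [List.toFinset_card_of_nodup hPnd, ← hnum, Share.num, Offer.hiShare, ← hP,
      Multiset.coe_card]
  have hvec : z.hi = t.aggregate (· ∈ P.toFinset) := by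
    rw [← ha.aggregate, ← hz]
    refine hpl.vec_eq_aggregate _ ?_
    change z.tree.leafMultiset.filter _ = z.hiLeaves
    rw [hz, Multiset.Nodup.ext (hnd.filter _) (Multiset.nodup_of_le hle hnd)]
    intro v
    rw [Multiset.mem_filter, List.mem_toFinset, ← hP, Multiset.mem_coe, and_iff_right_iff_imp]
    exact fun hv => Multiset.mem_of_le hle (hP ▸ Multiset.mem_coe.2 hv)
  have hsum : ∀ P', IsPlacement (leafSet A) ρ P' →
      ∑ i ∈ Finset.range (ρ + 1), failureCount A Finset.univ P.toFinset i * B ^ i ≤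
        ∑ i ∈ Finset.range (ρ + 1), failureCount A Finset.univ P' i * B ^ i := by
    intro P' hP'
    have := hmin _ (Share.placed_aggregate (· ∈ P') a) hz.symm (by
      rw [Share.num]
      dsimp only
      rw [ha.leaves, Multiset.filter_coe, Multiset.coe_card,
        ← List.toFinset_card_of_nodup ((RoseTree.nodup_leafList h.1).filter _), ← hP'.2]
      congr 1
      ext v
      simpa [hmem] using @hP'.1 v)
    simp only [Share.cost, Offer.hiShare, hvec, ha.aggregate] at this
    rwa [h.eval_aggregate hPl, h.eval_aggregate hP'.1, hPc, hP'.2] at this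
  obtain ⟨h1, h2⟩ := isLexicominimum_of_digitSum_le (by omega) ⟨hPl, hPc⟩ hsum
  have hout : (output x).val = (P, x.hi) := by simp [output, hPdef]
  rw [hout]
  refine ⟨⟨hPnd, ?_, ?_, hx.hi_size, fun i _ => ?_⟩, ?_⟩
  · convert h1
  · convert h2 _ failureCount_univ
  · rw [hx.hi i, hvec, ← h.failureCount_eq hPl]
  · have := hx.hiTime []
    rw [hz] at this
    simp only [output, Timed.time_bind, op_time]
    omega

end

end ReplicaPlacement

namespace ReplicaPlacement

variable {V : Type} [Fintype V] {A : V → V → Prop} {t : RoseTree V}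

/-! ## The three versions -/

theorem Describes.leaves_eq (h : t.Represents A) {a : InfoTree V} (ha : Describes a t) :
    a.leaves = (leafSet A).card := by
  classical
  rw [← ha.valid.card_leafMultiset, ha.leaves, h.leafSet_eq,
    List.toFinset_card_of_nodup (RoseTree.nodup_leafList h.1), Multiset.coe_card]

theorem Conquers.isSolution_output {a : InfoTree V} {ρ B : ℕ} {dim : ℕ → ℕ} {d : DividedTree V}
    (hd : Conquers dim B ρ d a) (h : t.Represents A) (ha : Describes a t) (hB : 2 * a.size < B)
    (hdim : dim ρ = ρ + 1) :
    IsSolution A ρ (output (conquer dim d).val).val ∧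
      (output (conquer dim d).val).time ≤ 2 * a.size := by
  obtain ⟨z, hz, hx, ho⟩ := hd
  rw [hdim] at hx
  exact ReplicaPlacement.isSolution_output h ha hB hz hx ho

theorem basicAlgorithm_spec (h : t.Represents A) {ρ : ℕ} (hρ : 0 < ρ)
    (hρ' : ρ < (leafSet A).card) :
    IsSolution A ρ (basicAlgorithm t ρ).val ∧
      (basicAlgorithm t ρ).time ≤ 120000 * (Fintype.card V * ρ) := by
  obtain ⟨ha, -, hat⟩ := annotate_spec false t
  rw [← ha.size] at hat
  simp only [basicAlgorithm, Timed.val_bind, Timed.time_bind]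
  generalize (annotate false t).val = a at *
  generalize (annotate false t).time = T at *
  obtain ⟨hd, hdt⟩ := divide_spec false a.size a ρ ha.valid le_rfl hρ (ha.leaves_eq h ▸ hρ'.le)
  obtain ⟨hc, hct⟩ := hd.conquers_basic (B := 2 * a.size + 1) hρ (by omega) le_rfl
  obtain ⟨hs, hst⟩ := hc.isSolution_output h ha (by omega) rfl
  refine ⟨hs, ?_⟩
  rw [h.card, ← ha.size]
  have h1 : a.size ≤ a.size * ρ := Nat.le_mul_of_pos_right _ hρ
  have h2 : 20000 * (ρ + 2) * a.size = 20000 * (a.size * ρ) + 40000 * a.size := by ring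
  omega

theorem compactAlgorithm_spec (h : t.Represents A) {ρ : ℕ} (hρ : 0 < ρ)
    (hρ' : ρ < (leafSet A).card) :
    IsSolution A ρ (compactAlgorithm t ρ).val ∧
      (compactAlgorithm t ρ).time ≤ 120000 * (Fintype.card V + ρ ^ 2) := by
  obtain ⟨ha, hbr, hat⟩ := annotate_spec true t
  rw [← ha.size] at hat
  simp only [compactAlgorithm, Timed.val_bind, Timed.time_bind]
  have hbr := hbr rfl
  generalize (annotate true t).val = a at *
  generalize (annotate true t).time = T at *
  obtain ⟨hd, hdt⟩ := divide_spec true a.size a ρ ha.valid le_rfl hρ (ha.leaves_eq h ▸ hρ'.le)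
  obtain ⟨hc, hct⟩ := hd.conquers_compact (B := 2 * a.size + 1) hbr (by omega)
  obtain ⟨hs, hst⟩ := hc.isSolution_output h ha (by omega) rfl
  refine ⟨hs, ?_⟩
  rw [h.card, ← ha.size]
  have h1 : (ρ - 1) ^ 2 ≤ ρ ^ 2 := Nat.pow_le_pow_left (Nat.sub_le _ _) 2
  omega

/-- Passes from the binary logarithm to the natural one. The potential is in `ρ - 1` and so vanishes
at `ρ = 1`, as `ρ log ρ` does. -/
theorem potential_le (ρ : ℕ) :
    (((ρ - 1) + (ρ - 1) * Nat.log 2 (ρ - 1) : ℕ) : ℝ) ≤ 3 * (ρ * Real.log ρ) := by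
  rcases (by omega : ρ = 0 ∨ ρ = 1 ∨ 2 ≤ ρ) with rfl | rfl | hρ
  · simp
  · simp
  have h2 := Real.log_two_gt_d9
  have hlog : Real.log 2 ≤ Real.log ρ := Real.log_le_log two_pos (by exact_mod_cast hρ)
  have hnat : (Nat.log 2 (ρ - 1) : ℝ) * Real.log 2 ≤ Real.log ρ := by
    have h1 : (Nat.log 2 (ρ - 1) : ℝ) ≤ Nat.log 2 ρ := by
      exact_mod_cast Nat.log_mono_right (Nat.sub_le ρ 1)
    have h3 := h1.trans (Real.natLog_le_logb ρ 2)
    rw [Nat.cast_ofNat, Real.logb, le_div_iff₀ (by linarith)] at h3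
    exact h3
  have hp : ((ρ - 1 : ℕ) : ℝ) ≤ ρ := by exact_mod_cast Nat.sub_le ρ 1
  -- Since `ρ ≥ 2`, both `1` and the binary logarithm are at most `log ρ / log 2`, and `2 / log 2 <
  -- 3`.
  have hx : (1 + Nat.log 2 (ρ - 1) : ℝ) ≤ 3 * Real.log ρ := by
    have := (Nat.log 2 (ρ - 1)).cast_nonneg (α := ℝ)
    nlinarith
  calc (((ρ - 1) + (ρ - 1) * Nat.log 2 (ρ - 1) : ℕ) : ℝ)
      = ((ρ - 1 : ℕ) : ℝ) * (1 + Nat.log 2 (ρ - 1)) := by push_cast; ring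
    _ ≤ ρ * (3 * Real.log ρ) := mul_le_mul hp hx (by positivity) (by positivity)
    _ = 3 * (ρ * Real.log ρ) := by ring

theorem chainAlgorithm_spec (h : t.Represents A) {ρ : ℕ} (hρ : 0 < ρ)
    (hρ' : ρ < (leafSet A).card) :
    IsSolution A ρ (chainAlgorithm t ρ).val ∧
      ((chainAlgorithm t ρ).time : ℝ) ≤
        (120000 : ℕ) * (Fintype.card V + ρ * Real.log ρ) := by
  obtain ⟨ha, -, hat⟩ := annotate_spec false t
  rw [← ha.size] at hat
  simp only [chainAlgorithm, Timed.val_bind, Timed.time_bind]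
  generalize (annotate false t).val = a at *
  generalize (annotate false t).time = T at *
  obtain ⟨hd, hdt⟩ := divide_spec true a.size a ρ ha.valid le_rfl hρ (ha.leaves_eq h ▸ hρ'.le)
  obtain ⟨⟨hc, hct⟩, -⟩ := hd.chainSpec (B := 2 * a.size + 1) (by omega)
  obtain ⟨hs, hst⟩ := hc.isSolution_output h ha (by omega) rfl
  refine ⟨hs, ?_⟩
  rw [h.card, ← ha.size]
  refine le_trans (b := ((120000 * a.size +
    40000 * ((ρ - 1) + (ρ - 1) * Nat.log 2 (ρ - 1)) : ℕ) : ℝ)) (Nat.cast_le.2 (by omega)) ?_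
  have := potential_le ρ
  push_cast at this ⊢
  linarith

end ReplicaPlacement

theorem mainTheorem5 :
    ∃ K : ℕ, ∀ (V : Type) [Fintype V] (A : V → V → Prop) (t : ReplicaPlacement.RoseTree V),
      t.Represents A →
      ∀ ρ : ℕ, 0 < ρ → ρ < (ReplicaPlacement.leafSet A).card →
        (ReplicaPlacement.IsSolution A ρ (ReplicaPlacement.basicAlgorithm t ρ).val ∧
          (ReplicaPlacement.basicAlgorithm t ρ).time ≤ K * (Fintype.card V * ρ)) ∧
        (ReplicaPlacement.IsSolution A ρ (ReplicaPlacement.compactAlgorithm t ρ).val ∧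
          (ReplicaPlacement.compactAlgorithm t ρ).time ≤ K * (Fintype.card V + ρ ^ 2)) ∧
        (ReplicaPlacement.IsSolution A ρ (ReplicaPlacement.chainAlgorithm t ρ).val ∧
          ((ReplicaPlacement.chainAlgorithm t ρ).time : ℝ) ≤
            K * (Fintype.card V + ρ * Real.log ρ)) :=
  ⟨120000, fun _ _ _ _ h _ h₁ h₂ => ⟨ReplicaPlacement.basicAlgorithm_spec h h₁ h₂,
    ReplicaPlacement.compactAlgorithm_spec h h₁ h₂, ReplicaPlacement.chainAlgorithm_spec h h₁ h₂⟩⟩
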